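/- **One-loop all-plus amplitudes from axion exchange.** Let $\mathfrak g$ be a finite-dimensional simple complex Lie algebra, $V$ a finite-dimensional representation of $\mathfrak g$ (the "fundamental" representation) with trace $\mathrm{tr}$, and $R$ a finite-dimensional representation (the matter, possibly $0$). Put $\mathrm{Tr}=\mathrm{tr}_{\rm adj}-\mathrm{tr}_R$, and assume that $\lambda_{\mathfrak g}\in\mathbb C$ satisfies $\mathrm{Tr}(X^4)=\lambda_{\mathfrak g}^2\,\mathrm{tr}(X^2)^2$ for all $X\in\mathfrak g$. (With suitable normalisations this is the case for $\mathfrak{sl}_2,\mathfrak{sl}_3,\mathfrak{so}_8$ and the exceptional algebras with $R=0$, and for $\mathfrak{sl}_N$ with $R$ equal to $N$ copies of the fundamental plus $N$ copies of the anti-fundamental.) Let $\hat\lambda=\lambda_{\mathfrak g}/((2\pi i)^{3/2}\sqrt{12})$ and $K(x,y)=\mathrm{tr}(xy)$. *The chiral algebra.* It has generators $J_x[r,s]$, $\tilde J_x[r,s]$ (linear in $x\in\mathfrak g$; $r,s\ge 0$), $E[r,s]$ ($r+s>0$) and $F[r,s]$ ($r,s\ge0$), of spins $1-\frac{r+s}2$,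 $-1-\frac{r+s}2$, $-\frac{r+s}2$, $-\frac{r+s}2$ and dimensions $-r-s$, $-r-s-2$, $-r-s$, $-r-s-2$. Its OPEs (operators on the right are placed at $w$) are $$J_x[r,s](z)J_y[t,u](w)\sim\frac{J_{[x,y]}[r+t,s+u]+\hat\lambda K(x,y)\big((ru-st)F[r+t-1,s+u-1]+(r+s)\,\partial E[r+t,s+u]\big)}{z-w}+\frac{\hat\lambda K(x,y)(r+s+t+u)E[r+t,s+u]}{(z-w)^2},$$ $$J_x[r,s](z)\tilde J_y[t,u](w)\sim\frac{\tilde J_{[x,y]}[r+t,s+u]}{z-w},\qquad J_x[r,s](z)E[t,u](w)\sim\hat\lambda\,\frac{ts-ur}{t+u}\,\frac{\tilde J_x[r+t-1,s+u-1]}{z-w},$$ $$J_x[r,s](z)F[t,u](w)\sim\hat\lambda\,\frac{r+s}{t+u+2}\,\frac{\partial\tilde J_x[r+t,s+u]}{z-w}+\hat\lambda\Big(1+\frac{r+s}{t+u+2}\Big)\frac{\tilde J_x[r+t,s+u]}{(z-w)^2},$$ and all OPEs among $\tilde J,E,F$ are regular. *Conformal blocks.* A conformal block is a system of correlation functions of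 the generators at pairwise distinct points of $\mathbb C$ that is independent of the order of the insertions, linear in the colour arguments, rational in the positions with poles only at coincident points, has the polar parts given by the OPEs (with $\partial$ of an operator acting as the derivative of the correlator), and is $O(|z|^{-2h})$ as the position $z$ of an operator of spin $h$ tends to $\infty$. A conformal block of $(\mathrm{tr}\,\rho)^2$ with normalisation $N\in\mathbb C$ is a conformal block such that: a correlator vanishes unless the dimensions of the inserted operators add up to $-4$; a correlator vanishes if it contains some $\tilde J$, some $E$, or some $F[r,s]$ with $r+s>0$; $\langle F[0,0](z_1)F[0,0](z_2)\rangle=N$; and every other two-point function of generators vanishes. *Kinematics.* Let $J_x(\mu,z)=\sum_{r,s\ge0}\frac{(\mu^{\dot1})^r(\mu^{\dot2})^s}{r!\,s!}J_x[r,s](z)$ for $\mu\in\mathbb C^2$, and $\langle ij\rangle=z_i-z_j$, $[ij]=\mu_i^{\dot1}\mu_j^{\dot2}-\mu_i^{\dot2}\mu_j^{\dot1}$. **Statement.** For every $N$ a conformal block of $(\mathrm{tr}\,\rho)^2$ with normalisation $N$ exists. In every such block, for all $n$, all $x_1,\dots,x_n\in\mathfrak g$, all pairwise distinct $z_1,\dots,z_n\in\mathbb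 C$ and all $\mu_1,\dots,\mu_n\in\mathbb C^2$ that satisfy momentum conservation $\sum_i\mu_i=0$, $\sum_i z_i\mu_i=0$, only finitely many terms contribute to the correlator of generating functions, and $$\big\langle(\mathrm{tr}\,\rho)^2\,\big|\,J_{x_1}(\mu_1,z_1)\cdots J_{x_n}(\mu_n,z_n)\big\rangle=\frac{N}{24(2\pi i)^3}\cdot\frac1n\sum_{\sigma\in S_n}\frac{\sum_{1\le i_1<i_2<i_3<i_4\le n}\langle\sigma_{i_1}\sigma_{i_2}\rangle[\sigma_{i_2}\sigma_{i_3}]\langle\sigma_{i_3}\sigma_{i_4}\rangle[\sigma_{i_4}\sigma_{i_1}]}{\langle\sigma_1\sigma_2\rangle\langle\sigma_2\sigma_3\rangle\cdots\langle\sigma_n\sigma_1\rangle}\,\mathrm{Tr}(x_{\sigma_1}\cdots x_{\sigma_n}).$$ The right-hand side (read as $0$ for $n<4$) is, up to the constant factor, the colour-dressed one-loop all-plus amplitude; for $N=24(2\pi i)^3$ the constant is $1$. -/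

import Mathlib

open Filter Topology Asymptotics
open scoped Nat

noncomputable section

namespace AxionChiralAlgebra

/-- Generators of the chiral algebra: the towers `J[r,s]`, `Jt[r,s]` (that is, J-tilde) with a
colour index contracted with an element of the gauge Lie algebra, and the two axion towers
`E[r,s]` (with `r + s > 0`) and `F[r,s]`. -/
inductive Gen (g : Type*) where
  | J (x : g) (r s : ℕ)
  | Jt (x : g) (r s : ℕ)
  | E (r s : ℕ) (pos : 0 < r + s)
  | F (r s : ℕ)

namespace Gen

variable {g : Type*}

/-- The generator belongs to the `J` tower. -/
def IsJ : Gen g → Prop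
  | J _ _ _ => True
  | _ => False

/-- Twice the two-dimensional spin. -/
def twiceSpin : Gen g → ℤ
  | J _ r s => 2 - (r + s)
  | Jt _ r s => -2 - (r + s)
  | E r s _ => -(r + s)
  | F r s => -(r + s)

/-- The charge under scaling of four-dimensional space. -/
def dim : Gen g → ℤ
  | J _ r s => -(r + s)
  | Jt _ r s => -(r + s) - 2
  | E r s _ => -(r + s)
  | F r s => -(r + s) - 2

end Gen

section Algebra

variable {g : Type*} [LieRing g] [LieAlgebra ℂ g]

/-- The pairing `tr(t_a t_b)` in the representation `V`. -/
def trPair (V : Type*) [AddCommGroup V] [Module ℂ V] [LieRingModule g V] [LieModule ℂ g V]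
    (x y : g) : ℂ :=
  LinearMap.trace ℂ V (LieModule.toEnd ℂ g V x * LieModule.toEnd ℂ g V y)

/-- The trace `Tr` of a word in `g`: the trace in the adjoint representation minus the trace in the
matter representation `R` (take `R = 0` for a theory without matter). -/
def gaugeTrace (R : Type*) [AddCommGroup R] [Module ℂ R] [LieRingModule g R] [LieModule ℂ g R]
    (l : List g) : ℂ :=
  LinearMap.trace ℂ g (l.map (LieAlgebra.ad ℂ g)).prod
    - LinearMap.trace ℂ R (l.map (LieModule.toEnd ℂ g R)).prod

/-- The axion coupling `lam / ((2 π i)^(3/2) √12)`. -/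
def axionCoupling (lam : ℂ) : ℂ :=
  lam / ((2 * Real.pi * Complex.I) ^ (3 / 2 : ℂ) * (Real.sqrt 12 : ℂ))

/-- The polar part at `ζ = w` of `⟨ J_x[r,s](ζ) b(w) ⋯ ⟩`, where `C c v` stands for the correlator
`⟨ c(v) ⋯ ⟩` with the other insertions held fixed. A derivative of an operator is the derivative of
its correlator. The truncated subtractions only occur with a vanishing coefficient. -/
def polarPart (V : Type*) [AddCommGroup V] [Module ℂ V] [LieRingModule g V] [LieModule ℂ g V]
    (lam : ℂ) (x : g) (r s : ℕ) (b : Gen g) (C : Gen g → ℂ → ℂ) (ζ w : ℂ) : ℂ :=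
  match b with
  | .J y t u =>
      (C (.J ⁅x, y⁆ (r + t) (s + u)) w
        + axionCoupling lam * trPair V x y * ((r : ℂ) * u - (s : ℂ) * t)
            * C (.F (r + t - 1) (s + u - 1)) w) / (ζ - w)
      + if h : 0 < (r + t) + (s + u) then
          axionCoupling lam * trPair V x y *
            (((r : ℂ) + s) * deriv (C (.E (r + t) (s + u) h)) w / (ζ - w)
              + ((r : ℂ) + s + t + u) * C (.E (r + t) (s + u) h) w / (ζ - w) ^ 2)
        else 0
  | .Jt y t u => C (.Jt ⁅x, y⁆ (r + t) (s + u)) w / (ζ - w)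
  | .E t u _ =>
      axionCoupling lam * (((t : ℂ) * s - (u : ℂ) * r) / ((t : ℂ) + u))
        * C (.Jt x (t + r - 1) (s + u - 1)) w / (ζ - w)
  | .F t u =>
      axionCoupling lam *
        ((((r : ℂ) + s) / ((t : ℂ) + u + 2)) * deriv (C (.Jt x (r + t) (s + u))) w / (ζ - w)
          + (1 + ((r : ℂ) + s) / ((t : ℂ) + u + 2)) * C (.Jt x (r + t) (s + u)) w / (ζ - w) ^ 2)

/-- A system of correlation functions of the generators; only the values at pairwise distinct
points are meaningful. -/
abbrev Correlators (g : Type*) : Type _ :=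
  (n : ℕ) → (Fin n → Gen g) → (Fin n → ℂ) → ℂ

open Matrix in
/-- A conformal block of the chiral algebra: correlation functions of the generators that do not
depend on the order of the insertions, are linear in colour, are rational with poles only at
coincident points, have the poles dictated by the operator product expansion, and have the
behaviour at infinity dictated by the spin. -/
structure IsConformalBlock (V : Type*) [AddCommGroup V] [Module ℂ V] [LieRingModule g V]
    [LieModule ℂ g V] (lam : ℂ) (ψ : Correlators g) : Prop where
  symmetric : ∀ (n : ℕ) (τ : Equiv.Perm (Fin n)) (A : Fin n → Gen g) (z : Fin n → ℂ),
    Function.Injective z → ψ n (A ∘ τ) (z ∘ τ) = ψ n A z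
  linear_J : ∀ (n : ℕ) (A : Fin n → Gen g) (z : Fin (n + 1) → ℂ) (c : ℂ) (x y : g) (r s : ℕ),
    Function.Injective z →
      ψ (n + 1) (vecCons (.J (c • x + y) r s) A) z
        = c * ψ (n + 1) (vecCons (.J x r s) A) z + ψ (n + 1) (vecCons (.J y r s) A) z
  linear_Jt : ∀ (n : ℕ) (A : Fin n → Gen g) (z : Fin (n + 1) → ℂ) (c : ℂ) (x y : g) (r s : ℕ),
    Function.Injective z →
      ψ (n + 1) (vecCons (.Jt (c • x + y) r s) A) z
        = c * ψ (n + 1) (vecCons (.Jt x r s) A) z + ψ (n + 1) (vecCons (.Jt y r s) A) z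
  rational : ∀ (n : ℕ) (A : Fin n → Gen g), ∃ (P : MvPolynomial (Fin n) ℂ) (m : ℕ),
    ∀ z : Fin n → ℂ, Function.Injective z →
      ψ n A z = MvPolynomial.eval z P / (∏ i, ∏ j ∈ Finset.Ioi i, (z i - z j)) ^ m
  ope_J : ∀ (n : ℕ) (x : g) (r s : ℕ) (b : Gen g) (A : Fin n → Gen g) (w : ℂ) (z : Fin n → ℂ),
    Function.Injective (vecCons w z) →
      (fun ζ : ℂ => ψ (n + 2) (vecCons (.J x r s) (vecCons b A)) (vecCons ζ (vecCons w z))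
          - polarPart V lam x r s b (fun c v => ψ (n + 1) (vecCons c A) (vecCons v z)) ζ w)
        =O[𝓝[≠] w] (fun _ => (1 : ℂ))
  ope_regular : ∀ (n : ℕ) (a b : Gen g) (A : Fin n → Gen g) (w : ℂ) (z : Fin n → ℂ),
    ¬ a.IsJ → ¬ b.IsJ → Function.Injective (vecCons w z) →
      (fun ζ : ℂ => ψ (n + 2) (vecCons a (vecCons b A)) (vecCons ζ (vecCons w z)))
        =O[𝓝[≠] w] (fun _ => (1 : ℂ))
  at_infinity : ∀ (n : ℕ) (a : Gen g) (A : Fin n → Gen g) (z : Fin n → ℂ),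
    Function.Injective z →
      (fun ζ : ℂ => ψ (n + 1) (vecCons a A) (vecCons ζ z))
        =O[cocompact ℂ] (fun ζ : ℂ => ζ ^ (-a.twiceSpin))

/-- A conformal block of the operator `(tr ρ)²`, normalised by `⟨F[0,0] F[0,0]⟩ = N`. The operator
has dimension `4`; it is quadratic in the axion and involves no other field, so that `F[0,0] F[0,0]`
is its only non-zero two-point function (in particular there is no admixture of the gluon operator
`tr F²`), and insertions of `Jt`, `E`, or `F[r,s]` with `r + s > 0` give zero. -/
structure IsTrRhoSqBlock (V : Type*) [AddCommGroup V] [Module ℂ V] [LieRingModule g V]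
    [LieModule ℂ g V] (lam N : ℂ) (ψ : Correlators g) : Prop
    extends IsConformalBlock V lam ψ where
  dimension : ∀ (n : ℕ) (A : Fin n → Gen g) (z : Fin n → ℂ), Function.Injective z →
    ∑ i, (A i).dim ≠ -4 → ψ n A z = 0
  vanishing : ∀ (n : ℕ) (A : Fin n → Gen g) (z : Fin n → ℂ), Function.Injective z →
    (∃ i, ¬ (A i).IsJ ∧ A i ≠ .F 0 0) → ψ n A z = 0
  two_point : ∀ z : Fin 2 → ℂ, Function.Injective z → ψ 2 ![.F 0 0, .F 0 0] z = N
  two_point_other : ∀ (a b : Gen g) (z : Fin 2 → ℂ), Function.Injective z →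
    ¬ (a = .F 0 0 ∧ b = .F 0 0) → ψ 2 ![a, b] z = 0

/-- The correlator `⟨ J_{x_1}(μ_1,z_1) ⋯ J_{x_n}(μ_n,z_n) ⟩` of the generating functions
`J(μ,z) = ∑_{r,s} (μ^1)^r (μ^2)^s / (r! s!) J[r,s](z)`. -/
def generatingCorrelator (ψ : Correlators g) (n : ℕ) (x : Fin n → g) (μ : Fin n → Fin 2 → ℂ)
    (z : Fin n → ℂ) : ℂ :=
  ∑ᶠ m : Fin n → ℕ × ℕ,
    (∏ i, μ i 0 ^ (m i).1 * μ i 1 ^ (m i).2 / (((m i).1)! * ((m i).2)!))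
      * ψ n (fun i => .J (x i) (m i).1 (m i).2) z

/-- `⟨ij⟩` -/
def angle {n : ℕ} (z : Fin n → ℂ) (i j : Fin n) : ℂ := z i - z j

/-- `[ij]` -/
def square {n : ℕ} (μ : Fin n → Fin 2 → ℂ) (i j : Fin n) : ℂ :=
  μ i 0 * μ j 1 - μ i 1 * μ j 0

/-- The colour-ordered one-loop all-plus amplitude
`∑_{i₁<i₂<i₃<i₄} ⟨i₁i₂⟩[i₂i₃]⟨i₃i₄⟩[i₄i₁] / (⟨12⟩⟨23⟩⋯⟨n1⟩)`. -/
def colourOrderedAmplitude (n : ℕ) (μ : Fin n → Fin 2 → ℂ) (z : Fin n → ℂ) : ℂ :=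
  (∑ i₁, ∑ i₂ ∈ Finset.Ioi i₁, ∑ i₃ ∈ Finset.Ioi i₂, ∑ i₄ ∈ Finset.Ioi i₃,
      angle z i₁ i₂ * square μ i₂ i₃ * angle z i₃ i₄ * square μ i₄ i₁)
    / ∏ i, angle z i (finRotate n i)

/-- The full one-loop all-plus amplitude, with colour factors. -/
def allPlusAmplitude (R : Type*) [AddCommGroup R] [Module ℂ R] [LieRingModule g R]
    [LieModule ℂ g R] (n : ℕ) (x : Fin n → g) (μ : Fin n → Fin 2 → ℂ) (z : Fin n → ℂ) : ℂ :=
  (1 / (n : ℂ)) * ∑ σ : Equiv.Perm (Fin n),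
    colourOrderedAmplitude n (μ ∘ σ) (z ∘ σ) * gaugeTrace R (List.ofFn (x ∘ σ))

end Algebra

end AxionChiralAlgebra

end

set_option linter.unusedSectionVars false

/-! The operator (tr ρ)² is quadratic in the axion, so its correlators are sums over the ways to
divide the insertions into two groups, each absorbing one axion field. A group of gluons whose two
mode numbers each add up to 1 contributes −λ̂ times its Parke-Taylor sum of traces in V times the
sum of ω i j (z i − z j) over its pairs; a lone F[0,0] contributes 1 (`component`). The sum over
groupings is `axionBlock`. It has the required poles because a Parke-Taylor factor expands in
partial fractions in the position of one letter, with brackets as residues (`component_insert`),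
while a group of just two gluons supplies the F term of the operator product.

The block is unique (`IsTrRhoSqBlock.eq`). Among three or more insertions of gluons and F[0,0] of
total dimension −4 there is a gluon J[r,s] with r + s ≤ 1. Its spin is positive, so the correlator
decays in its position; the poles are fixed by correlators with fewer points, and Liouville's
theorem fixes the rest. One-point functions vanish because a simple Lie algebra is spanned by
brackets.

Summing over modes turns the generating correlator into (N/2) λ̂² times `doubleTrace`, and the
amplitude is `singleTrace`. What remains is an identity on the locus of momentum conservation,
`singleTrace_eq_doubleTrace`, with factor λ². It is proved by induction on the number of labels in a
polarised form, where the two square brackets become independent conserved antisymmetric pairings ω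
and ω'. Both sides are linear in ω', and conserved pairings are spanned by ones supported on at most
four labels, so with five or more labels some label m decouples from ω'. Let the position ζ of m
vary, correcting ω by (ζ − z m) η to keep it conserved. The numerators are affine in ζ and the
Parke-Taylor factors decay quadratically, so each side is the sum of its poles at the z j, where it
reduces to the same expression with m merged into j (`singleTrace_insert`, `doubleTrace_insert`).
For four labels a conserved pairing is unique up to a factor, and the identity is the polarisation
of Tr(X⁴) = λ² tr(X²)². -/

namespace AxionChiralAlgebra

/-! ### Orderings, Parke-Taylor denominators and partial fractions -/

section Words

variable {ι : Type*}

/-- The orderings of a finite set of labels. -/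
def orderings (S : Finset ι) : Finset (List ι) :=
  ⟨S.val.lists, Multiset.lists_nodup_finset S⟩

lemma mem_orderings {S : Finset ι} {l : List ι} :
    l ∈ orderings S ↔ l.Nodup ∧ ∀ a, a ∈ l ↔ a ∈ S := by
  have : l ∈ orderings S ↔ S.val = (l : Multiset ι) := Multiset.mem_lists_iff _ _
  rw [this]
  constructor
  · intro h
    refine ⟨?_, fun a => ?_⟩
    · rw [← Multiset.coe_nodup, ← h]; exact S.nodup
    · rw [← Multiset.mem_coe, ← h]; rfl
  · rintro ⟨h1, h2⟩
    exact (Multiset.Nodup.ext S.nodup (Multiset.coe_nodup.2 h1)).2 fun a => by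
      rw [Multiset.mem_coe, h2]; rfl

lemma rotate_mem_orderings {S : Finset ι} {l : List ι} (k : ℕ) :
    l.rotate k ∈ orderings S ↔ l ∈ orderings S := by
  simp [mem_orderings]

/-- The product of the differences of consecutive positions along a word. -/
def path (z : ι → ℂ) : List ι → ℂ
  | [] => 1
  | [_] => 1
  | a :: b :: l => (z a - z b) * path z (b :: l)

/-- The Parke-Taylor denominator of a cyclic word. -/
def cyc (z : ι → ℂ) : List ι → ℂ
  | [] => 1
  | a :: l => path z (a :: l ++ [a])

lemma path_append_pair (z : ι → ℂ) (l : List ι) (a b : ι) :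
    path z (l ++ [a, b]) = path z (l ++ [a]) * (z a - z b) := by
  induction l with
  | nil => simp [path]
  | cons c l ih =>
    rcases l with _ | ⟨d, l⟩
    · simp [path]
    · simp only [List.cons_append, path] at ih ⊢
      rw [ih]; ring

lemma cyc_append_singleton (z : ι → ℂ) (a : ι) (l : List ι) :
    cyc z (l ++ [a]) = cyc z (a :: l) := by
  rcases l with _ | ⟨b, t⟩
  · rfl
  · have := path_append_pair z (b :: t) a b
    simp only [List.cons_append, cyc, path, List.append_assoc, List.nil_append] at this ⊢
    rw [this]; ring

lemma cyc_cons_cons_append (z : ι → ℂ) (m b a : ι) (t : List ι) :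
    cyc z (m :: b :: t ++ [a]) = (z m - z b) * path z (b :: t ++ [a]) * (z a - z m) := by
  have := path_append_pair z (b :: t) a m
  simp only [List.cons_append, cyc, path, List.append_assoc, List.nil_append] at this ⊢
  rw [this]; ring

lemma cyc_cons_append (z : ι → ℂ) (b a : ι) (t : List ι) :
    cyc z (b :: t ++ [a]) = path z (b :: t ++ [a]) * (z a - z b) := by
  have := path_append_pair z (b :: t) a b
  simp only [List.cons_append, cyc, List.append_assoc, List.nil_append] at this ⊢
  rw [this]

lemma path_ne_zero {z : ι → ℂ} {l : List ι} (hz : ∀ i ∈ l, ∀ j ∈ l, z i = z j → i = j)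
    (hl : l.Nodup) : path z l ≠ 0 := by
  induction l with
  | nil => simp [path]
  | cons a l ih =>
    rcases l with _ | ⟨b, l⟩
    · simp [path]
    · simp only [path]
      refine mul_ne_zero (fun h => ?_) (ih (fun i hi j hj => hz i (by simp_all) j (by simp_all))
        hl.of_cons)
      have := hz a (by simp) b (by simp) (sub_eq_zero.1 h)
      simp [this] at hl

lemma path_congr {z z' : ι → ℂ} {l : List ι} (h : ∀ i ∈ l, z i = z' i) : path z l = path z' l := by
  induction l with
  | nil => simp [path]
  | cons a l ih =>
    rcases l with _ | ⟨b, l⟩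
    · simp [path]
    · simp only [path]
      rw [h a (by simp), h b (by simp), ih fun i hi => h i (by simp_all)]

lemma cyc_congr {z z' : ι → ℂ} {l : List ι} (h : ∀ i ∈ l, z i = z' i) : cyc z l = cyc z' l := by
  rcases l with _ | ⟨a, l⟩
  · rfl
  · exact path_congr fun i hi => h i (by simpa [or_comm, or_assoc] using hi)

lemma exists_eq_cons_append {l : List ι} (h : 2 ≤ l.length) :
    ∃ b t a, l = b :: t ++ [a] := by
  rcases l with _ | ⟨b, l⟩
  · simp at h
  · rcases List.eq_nil_or_concat l with rfl | ⟨t, a, rfl⟩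
    · simp at h
    · exact ⟨b, t, a, by simp⟩

/-- A trace of words in a Lie algebra: cyclic, linear in the letters, and compatible with the
bracket. -/
structure IsColourTrace {g : Type*} [LieRing g] [LieAlgebra ℂ g] (T : List g → ℂ) : Prop where
  rotate : ∀ a l, T (l ++ [a]) = T (a :: l)
  bracket : ∀ a b l, T (⁅a, b⁆ :: l) = T (a :: b :: l) - T (b :: a :: l)
  linear : ∀ (c : ℂ) a b l, T ((c • a + b) :: l) = c * T (a :: l) + T (b :: l)

variable [DecidableEq ι]

lemma toFinset_of_mem_orderings {S : Finset ι} {l : List ι} (h : l ∈ orderings S) :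
    l.toFinset = S := by
  ext a; simp [(mem_orderings.1 h).2]

lemma length_of_mem_orderings {S : Finset ι} {l : List ι} (h : l ∈ orderings S) :
    l.length = S.card := by
  rw [← toFinset_of_mem_orderings h, List.toFinset_card_of_nodup (mem_orderings.1 h).1]

lemma cons_mem_orderings {S : Finset ι} {j : ι} {t : List ι} :
    j :: t ∈ orderings S ↔ j ∈ S ∧ t ∈ orderings (S.erase j) := by
  simp only [mem_orderings, List.nodup_cons, List.mem_cons, Finset.mem_erase]
  constructor
  · rintro ⟨⟨h1, h2⟩, h3⟩
    refine ⟨(h3 j).1 (Or.inl rfl), h2, fun a => ⟨fun ha => ⟨?_, (h3 a).1 (Or.inr ha)⟩, ?_⟩⟩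
    · rintro rfl; exact h1 ha
    · rintro ⟨h4, h5⟩
      exact ((h3 a).2 h5).resolve_left h4
  · rintro ⟨h1, h2, h3⟩
    refine ⟨⟨fun h => ((h3 j).1 h).1 rfl, h2⟩, fun a => ⟨?_, fun ha => ?_⟩⟩
    · rintro (rfl | ha)
      · exact h1
      · exact ((h3 a).1 ha).2
    · by_cases h : a = j
      · exact Or.inl h
      · exact Or.inr ((h3 a).2 ⟨h, ha⟩)

lemma sum_orderings_cons {S : Finset ι} (hS : S.Nonempty) (F : List ι → ℂ) :
    ∑ l ∈ orderings S, F l = ∑ j ∈ S, ∑ t ∈ orderings (S.erase j), F (j :: t) := by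
  rw [Finset.sum_sigma']
  symm
  refine Finset.sum_nbij (fun p => p.1 :: p.2) ?_ ?_ ?_ ?_
  · rintro ⟨j, t⟩ h
    rw [Finset.mem_sigma] at h
    exact cons_mem_orderings.2 h
  · rintro ⟨j, t⟩ _ ⟨k, s⟩ _ h
    simpa using h
  · intro l hl
    rcases l with _ | ⟨j, t⟩
    · obtain ⟨a, ha⟩ := hS
      simpa using ((mem_orderings.1 hl).2 a).2 ha
    · exact ⟨⟨j, t⟩, by simpa using cons_mem_orderings.1 hl, rfl⟩
  · intro _ _; rfl

lemma sum_orderings_rotate (S : Finset ι) (k : ℕ) (F : List ι → ℂ) :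
    ∑ l ∈ orderings S, F (l.rotate k) = ∑ l ∈ orderings S, F l := by
  have hmaps : ∀ l ∈ orderings S, l.rotate k ∈ orderings S :=
    fun l hl => (rotate_mem_orderings k).2 hl
  have hinj : Set.InjOn (fun l : List ι => l.rotate k) (orderings S) :=
    fun a _ b _ h => List.rotate_injective k h
  exact Finset.sum_nbij (fun l => l.rotate k) hmaps hinj
    (Finset.surjOn_of_injOn_of_card_le _ hmaps hinj le_rfl) fun _ _ => rfl

lemma sum_orderings_append_singleton {S : Finset ι} (hS : S.Nonempty) (F : List ι → ℂ) :
    ∑ l ∈ orderings S, F l = ∑ j ∈ S, ∑ t ∈ orderings (S.erase j), F (t ++ [j]) := by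
  rw [← sum_orderings_rotate S 1, sum_orderings_cons hS]
  simp

/-- A rotation invariant function has the same sum over the orderings that start with any given
label. -/
lemma sum_orderings_eq_card_mul {S : Finset ι} {j : ι} (hj : j ∈ S) (F : List ι → ℂ)
    (hF : ∀ a t, a :: t ∈ orderings S → F (t ++ [a]) = F (a :: t)) :
    ∑ l ∈ orderings S, F l = S.card * ∑ t ∈ orderings (S.erase j), F (j :: t) := by
  have hrot1 : ∀ l ∈ orderings S, F (l.rotate 1) = F l := by
    rintro (_ | ⟨a, t⟩) hl
    · simp
    · simpa using hF a t hl
  have hrot : ∀ k, ∀ l ∈ orderings S, F (l.rotate k) = F l := by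
    intro k
    induction k with
    | zero => simp
    | succ k ih =>
      intro l hl
      rw [← List.rotate_rotate, hrot1 _ ((rotate_mem_orderings k).2 hl), ih l hl]
  -- Exactly one rotation brings j to the front, the one by the index of j. Inserting this indicator
  -- and exchanging the sums leaves one copy of the sum over words starting with j for each
  -- rotation.
  have hcount : ∀ l ∈ orderings S,
      ∑ k ∈ Finset.range S.card, (if (l.rotate k).head? = some j then (1 : ℂ) else 0) = 1 := by
    intro l hl
    have hjl : j ∈ l := ((mem_orderings.1 hl).2 j).2 hj
    have hlen := length_of_mem_orderings hl
    rw [Finset.sum_eq_single (l.idxOf j)]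
    · rw [List.head?_rotate (List.idxOf_lt_length_iff.2 hjl)]
      simp [hjl]
    · intro k hk hne
      rw [Finset.mem_range, ← hlen] at hk
      rw [List.head?_rotate hk, if_neg]
      intro h
      apply hne
      rw [List.getElem?_eq_getElem hk, Option.some_inj] at h
      rw [← h, (mem_orderings.1 hl).1.idxOf_getElem]
    · intro h
      exact absurd (Finset.mem_range.2 (hlen ▸ List.idxOf_lt_length_iff.2 hjl)) h
  calc ∑ l ∈ orderings S, F l
      = ∑ l ∈ orderings S, ∑ k ∈ Finset.range S.card,
          (if (l.rotate k).head? = some j then F (l.rotate k) else 0) := by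
        refine Finset.sum_congr rfl fun l hl => ?_
        conv_lhs => rw [← mul_one (F l), ← hcount l hl, Finset.mul_sum]
        refine Finset.sum_congr rfl fun k _ => ?_
        rw [hrot k l hl]; simp
    _ = ∑ k ∈ Finset.range S.card, ∑ l ∈ orderings S, (if l.head? = some j then F l else 0) := by
        rw [Finset.sum_comm]
        refine Finset.sum_congr rfl fun k _ => ?_
        rw [sum_orderings_rotate S k fun l => if l.head? = some j then F l else 0]
    _ = S.card * ∑ t ∈ orderings (S.erase j), F (j :: t) := by
        rw [Finset.sum_const, Finset.card_range, nsmul_eq_mul, sum_orderings_cons ⟨j, hj⟩]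
        congr 1
        rw [Finset.sum_eq_single j]
        · simp
        · intro k _ hk; simp [hk]
        · intro h; exact absurd hj h

lemma map_update_cons {α : Type*} {x : ι → α} {S : Finset ι} {j : ι} {t : List ι}
    (h : j :: t ∈ orderings S) (y : α) :
    (j :: t).map (Function.update x j y) = y :: t.map x := by
  have hj : j ∉ t := (List.nodup_cons.1 (mem_orderings.1 h).1).1
  simp only [List.map_cons, Function.update_self, List.cons.injEq, true_and]
  exact List.map_congr_left fun a ha => Function.update_of_ne (by rintro rfl; exact hj ha) _ _

variable {g : Type*} [LieRing g] [LieAlgebra ℂ g]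

/-- Partial fractions for the insertion of one more letter `m` into the Parke-Taylor factors of the
cyclic words in `S`, with numerators that are affine functions of the position of `m`. -/
lemma sum_insertion {T : List g → ℂ} (hT : IsColourTrace T) {S : Finset ι} {m : ι} (hm : m ∉ S)
    (hS : 2 ≤ S.card) {z : ι → ℂ} (hz : Set.InjOn z (insert m S : Finset ι)) (x : ι → g)
    (P Q : List ι → ℂ) (M : ι → List ι → ℂ)
    (hhead : ∀ b t, b :: t ∈ orderings S → P (b :: t) + Q (b :: t) * z b = M b (b :: t))
    (hlast : ∀ a t, a :: t ∈ orderings S →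
      P (t ++ [a]) + Q (t ++ [a]) * z a = M a (a :: t)) :
    ∑ l ∈ orderings S, (P l + Q l * z m) * T (x m :: l.map x) / cyc z (m :: l)
      = ∑ j ∈ S, 1 / (z m - z j) * ∑ t ∈ orderings (S.erase j),
          M j (j :: t) * T ((j :: t).map (Function.update x j ⁅x m, x j⁆)) / cyc z (j :: t) := by
  have hne : S.Nonempty := Finset.card_pos.1 (by omega)
  have hzm : ∀ j ∈ S, z m - z j ≠ 0 := fun j hj h => hm (by
    have := hz (by simp) (by simp [hj]) (sub_eq_zero.1 h)
    rwa [this])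
  -- With first letter b and last letter a, this expands (P + Q ζ) / ((ζ − z b)(z a − ζ)) at ζ = z
  -- m. The numerator is only affine, so there is no polynomial part and each pole carries its value
  -- there. The default m is never reached, as l has at least two letters.
  have key : ∀ l ∈ orderings S, (P l + Q l * z m) * T (x m :: l.map x) / cyc z (m :: l)
      = (P l + Q l * z (l.headD m)) * T (x m :: l.map x) / (z m - z (l.headD m)) / cyc z l
        - (P l + Q l * z (l.getLastD m)) * T (x m :: l.map x) / (z m - z (l.getLastD m))
          / cyc z l := by
    intro l hl
    obtain ⟨b, t, a, rfl⟩ := exists_eq_cons_append (by rw [length_of_mem_orderings hl]; exact hS)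
    have hmem := (mem_orderings.1 hl).2
    have hnd := (mem_orderings.1 hl).1
    have hb : b ∈ S := (hmem b).1 (by simp)
    have ha : a ∈ S := (hmem a).1 (by simp)
    have hab : z a - z b ≠ 0 := fun h => by
      have := hz (by simp [ha]) (by simp [hb]) (sub_eq_zero.1 h)
      subst this
      simp at hnd
    have hp : path z (b :: t ++ [a]) ≠ 0 := path_ne_zero
      (fun i hi j hj h => hz (by simp [(hmem i).1 hi]) (by simp [(hmem j).1 hj]) h) hnd
    have h1 := hzm a ha
    have h1' : z a - z m ≠ 0 := fun h => h1 (by rw [← neg_sub, h, neg_zero])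
    have h2 := hzm b hb
    rw [show m :: (b :: t ++ [a]) = m :: b :: t ++ [a] from rfl, cyc_cons_cons_append,
      cyc_cons_append]
    have e1 : (b :: t ++ [a]).headD m = b := rfl
    have e2 : (b :: t ++ [a]).getLastD m = a := List.getLastD_concat ..
    rw [e1, e2]
    generalize path z (b :: t ++ [a]) = p at *
    generalize P (b :: t ++ [a]) = P0 at *
    generalize Q (b :: t ++ [a]) = Q0 at *
    generalize T (x m :: (b :: t ++ [a]).map x) = T0 at *
    rw [show z a - z m = -(z m - z a) by ring]
    field_simp
    ring
  -- The first terms are grouped by the first letter j, the second ones by the last letter j. After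
  -- a rotation the traces read x m, x j, … and x j, x m, …, and their difference puts the bracket
  -- at j.
  rw [Finset.sum_congr rfl key, Finset.sum_sub_distrib, sum_orderings_cons hne,
    sum_orderings_append_singleton hne, ← Finset.sum_sub_distrib]
  refine Finset.sum_congr rfl fun j hj => ?_
  rw [← Finset.sum_sub_distrib, Finset.mul_sum]
  refine Finset.sum_congr rfl fun t ht => ?_
  have hl : j :: t ∈ orderings S := cons_mem_orderings.2 ⟨hj, ht⟩
  have e2 : (t ++ [j]).getLastD m = j := by simp
  rw [e2, hlast j t hl, show (j :: t).headD m = j from rfl, hhead j t hl, map_update_cons hl,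
    hT.bracket, cyc_append_singleton, List.map_append, List.map_singleton,
    ← List.cons_append, hT.rotate, List.map_cons]
  ring

end Words

/-! ### Sums over ordered subwords and the numerator of the amplitude -/

section OrderedSums

variable {ι : Type*}

/-- The sum of `F a b` over the pairs of letters `a`, `b` that occur in this order in a word. -/
def pairSum (F : ι → ι → ℂ) : List ι → ℂ
  | [] => 0
  | a :: l => (l.map (F a)).sum + pairSum F l

/-- The sum of `F a b c` over the triples of letters that occur in this order in a word. -/
def tripleSum (F : ι → ι → ι → ℂ) : List ι → ℂ
  | [] => 0
  | a :: l => pairSum (F a) l + tripleSum F l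

/-- The sum of `F a b c d` over the quadruples of letters that occur in this order in a word. -/
def quadSum (F : ι → ι → ι → ι → ℂ) : List ι → ℂ
  | [] => 0
  | a :: l => tripleSum (F a) l + quadSum F l

lemma pairSum_append_singleton (F : ι → ι → ℂ) (l : List ι) (d : ι) :
    pairSum F (l ++ [d]) = pairSum F l + (l.map fun a => F a d).sum := by
  induction l with
  | nil => simp [pairSum]
  | cons a l ih => simp [pairSum, ih]; ring

lemma tripleSum_append_singleton (F : ι → ι → ι → ℂ) (l : List ι) (d : ι) :
    tripleSum F (l ++ [d]) = tripleSum F l + pairSum (fun a b => F a b d) l := by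
  induction l with
  | nil => simp [tripleSum, pairSum]
  | cons a l ih => simp [tripleSum, pairSum, ih, pairSum_append_singleton]; ring

lemma quadSum_append_singleton (F : ι → ι → ι → ι → ℂ) (l : List ι) (d : ι) :
    quadSum F (l ++ [d]) = quadSum F l + tripleSum (fun a b c => F a b c d) l := by
  induction l with
  | nil => simp [quadSum, tripleSum]
  | cons a l ih => simp [quadSum, tripleSum, ih, tripleSum_append_singleton]; ring

lemma pairSum_congr {F G : ι → ι → ℂ} {l : List ι} (h : ∀ a ∈ l, ∀ b ∈ l, F a b = G a b) :
    pairSum F l = pairSum G l := by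
  induction l with
  | nil => rfl
  | cons a l ih =>
    simp only [List.mem_cons] at h
    rw [pairSum, pairSum, ih fun b hb c hc => h b (Or.inr hb) c (Or.inr hc),
      List.map_congr_left fun b hb => h a (Or.inl rfl) b (Or.inr hb)]

lemma tripleSum_congr {F G : ι → ι → ι → ℂ} {l : List ι}
    (h : ∀ a ∈ l, ∀ b ∈ l, ∀ c ∈ l, F a b c = G a b c) : tripleSum F l = tripleSum G l := by
  induction l with
  | nil => rfl
  | cons a l ih =>
    simp only [List.mem_cons] at h
    rw [tripleSum, tripleSum,
      ih fun b hb c hc d hd => h b (Or.inr hb) c (Or.inr hc) d (Or.inr hd),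
      pairSum_congr fun b hb c hc => h a (Or.inl rfl) b (Or.inr hb) c (Or.inr hc)]

lemma quadSum_congr {F G : ι → ι → ι → ι → ℂ} {l : List ι}
    (h : ∀ a ∈ l, ∀ b ∈ l, ∀ c ∈ l, ∀ d ∈ l, F a b c d = G a b c d) :
    quadSum F l = quadSum G l := by
  induction l with
  | nil => rfl
  | cons a l ih =>
    simp only [List.mem_cons] at h
    rw [quadSum, quadSum, ih fun b hb c hc d hd e he =>
        h b (Or.inr hb) c (Or.inr hc) d (Or.inr hd) e (Or.inr he),
      tripleSum_congr fun b hb c hc d hd =>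
        h a (Or.inl rfl) b (Or.inr hb) c (Or.inr hc) d (Or.inr hd)]

lemma pairSum_add_mul (F G : ι → ι → ℂ) (s : ℂ) (l : List ι) :
    pairSum (fun a b => F a b + s * G a b) l = pairSum F l + s * pairSum G l := by
  induction l with
  | nil => simp [pairSum]
  | cons a l ih => simp only [pairSum, ih, List.sum_map_add, List.sum_map_mul_left]; ring

lemma tripleSum_add_mul (F G : ι → ι → ι → ℂ) (s : ℂ) (l : List ι) :
    tripleSum (fun a b c => F a b c + s * G a b c) l = tripleSum F l + s * tripleSum G l := by
  induction l with
  | nil => simp [tripleSum]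
  | cons a l ih => simp only [tripleSum, ih, pairSum_add_mul]; ring

lemma quadSum_add_mul (F G : ι → ι → ι → ι → ℂ) (s : ℂ) (l : List ι) :
    quadSum (fun a b c d => F a b c d + s * G a b c d) l = quadSum F l + s * quadSum G l := by
  induction l with
  | nil => simp [quadSum]
  | cons a l ih => simp only [quadSum, ih, tripleSum_add_mul]; ring

lemma quadSum_sum_mul {κ : Type*} (s : Finset κ) (c : κ → ℂ) (F : κ → ι → ι → ι → ι → ℂ)
    (l : List ι) :
    quadSum (fun a b d e => ∑ k ∈ s, c k * F k a b d e) l = ∑ k ∈ s, c k * quadSum (F k) l := by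
  classical
  induction s using Finset.induction_on with
  | empty =>
    have := quadSum_add_mul (fun _ _ _ _ => 0) (fun _ _ _ _ => 0) (-1) l
    simpa using this
  | insert k s hk ih =>
    simp only [Finset.sum_insert hk, ← ih]
    rw [← one_mul (quadSum (fun a b d e => ∑ k ∈ s, c k * F k a b d e) l)]
    have h1 := quadSum_add_mul (fun a b d e => ∑ k ∈ s, c k * F k a b d e) (F k) (c k) l
    rw [one_mul, add_comm, ← h1]
    exact quadSum_congr fun _ _ _ _ _ _ _ _ => add_comm _ _

lemma quadSum_eq_zero_of_length_lt {F : ι → ι → ι → ι → ℂ} {l : List ι} (h : l.length < 4) :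
    quadSum F l = 0 := by
  rcases l with _ | ⟨a, _ | ⟨b, _ | ⟨c, _ | ⟨d, l⟩⟩⟩⟩
  all_goals first | (simp [quadSum, tripleSum, pairSum]; done) | (simp at h; done) | (simp at h; omega)

/-- The sum over the ways to write `l` as `q ++ c :: r` of the product of the sums of `F b c` over
the letters `b` of `p ++ q` and of `G c d` over the letters `d` of `r`. -/
def splitSum (F G : ι → ι → ℂ) : List ι → List ι → ℂ
  | _, [] => 0
  | p, c :: r => (p.map fun b => F b c).sum * (r.map fun d => G c d).sum
      + splitSum F G (p ++ [c]) r

/-- Triples are sorted by their middle letter. The prefix p records the letters already passed; for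
p empty only the triple sum is left. -/
lemma splitSum_eq (F G : ι → ι → ℂ) (p l : List ι) :
    splitSum F G p l = tripleSum (fun b c d => F b c * G c d) l
      + (p.map fun b => pairSum (fun c d => F b c * G c d) l).sum := by
  induction l generalizing p with
  | nil => simp [splitSum, tripleSum, pairSum]
  | cons c r ih =>
    simp only [splitSum, ih, tripleSum, pairSum, List.map_append, List.map_cons, List.map_nil,
      List.sum_append, List.sum_cons, List.sum_nil, List.sum_map_add, List.sum_map_mul_left,
      List.sum_map_mul_right]
    ring

/-- For a fixed middle letter c, the vanishing totals turn the sum of F over letters before c into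
minus the sum over letters after c, and conversely for G. The two signs cancel, so "before" and
"after" are exchanged. -/
lemma tripleSum_mul_comm {F G : ι → ι → ℂ} {l : List ι} (hF0 : ∀ c, F c c = 0)
    (hG0 : ∀ c, G c c = 0) (hF : ∀ c ∈ l, (l.map fun b => F b c).sum = 0)
    (hG : ∀ c ∈ l, (l.map fun d => G c d).sum = 0) :
    tripleSum (fun b c d => F b c * G c d) l = tripleSum (fun b c d => G c b * F d c) l := by
  have key : ∀ r p : List ι, (∀ c ∈ r, ((p ++ r).map fun b => F b c).sum = 0) →
      (∀ c ∈ r, ((p ++ r).map fun d => G c d).sum = 0) →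
      splitSum F G p r = splitSum (fun b c => G c b) (fun c d => F d c) p r := by
    intro r
    induction r with
    | nil => intro p _ _; rfl
    | cons c r ih =>
      intro p h1 h2
      have e1 := h1 c (by simp)
      have e2 := h2 c (by simp)
      simp only [List.map_append, List.map_cons, List.sum_append, List.sum_cons, hF0, hG0,
        zero_add] at e1 e2
      simp only [splitSum]
      rw [ih (p ++ [c]) (fun d hd => by simpa using h1 d (by simp [hd]))
        (fun d hd => by simpa using h2 d (by simp [hd])), eq_neg_of_add_eq_zero_left e1,
        eq_neg_of_add_eq_zero_left e2]
      ring
  have := key l [] (by simpa using hF) (by simpa using hG)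
  rwa [splitSum_eq, splitSum_eq, List.map_nil, List.map_nil, List.sum_nil, add_zero,
    add_zero] at this

/-- The numerator of the colour-ordered one-loop all-plus amplitude of a word, polarised in the
pairing of the momenta. -/
def numerator (z : ι → ℂ) (ω ω' : ι → ι → ℂ) (l : List ι) : ℂ :=
  quadSum (fun a b c d => (z a - z b) * ω b c * (z c - z d) * ω' d a) l

lemma numerator_add_mul_left (z : ι → ℂ) (ω η ω' : ι → ι → ℂ) (s : ℂ) (l : List ι) :
    numerator z (fun i j => ω i j + s * η i j) ω' l
      = numerator z ω ω' l + s * numerator z η ω' l := by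
  rw [numerator, numerator, numerator, ← quadSum_add_mul]
  exact quadSum_congr fun _ _ _ _ _ _ _ _ => by ring

lemma numerator_sum_mul_right {κ : Type*} (s : Finset κ) (c : κ → ℂ) (z : ι → ℂ)
    (ω : ι → ι → ℂ) (θ : κ → ι → ι → ℂ) (l : List ι) :
    numerator z ω (fun i j => ∑ k ∈ s, c k * θ k i j) l
      = ∑ k ∈ s, c k * numerator z ω (θ k) l := by
  simp only [numerator]
  rw [← quadSum_sum_mul]
  refine quadSum_congr fun _ _ _ _ _ _ _ _ => ?_
  rw [Finset.mul_sum]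
  exact Finset.sum_congr rfl fun _ _ => by ring

lemma numerator_congr_right {z : ι → ℂ} {ω ω' θ : ι → ι → ℂ} {l : List ι}
    (h : ∀ i ∈ l, ∀ j ∈ l, ω' i j = θ i j) : numerator z ω ω' l = numerator z ω θ l :=
  quadSum_congr fun a ha _ _ _ _ d hd => by rw [h d hd a ha]

/-- The pairing ω is evaluated at the second and third letters of a quadruple, hence never at the
first letter of the word. By the same token it never meets the last letter. -/
lemma numerator_cons_congr {z : ι → ℂ} {ω θ ω' : ι → ι → ℂ} {b : ι} {t : List ι}
    (h : ∀ i ∈ t, ∀ j ∈ t, ω i j = θ i j) :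
    numerator z ω ω' (b :: t) = numerator z θ ω' (b :: t) := by
  rw [numerator, numerator, quadSum, quadSum]
  congr 1
  · exact tripleSum_congr fun a ha c hc _ _ => by rw [h a ha c hc]
  · exact quadSum_congr fun _ _ a ha c hc _ _ => by rw [h a ha c hc]

lemma numerator_append_singleton_congr {z : ι → ℂ} {ω θ ω' : ι → ι → ℂ} {b : ι} {t : List ι}
    (h : ∀ i ∈ t, ∀ j ∈ t, ω i j = θ i j) :
    numerator z ω ω' (t ++ [b]) = numerator z θ ω' (t ++ [b]) := by
  rw [numerator, numerator, quadSum_append_singleton, quadSum_append_singleton]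
  congr 1
  · exact quadSum_congr fun _ _ a ha c hc _ _ => by rw [h a ha c hc]
  · exact tripleSum_congr fun _ _ a ha c hc => by rw [h a ha c hc]

/-- Every quadruple that starts with m carries a factor ω' d m. -/
lemma numerator_cons_of_eq_zero {z : ι → ℂ} {ω ω' : ι → ι → ℂ} {m : ι} {t : List ι}
    (h : ∀ i ∈ t, ω' i m = 0) : numerator z ω ω' (m :: t) = numerator z ω ω' t := by
  rw [numerator, numerator, quadSum, add_eq_right]
  -- The zero function is written in the shape of `tripleSum_add_mul`, which gives X + (−1) X for
  -- its sum.
  rw [tripleSum_congr (G := fun b c d => 0 + (-1) * 0) fun b _ c _ d hd => by rw [h d hd]; ring]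
  rw [tripleSum_add_mul (fun _ _ _ => 0) (fun _ _ _ => 0)]
  ring

end OrderedSums

/-! ### Conserved pairings and cyclicity of the numerator -/

section Conserved

variable {ι : Type*} [DecidableEq ι]

/-- An antisymmetric pairing of the labels in `S` that satisfies momentum conservation. -/
structure IsConserved (S : Finset ι) (z : ι → ℂ) (ω : ι → ι → ℂ) : Prop where
  antisymm : ∀ i j, ω i j = -ω j i
  sum_eq_zero : ∀ i ∈ S, ∑ j ∈ S, ω i j = 0
  sum_mul_eq_zero : ∀ i ∈ S, ∑ j ∈ S, z j * ω i j = 0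

lemma sum_map_of_mem_orderings {S : Finset ι} {l : List ι} (h : l ∈ orderings S) (f : ι → ℂ) :
    (l.map f).sum = ∑ i ∈ S, f i := by
  rw [← toFinset_of_mem_orderings h, List.sum_toFinset f (mem_orderings.1 h).1]

namespace IsConserved

variable {S : Finset ι} {z : ι → ℂ} {ω ω' : ι → ι → ℂ}

lemma self_eq_zero (h : IsConserved S z ω) (i : ι) : ω i i = 0 := by
  have := h.antisymm i i
  linear_combination this / 2

lemma sum_sub_mul (h : IsConserved S z ω) {i : ι} (hi : i ∈ S) (c : ℂ) :
    ∑ j ∈ S, (c - z j) * ω i j = 0 := by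
  simp only [sub_mul, Finset.sum_sub_distrib, ← Finset.mul_sum, h.sum_eq_zero i hi,
    h.sum_mul_eq_zero i hi]
  ring

/-- Only quadruples that contain a change: a is their first letter in one word and their last in the
other. What is left is a sum over triples to which `tripleSum_mul_comm` applies, the totals being
zero by conservation. -/
lemma numerator_append_singleton (h : IsConserved S z ω) (h' : IsConserved S z ω') {a : ι}
    {t : List ι} (hl : a :: t ∈ orderings S) :
    numerator z ω ω' (t ++ [a]) = numerator z ω ω' (a :: t) := by
  obtain ⟨ha, ht⟩ := cons_mem_orderings.1 hl
  have hmem : ∀ c ∈ t, c ∈ S := fun c hc => Finset.mem_of_mem_erase (((mem_orderings.1 ht).2 c).1 hc)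
  have := tripleSum_mul_comm (F := fun b c => (z a - z b) * ω b c)
    (G := fun c d => (z c - z d) * ω' d a) (l := t) (fun c => by simp [h.self_eq_zero])
    (fun c => by simp) (fun c hc => by
      -- The label a may be added back to the sum because its term contains z a − z a. For G below,
      -- the corresponding factor is ω' a a.
      rw [sum_map_of_mem_orderings ht, Finset.sum_erase _ (by simp)]
      rw [← neg_eq_zero, ← Finset.sum_neg_distrib, ← h.sum_sub_mul (hmem c hc) (z a)]
      exact Finset.sum_congr rfl fun j _ => by rw [h.antisymm c j]; ring)
    (fun c hc => by
      rw [sum_map_of_mem_orderings ht, Finset.sum_erase _ (by simp [h'.self_eq_zero])]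
      rw [← neg_eq_zero, ← Finset.sum_neg_distrib, ← h'.sum_sub_mul ha (z c)]
      exact Finset.sum_congr rfl fun j _ => by rw [h'.antisymm a j]; ring)
  rw [numerator, numerator, quadSum_append_singleton, quadSum, add_comm]
  congr 1
  refine Eq.trans ?_ (this.symm.trans ?_)
  · exact tripleSum_congr fun b _ c _ d _ => by
      rw [h.antisymm d c, h'.antisymm b a]; ring
  · exact tripleSum_congr fun b _ c _ d _ => by ring

end IsConserved

end Conserved

/-! ### Single-trace and double-trace expressions -/

section Traces

variable {ι : Type*} [DecidableEq ι] {g : Type*} [LieRing g] [LieAlgebra ℂ g]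

/-- The single-trace Parke-Taylor sum over the cyclic orderings of `S`. -/
noncomputable def parkeTaylor (T : List g → ℂ) (S : Finset ι) (x : ι → g) (z : ι → ℂ) : ℂ :=
  1 / (S.card : ℂ) * ∑ l ∈ orderings S, T (l.map x) / cyc z l

/-- The sum of `ω i j * (z i - z j)` over the unordered pairs of labels in `S`. -/
noncomputable def pairing (S : Finset ι) (z : ι → ℂ) (ω : ι → ι → ℂ) : ℂ :=
  1 / 2 * ∑ i ∈ S, ∑ j ∈ S, ω i j * (z i - z j)

/-- The contribution of the exchange of two axions: a sum over the distributions of the labels in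
`S` over two traces. -/
noncomputable def doubleTrace (T : List g → ℂ) (S : Finset ι) (x : ι → g) (z : ι → ℂ)
    (ω ω' : ι → ι → ℂ) : ℂ :=
  ∑ A ∈ S.powerset, (parkeTaylor T A x z * pairing A z ω) *
    (parkeTaylor T (S \ A) x z * pairing (S \ A) z ω')

/-- The single-trace one-loop expression, polarised in the pairing of the momenta. -/
noncomputable def singleTrace (T : List g → ℂ) (S : Finset ι) (x : ι → g) (z : ι → ℂ)
    (ω ω' : ι → ι → ℂ) : ℂ :=
  1 / (S.card : ℂ) * ∑ l ∈ orderings S, numerator z ω ω' l * T (l.map x) / cyc z l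

/-- The pairing in which the momentum of `m` is added to the one of `j`. -/
def merge (ω : ι → ι → ℂ) (m j : ι) (i k : ι) : ℂ :=
  ω i k + (if i = j then ω m k else 0) + (if k = j then ω i m else 0)

/-- A cyclic numerator makes each summand invariant under rotation, so the prefactor 1/|S| can be
traded for fixing the first letter to be j. -/
lemma sum_orderings_div_cyc {T : List g → ℂ} (hT : IsColourTrace T) {S : Finset ι} {j : ι}
    (hj : j ∈ S) (x : ι → g) (z : ι → ℂ) (N : List ι → ℂ)
    (hN : ∀ a t, a :: t ∈ orderings S → N (t ++ [a]) = N (a :: t)) :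
    1 / (S.card : ℂ) * ∑ l ∈ orderings S, N l * T (l.map x) / cyc z l
      = ∑ t ∈ orderings (S.erase j), N (j :: t) * T ((j :: t).map x) / cyc z (j :: t) := by
  rw [sum_orderings_eq_card_mul hj, one_div, inv_mul_cancel_left₀]
  · exact Nat.cast_ne_zero.2 (Finset.card_ne_zero_of_mem hj)
  · intro a t h
    rw [hN a t h, List.map_append, List.map_singleton, hT.rotate, cyc_append_singleton,
      List.map_cons]

lemma parkeTaylor_eq {T : List g → ℂ} (hT : IsColourTrace T) {S : Finset ι} {j : ι}
    (hj : j ∈ S) (x : ι → g) (z : ι → ℂ) :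
    parkeTaylor T S x z
      = ∑ t ∈ orderings (S.erase j), T ((j :: t).map x) / cyc z (j :: t) := by
  simpa [parkeTaylor] using sum_orderings_div_cyc hT hj x z (fun _ => 1) (fun _ _ _ => rfl)

/-- The prefactor p + q ζ is harmless against the quadratic decay in the position ζ of m. It makes
room for a pairing, which is affine in that position. -/
lemma parkeTaylor_insert {T : List g → ℂ} (hT : IsColourTrace T) {S : Finset ι} {m : ι}
    (hm : m ∉ S) (hS : 2 ≤ S.card) {z : ι → ℂ} (hz : Set.InjOn z (insert m S : Finset ι))
    (x : ι → g) (p q : ℂ) :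
    (p + q * z m) * parkeTaylor T (insert m S) x z
      = ∑ j ∈ S, 1 / (z m - z j) *
          ((p + q * z j) * parkeTaylor T S (Function.update x j ⁅x m, x j⁆) z) := by
  have := sum_insertion hT hm hS hz x (fun _ => p) (fun _ => q) (fun j _ => p + q * z j)
    (fun _ _ _ => rfl) (fun _ _ _ => rfl)
  rw [parkeTaylor_eq hT (Finset.mem_insert_self m S), Finset.erase_insert hm, Finset.mul_sum]
  simp only [List.map_cons, mul_div_assoc] at this ⊢
  rw [this]
  refine Finset.sum_congr rfl fun j hj => ?_
  rw [parkeTaylor_eq hT hj, ← Finset.mul_sum]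
  simp

lemma orderings_empty : orderings (∅ : Finset ι) = {[]} := by
  ext l
  simp only [mem_orderings, Finset.notMem_empty, iff_false, Finset.mem_singleton]
  exact ⟨fun h => List.eq_nil_iff_forall_not_mem.2 h.2, fun h => by simp [h]⟩

lemma orderings_singleton (a : ι) : orderings ({a} : Finset ι) = {[a]} := by
  ext l
  rw [Finset.mem_singleton]
  constructor
  · intro h
    rcases l with _ | ⟨b, t⟩
    · simpa using length_of_mem_orderings h
    · obtain ⟨h1, h2⟩ := cons_mem_orderings.1 h
      rw [Finset.mem_singleton] at h1
      rw [h1, Finset.erase_singleton, orderings_empty, Finset.mem_singleton] at h2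
      rw [h1, h2]
  · rintro rfl
    rw [cons_mem_orderings]
    simp [orderings_empty]

/-- Division by zero is at work: the prefactor is 1/0 for the empty set, and the cyclic denominator
of a single label is z a − z a. -/
lemma parkeTaylor_of_card_le_one (T : List g → ℂ) {S : Finset ι} (hS : S.card ≤ 1) (x : ι → g)
    (z : ι → ℂ) : parkeTaylor T S x z = 0 := by
  rcases Nat.le_one_iff_eq_zero_or_eq_one.1 hS with h | h
  · simp [parkeTaylor, h]
  · obtain ⟨a, rfl⟩ := Finset.card_eq_one.1 h
    simp [parkeTaylor, orderings_singleton, cyc, path]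

lemma parkeTaylor_pair {T : List g → ℂ} (hT : IsColourTrace T) {a b : ι} (hab : a ≠ b) (x : ι → g)
    (z : ι → ℂ) : parkeTaylor T {a, b} x z = T [x a, x b] / ((z a - z b) * (z b - z a)) := by
  rw [parkeTaylor_eq hT (Finset.mem_insert_self a {b}),
    Finset.erase_insert (by simpa using hab), orderings_singleton]
  simp [cyc, path]

lemma parkeTaylor_congr {T : List g → ℂ} {S : Finset ι} {x x' : ι → g} {z z' : ι → ℂ}
    (hx : ∀ i ∈ S, x i = x' i) (hz : ∀ i ∈ S, z i = z' i) :
    parkeTaylor T S x z = parkeTaylor T S x' z' := by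
  rw [parkeTaylor, parkeTaylor]
  congr 1
  refine Finset.sum_congr rfl fun l hl => ?_
  have h := (mem_orderings.1 hl).2
  rw [List.map_congr_left fun a ha => hx a ((h a).1 ha), cyc_congr fun a ha => hz a ((h a).1 ha)]

lemma pairing_congr {S : Finset ι} {z z' : ι → ℂ} {ω θ : ι → ι → ℂ} (hz : ∀ i ∈ S, z i = z' i)
    (h : ∀ i ∈ S, ∀ j ∈ S, ω i j = θ i j) : pairing S z ω = pairing S z' θ := by
  rw [pairing, pairing]
  congr 1
  exact Finset.sum_congr rfl fun i hi => Finset.sum_congr rfl fun j hj => by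
    rw [h i hi j hj, hz i hi, hz j hj]

lemma pairing_add_mul (S : Finset ι) (z : ι → ℂ) (ω η : ι → ι → ℂ) (s : ℂ) :
    pairing S z (fun i j => ω i j + s * η i j) = pairing S z ω + s * pairing S z η := by
  simp only [pairing, Finset.mul_sum, ← Finset.sum_add_distrib]
  exact Finset.sum_congr rfl fun _ _ => Finset.sum_congr rfl fun _ _ => by ring

lemma pairing_sum_mul {κ : Type*} (s : Finset κ) (c : κ → ℂ) (S : Finset ι) (z : ι → ℂ)
    (θ : κ → ι → ι → ℂ) :
    pairing S z (fun i j => ∑ k ∈ s, c k * θ k i j) = ∑ k ∈ s, c k * pairing S z (θ k) := by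
  simp only [pairing, Finset.mul_sum, Finset.sum_mul]
  symm
  rw [Finset.sum_comm]
  refine Finset.sum_congr rfl fun i _ => ?_
  rw [Finset.sum_comm]
  exact Finset.sum_congr rfl fun _ _ => Finset.sum_congr rfl fun _ _ => by ring

lemma pairing_singleton (a : ι) (z : ι → ℂ) (ω : ι → ι → ℂ) : pairing {a} z ω = 0 := by
  simp [pairing]

lemma pairing_pair {ω : ι → ι → ℂ} (hω : ∀ i j, ω i j = -ω j i) {a b : ι} (hab : a ≠ b)
    (z : ι → ℂ) : pairing {a, b} z ω = ω a b * (z a - z b) := by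
  rw [pairing, Finset.sum_pair hab, Finset.sum_pair hab, Finset.sum_pair hab, hω b a]
  ring

lemma pairing_insert {ω : ι → ι → ℂ} (hω : ∀ i j, ω i j = -ω j i) {S : Finset ι} {m : ι}
    (hm : m ∉ S) (z : ι → ℂ) :
    pairing (insert m S) z ω = pairing S z ω + ∑ k ∈ S, ω m k * (z m - z k) := by
  simp only [pairing, Finset.sum_insert hm, Finset.sum_add_distrib]
  have : ∑ i ∈ S, ω i m * (z i - z m) = ∑ i ∈ S, ω m i * (z m - z i) :=
    Finset.sum_congr rfl fun i _ => by rw [hω i m]; ring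
  rw [this]
  ring

/-- The extra sum is the one that `pairing_insert` adds for m, with m placed at z j: merging is
insertion at a coincident position. -/
lemma pairing_merge {ω : ι → ι → ℂ} (hω : ∀ i j, ω i j = -ω j i) {S : Finset ι} {m j : ι}
    (hj : j ∈ S) (z : ι → ℂ) :
    pairing S z (merge ω m j) = pairing S z ω + ∑ k ∈ S, ω m k * (z j - z k) := by
  have h1 : ∑ i ∈ S, ∑ k ∈ S, (if i = j then ω m k else 0) * (z i - z k)
      = ∑ k ∈ S, ω m k * (z j - z k) := by
    rw [Finset.sum_eq_single j (fun i _ hi => by simp [hi]) (fun h => absurd hj h)]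
    simp
  have h2 : ∑ i ∈ S, ∑ k ∈ S, (if k = j then ω i m else 0) * (z i - z k)
      = ∑ k ∈ S, ω m k * (z j - z k) := by
    refine Finset.sum_congr rfl fun i _ => ?_
    rw [Finset.sum_eq_single j (fun i _ hi => by simp [hi]) (fun h => absurd hj h), hω m i]
    simp only [if_true]; ring
  simp only [pairing, merge, add_mul, Finset.sum_add_distrib]
  rw [h1, h2]
  ring

lemma merge_antisymm {ω : ι → ι → ℂ} (hω : ∀ i j, ω i j = -ω j i) (m j i k : ι) :
    merge ω m j i k = -merge ω m j k i := by
  simp only [merge]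
  rw [hω i k, hω k m]
  split_ifs <;> (try rw [hω i m]) <;> ring

lemma merge_of_ne (ω : ι → ι → ℂ) (m : ι) {j i k : ι} (hi : i ≠ j) (hk : k ≠ j) :
    merge ω m j i k = ω i k := by
  simp [merge, hi, hk]

lemma singleTrace_congr_right {T : List g → ℂ} {S : Finset ι} (x : ι → g) {z : ι → ℂ}
    {ω ω' θ : ι → ι → ℂ} (h : ∀ i ∈ S, ∀ j ∈ S, ω' i j = θ i j) :
    singleTrace T S x z ω ω' = singleTrace T S x z ω θ := by
  rw [singleTrace, singleTrace]
  congr 1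
  refine Finset.sum_congr rfl fun l hl => ?_
  have hmem := (mem_orderings.1 hl).2
  rw [numerator_congr_right fun i hi j hj => h i ((hmem i).1 hi) j ((hmem j).1 hj)]

lemma doubleTrace_congr_right {T : List g → ℂ} {S : Finset ι} (x : ι → g) {z : ι → ℂ}
    {ω ω' θ : ι → ι → ℂ} (h : ∀ i ∈ S, ∀ j ∈ S, ω' i j = θ i j) :
    doubleTrace T S x z ω ω' = doubleTrace T S x z ω θ := by
  refine Finset.sum_congr rfl fun A _ => ?_
  rw [pairing_congr (S := S \ A) (ω := ω') (θ := θ) (fun _ _ => rfl) fun i hi j hj =>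
    h i (Finset.sdiff_subset hi) j (Finset.sdiff_subset hj)]

lemma singleTrace_sum_mul {κ : Type*} (s : Finset κ) (c : κ → ℂ) (T : List g → ℂ) (S : Finset ι)
    (x : ι → g) (z : ι → ℂ) (ω : ι → ι → ℂ) (θ : κ → ι → ι → ℂ) :
    singleTrace T S x z ω (fun i j => ∑ k ∈ s, c k * θ k i j)
      = ∑ k ∈ s, c k * singleTrace T S x z ω (θ k) := by
  simp only [singleTrace, numerator_sum_mul_right, Finset.mul_sum, Finset.sum_mul, Finset.sum_div]
  rw [Finset.sum_comm]
  exact Finset.sum_congr rfl fun _ _ => Finset.sum_congr rfl fun _ _ => by ring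

lemma doubleTrace_sum_mul {κ : Type*} (s : Finset κ) (c : κ → ℂ) (T : List g → ℂ) (S : Finset ι)
    (x : ι → g) (z : ι → ℂ) (ω : ι → ι → ℂ) (θ : κ → ι → ι → ℂ) :
    doubleTrace T S x z ω (fun i j => ∑ k ∈ s, c k * θ k i j)
      = ∑ k ∈ s, c k * doubleTrace T S x z ω (θ k) := by
  simp only [doubleTrace, pairing_sum_mul, Finset.mul_sum]
  rw [Finset.sum_comm]
  exact Finset.sum_congr rfl fun _ _ => Finset.sum_congr rfl fun _ _ => by ring

/-- The exact recursion for the single trace times the pairing under the insertion of a letter. -/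
lemma parkeTaylor_mul_pairing_insert {T : List g → ℂ} (hT : IsColourTrace T) {S : Finset ι} {m : ι}
    (hm : m ∉ S) (hS : 2 ≤ S.card) {z : ι → ℂ} (hz : Set.InjOn z (insert m S : Finset ι))
    (x : ι → g) {ω η : ι → ι → ℂ} (hω : ∀ i j, ω i j = -ω j i) (hη : ∀ i j, η i j = -η j i)
    (hηm : ∀ i, η m i = 0) :
    parkeTaylor T (insert m S) x z * pairing (insert m S) z ω
      = ∑ j ∈ S, 1 / (z m - z j) *
          (parkeTaylor T S (Function.update x j ⁅x m, x j⁆) z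
            * pairing S z (merge (fun i k => ω i k + (z j - z m) * η i k) m j)) := by
  -- The two arguments are the coefficients of the affine function of ζ given by the pairing of S
  -- with ω + (ζ − z m) η plus the sum of ω m k (ζ − z k). At ζ = z m it is the pairing on `insert m
  -- S`, at ζ = z j the one of the merged labels.
  have := parkeTaylor_insert hT hm hS hz x
    (pairing S z ω - z m * pairing S z η - ∑ k ∈ S, ω m k * z k)
    (pairing S z η + ∑ k ∈ S, ω m k)
  rw [pairing_insert hω hm, mul_comm]
  have hsum : ∀ c : ℂ, ∑ k ∈ S, ω m k * (c - z k) = c * ∑ k ∈ S, ω m k - ∑ k ∈ S, ω m k * z k := by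
    intro c
    simp only [mul_sub, Finset.sum_sub_distrib, Finset.mul_sum, mul_comm]
  rw [hsum, show pairing S z ω + (z m * ∑ k ∈ S, ω m k - ∑ k ∈ S, ω m k * z k)
    = pairing S z ω - z m * pairing S z η - ∑ k ∈ S, ω m k * z k
      + (pairing S z η + ∑ k ∈ S, ω m k) * z m by ring, this]
  refine Finset.sum_congr rfl fun j hj => ?_
  rw [pairing_merge (fun i k => by rw [hω i k, hη i k]; ring) hj, pairing_add_mul]
  simp only [hηm, mul_zero, add_zero]
  rw [hsum]
  ring

end Traces

/-! ### Recursion under the removal of one label -/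

section Recursion

variable {ι : Type*} [DecidableEq ι] {g : Type*} [LieRing g] [LieAlgebra ℂ g]

/-- As the position of `m` moves, the pairing `ω + (ζ - z m) η` stays conserved. -/
structure IsBalancing (S : Finset ι) (z : ι → ℂ) (m : ι) (ω η : ι → ι → ℂ) : Prop where
  antisymm : ∀ i j, η i j = -η j i
  left_eq_zero : ∀ i, η m i = 0
  sum_eq_zero : ∀ i ∈ S, ∑ k ∈ S, η i k = 0
  sum_mul_eq : ∀ i ∈ S, ∑ k ∈ S, z k * η i k = -ω i m

variable {S : Finset ι} {z : ι → ℂ} {m : ι} {ω ω' η : ι → ι → ℂ}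

lemma IsConserved.sum_insert_eq (h : IsConserved (insert m S) z ω) (hm : m ∉ S) {i : ι}
    (hi : i ∈ insert m S) : ∑ k ∈ S, ω i k = -ω i m := by
  have := h.sum_eq_zero i hi
  rw [Finset.sum_insert hm] at this
  linear_combination this

lemma IsConserved.sum_mul_insert_eq (h : IsConserved (insert m S) z ω) (hm : m ∉ S) {i : ι}
    (hi : i ∈ insert m S) : ∑ k ∈ S, z k * ω i k = -(z m * ω i m) := by
  have := h.sum_mul_eq_zero i hi
  rw [Finset.sum_insert hm] at this
  linear_combination this

/-- For ω i j = [ij], moving m from z m to ζ changes ∑ z i μ i by (ζ − z m) μ m. This is repaired by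
adding (ζ − z m) u k μ m to each μ k, where u lives on two labels p, q with ∑ u = 0 and ∑ z u = −1.
The induced change of ω is linear in ζ − z m because ω m m = 0. -/
lemma exists_isBalancing (hm : m ∉ S) (hS : 2 ≤ S.card) (hz : Set.InjOn z (insert m S : Finset ι))
    (h : IsConserved (insert m S) z ω) : ∃ η, IsBalancing S z m ω η := by
  obtain ⟨p, hp, q, hq, hpq⟩ := Finset.one_lt_card.1 hS
  have hd : z p - z q ≠ 0 := fun e => hpq (hz (by simp [hp]) (by simp [hq]) (sub_eq_zero.1 e))
  set u : ι → ℂ := fun k => (if k = p then -1 / (z p - z q) else 0)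
    + (if k = q then 1 / (z p - z q) else 0) with hu
  have hum : u m = 0 := by
    have h1 : m ≠ p := by rintro rfl; exact hm hp
    have h2 : m ≠ q := by rintro rfl; exact hm hq
    simp [hu, h1, h2]
  have hu0 : ∑ k ∈ S, u k = 0 := by
    simp only [hu, Finset.sum_add_distrib, Finset.sum_ite_eq', hp, hq, if_true]
    ring
  have hu1 : ∑ k ∈ S, z k * u k = -1 := by
    simp only [hu, mul_add, Finset.sum_add_distrib, mul_ite, mul_zero, Finset.sum_ite_eq', hp, hq,
      if_true]
    field_simp
    ring
  have hωm : ∑ k ∈ S, ω k m = 0 := by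
    have := h.sum_insert_eq hm (Finset.mem_insert_self m S)
    rw [h.self_eq_zero, neg_zero] at this
    rw [← neg_eq_zero, ← Finset.sum_neg_distrib, ← this]
    exact Finset.sum_congr rfl fun k _ => (h.antisymm m k).symm
  have hωm' : ∑ k ∈ S, z k * ω k m = 0 := by
    have := h.sum_mul_insert_eq hm (Finset.mem_insert_self m S)
    rw [h.self_eq_zero, mul_zero, neg_zero] at this
    rw [← neg_eq_zero, ← Finset.sum_neg_distrib, ← this]
    exact Finset.sum_congr rfl fun k _ => by rw [h.antisymm m k]; ring
  refine ⟨fun i k => ω i m * u k - u i * ω k m, ?_, ?_, ?_, ?_⟩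
  · intro i j; ring
  · intro i; simp [hum, h.self_eq_zero]
  · intro i _
    simp only [Finset.sum_sub_distrib, ← Finset.mul_sum, hu0, hωm]
    ring
  · intro i _
    have : ∀ k, z k * (ω i m * u k - u i * ω k m) = ω i m * (z k * u k) - u i * (z k * ω k m) :=
      fun k => by ring
    simp only [this, Finset.sum_sub_distrib, ← Finset.mul_sum, hu1, hωm']
    ring

/-- The pairing that results when the letter `m` moves to the position of `j` and merges with it. -/
def mergedPairing (z : ι → ℂ) (ω η : ι → ι → ℂ) (m j : ι) : ι → ι → ℂ :=
  merge (fun i k => ω i k + (z j - z m) * η i k) m j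

lemma mergedPairing_of_ne {j i k : ι} (hi : i ≠ j) (hk : k ≠ j) :
    mergedPairing z ω η m j i k = ω i k + (z j - z m) * η i k := merge_of_ne _ _ hi hk

/-- The corrected pairing is conserved with m placed at z j. There m and j have the same position,
so adding the momentum of m to that of j alters neither conservation law. -/
lemma IsConserved.mergedPairing (h : IsConserved (insert m S) z ω) (hm : m ∉ S)
    (hη : IsBalancing S z m ω η) {j : ι} (hj : j ∈ S) :
    IsConserved S z (mergedPairing z ω η m j) := by
  have hηm : ∀ i, η i m = 0 := fun i => by rw [hη.antisymm, hη.left_eq_zero, neg_zero]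
  have hsm := h.sum_insert_eq hm (Finset.mem_insert_self m S)
  have hsm' := h.sum_mul_insert_eq hm (Finset.mem_insert_self m S)
  rw [h.self_eq_zero] at hsm hsm'
  refine ⟨merge_antisymm (fun i k => ?_) m j, fun i hi => ?_, fun i hi => ?_⟩
  · rw [h.antisymm i k, hη.antisymm i k]; ring
  · have hs := h.sum_insert_eq hm (Finset.mem_insert_of_mem hi)
    simp only [AxionChiralAlgebra.mergedPairing, merge, Finset.sum_add_distrib, hη.left_eq_zero,
      hηm, mul_zero, add_zero, Finset.sum_ite_eq', hj, if_true, ← Finset.mul_sum,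
      hη.sum_eq_zero i hi, hs]
    split_ifs
    · rw [hsm]; ring
    · simp
  · have hs := h.sum_mul_insert_eq hm (Finset.mem_insert_of_mem hi)
    simp only [AxionChiralAlgebra.mergedPairing, merge, mul_add, Finset.sum_add_distrib,
      hη.left_eq_zero, hηm, mul_zero, add_zero, mul_ite, Finset.sum_ite_eq', hj, if_true, hs]
    have e : ∑ k ∈ S, z k * ((z j - z m) * η i k) = (z j - z m) * -ω i m := by
      rw [← hη.sum_mul_eq i hi, Finset.mul_sum]
      exact Finset.sum_congr rfl fun _ _ => by ring
    rw [e]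
    split_ifs
    · rw [hsm']; ring
    · simp only [Finset.sum_const_zero]; ring

lemma IsConserved.of_insert (h : IsConserved (insert m S) z ω) (hm : m ∉ S)
    (h0 : ∀ i ∈ S, ω i m = 0) : IsConserved S z ω := by
  refine ⟨h.antisymm, fun i hi => ?_, fun i hi => ?_⟩
  · rw [h.sum_insert_eq hm (Finset.mem_insert_of_mem hi), h0 i hi, neg_zero]
  · rw [h.sum_mul_insert_eq hm (Finset.mem_insert_of_mem hi), h0 i hi, mul_zero, neg_zero]

/-- Since ω' vanishes at m, no quadruple starts at m, and the numerator of m :: l is that of l,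
affine in ζ along ω + (ζ − z m) η. Partial fractions evaluate it at the positions of the first and
last letters of l, letters at which ω itself is not evaluated, so the merged pairing may take its
place. -/
lemma singleTrace_insert {T : List g → ℂ} (hT : IsColourTrace T) (hm : m ∉ S) (hS : 2 ≤ S.card)
    (hz : Set.InjOn z (insert m S : Finset ι)) (x : ι → g) (h : IsConserved (insert m S) z ω)
    (h' : IsConserved (insert m S) z ω') (h0 : ∀ i ∈ S, ω' i m = 0)
    (hη : IsBalancing S z m ω η) :
    singleTrace T (insert m S) x z ω ω'
      = ∑ j ∈ S, 1 / (z m - z j) *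
          singleTrace T S (Function.update x j ⁅x m, x j⁆) z (mergedPairing z ω η m j) ω' := by
  have hS' := h'.of_insert hm h0
  have agree : ∀ a t, a :: t ∈ orderings S → ∀ i ∈ t, ∀ k ∈ t,
      ω i k + (z a - z m) * η i k = mergedPairing z ω η m a i k := by
    intro a t hl i hi k hk
    have ha := (List.nodup_cons.1 (mem_orderings.1 hl).1).1
    rw [mergedPairing_of_ne (by rintro rfl; exact ha hi) (by rintro rfl; exact ha hk)]
  have key := sum_insertion hT hm hS hz x
    (fun l => numerator z ω ω' l - z m * numerator z η ω' l) (fun l => numerator z η ω' l)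
    (fun j l => numerator z (mergedPairing z ω η m j) ω' l)
    (fun b t hl => by
      rw [← numerator_cons_congr (agree b t hl), numerator_add_mul_left]; ring)
    -- The pole at the last letter produces the numerator of t ++ [a]. Cyclicity brings it to a ::
    -- t, and this is where the merged pairing has to be conserved.
    (fun a t hl => by
      rw [← (h.mergedPairing hm hη (cons_mem_orderings.1 hl).1).numerator_append_singleton hS' hl,
        ← numerator_append_singleton_congr (agree a t hl), numerator_add_mul_left]; ring)
  rw [singleTrace, sum_orderings_div_cyc hT (Finset.mem_insert_self m S) x z
    (numerator z ω ω') (fun a t hl => h.numerator_append_singleton h' hl),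
    Finset.erase_insert hm]
  refine Eq.trans (Finset.sum_congr rfl fun l hl => ?_) (key.trans ?_)
  · rw [numerator_cons_of_eq_zero fun i hi => h0 i (((mem_orderings.1 hl).2 i).1 hi)]
    rw [List.map_cons]
    ring
  · refine Finset.sum_congr rfl fun j hj => ?_
    rw [singleTrace, sum_orderings_div_cyc hT hj _ z (numerator z (mergedPairing z ω η m j) ω')
      (fun a t hl => (h.mergedPairing hm hη hj).numerator_append_singleton hS' hl)]

lemma pairing_eq_zero (h : IsConserved S z ω) : pairing S z ω = 0 := by
  rw [pairing, Finset.sum_eq_zero, mul_zero]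
  intro i hi
  have h1 := h.sum_eq_zero i hi
  have h2 := h.sum_mul_eq_zero i hi
  have : ∀ j, ω i j * (z i - z j) = z i * ω i j - z j * ω i j := fun j => by ring
  simp only [this, Finset.sum_sub_distrib, ← Finset.mul_sum, h1, h2]
  ring

/-- Conservation kills both the pairing on all of S and the part of it that involves j. The result
disposes of the case where m has a single companion in its group, which `parkeTaylor_insert` does
not cover. -/
lemma pairing_erase_eq_zero (h : IsConserved S z ω) {j : ι} (hj : j ∈ S) :
    pairing (S.erase j) z ω = 0 := by
  have h0 := pairing_eq_zero h
  rw [← Finset.insert_erase hj, pairing_insert h.antisymm (by simp)] at h0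
  have h1 := h.sum_sub_mul hj (z j)
  rw [← Finset.add_sum_erase _ _ hj, sub_self, zero_mul, zero_add] at h1
  rwa [show ∑ k ∈ S.erase j, ω j k * (z j - z k) = 0 from
    (Finset.sum_congr rfl fun _ _ => mul_comm _ _).trans h1, add_zero] at h0

/-- The label m joins one of the two groups. In the group with ω, the pairing supplies an affine
numerator. In the group with ω' only the Parke-Taylor factor sees m, and the affine numerator comes
from the other group, whose pairing moves along η. -/
lemma doubleTrace_insert {T : List g → ℂ} (hT : IsColourTrace T) (hm : m ∉ S)
    (hz : Set.InjOn z (insert m S : Finset ι)) (x : ι → g) (h : IsConserved (insert m S) z ω)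
    (h' : IsConserved (insert m S) z ω') (h0 : ∀ i ∈ S, ω' i m = 0)
    (hη : IsBalancing S z m ω η) :
    doubleTrace T (insert m S) x z ω ω'
      = ∑ j ∈ S, 1 / (z m - z j) *
          doubleTrace T S (Function.update x j ⁅x m, x j⁆) z (mergedPairing z ω η m j) ω' := by
  have hS' := h'.of_insert hm h0
  have h0' : ∀ i ∈ S, ω' m i = 0 := fun i hi => by rw [h'.antisymm, h0 i hi, neg_zero]
  have hupd : ∀ {B : Finset ι} {j : ι}, j ∉ B → ∀ y,
      parkeTaylor T B (Function.update x j y) z = parkeTaylor T B x z := fun {B j} hj y =>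
    parkeTaylor_congr (fun i hi => Function.update_of_ne (by rintro rfl; exact hj hi) _ _)
      fun _ _ => rfl
  have hleft : ∀ A ∈ S.powerset,
      (parkeTaylor T (insert m A) x z * pairing (insert m A) z ω)
          * (parkeTaylor T (S \ A) x z * pairing (S \ A) z ω')
        = ∑ j ∈ A, 1 / (z m - z j) *
          ((parkeTaylor T A (Function.update x j ⁅x m, x j⁆) z
              * pairing A z (mergedPairing z ω η m j)) *
            (parkeTaylor T (S \ A) (Function.update x j ⁅x m, x j⁆) z
              * pairing (S \ A) z ω')) := by
    intro A hA
    rw [Finset.mem_powerset] at hA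
    have hmA : m ∉ A := fun hh => hm (hA hh)
    by_cases hcard : 2 ≤ A.card
    · rw [parkeTaylor_mul_pairing_insert hT hmA hcard
        (hz.mono (by exact_mod_cast Finset.insert_subset_insert m hA)) x h.antisymm hη.antisymm
        hη.left_eq_zero, Finset.sum_mul]
      refine Finset.sum_congr rfl fun j hj => ?_
      rw [hupd (B := S \ A) (by simp [hj]), mergedPairing]
      ring
    · rw [Finset.sum_eq_zero fun j hj => by
        rw [parkeTaylor_of_card_le_one T (by omega : A.card ≤ 1)]; ring]
      rcases Nat.le_one_iff_eq_zero_or_eq_one.1 (by omega : A.card ≤ 1) with hc | hc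
      · rw [Finset.card_eq_zero.1 hc, insert_empty_eq, pairing_singleton]; ring
      -- The group {m, j} would merge into a single label. Its term is zero because the pairing of
      -- ω' on the complement of j vanishes.
      · obtain ⟨j, rfl⟩ := Finset.card_eq_one.1 hc
        rw [Finset.sdiff_singleton_eq_erase, pairing_erase_eq_zero hS' (by simpa using hA)]
        ring
  have hright : ∀ A ∈ S.powerset,
      (parkeTaylor T A x z * pairing A z ω)
          * (parkeTaylor T (insert m (S \ A)) x z * pairing (insert m (S \ A)) z ω')
        = ∑ j ∈ S \ A, 1 / (z m - z j) *
          ((parkeTaylor T A (Function.update x j ⁅x m, x j⁆) z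
              * pairing A z (mergedPairing z ω η m j)) *
            (parkeTaylor T (S \ A) (Function.update x j ⁅x m, x j⁆) z
              * pairing (S \ A) z ω')) := by
    intro A hA
    rw [Finset.mem_powerset] at hA
    have hmB : m ∉ S \ A := fun hh => hm (Finset.sdiff_subset hh)
    have hQ : pairing (insert m (S \ A)) z ω' = pairing (S \ A) z ω' := by
      rw [pairing_insert h'.antisymm hmB, Finset.sum_eq_zero fun k hk => by
        rw [h0' k (Finset.sdiff_subset hk), zero_mul], add_zero]
    rw [hQ]
    by_cases hcard : 2 ≤ (S \ A).card
    -- The affine function is the pairing of A with ω + (ζ − z m) η. Its value at ζ = z j is that of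
    -- the merged pairing since j lies outside A.
    · have := parkeTaylor_insert hT hmB hcard
        (hz.mono (by exact_mod_cast Finset.insert_subset_insert m Finset.sdiff_subset)) x
        (pairing A z ω - z m * pairing A z η) (pairing A z η)
      rw [show (parkeTaylor T A x z * pairing A z ω) * (parkeTaylor T (insert m (S \ A)) x z
          * pairing (S \ A) z ω') = (parkeTaylor T A x z * pairing (S \ A) z ω')
          * ((pairing A z ω - z m * pairing A z η + pairing A z η * z m)
            * parkeTaylor T (insert m (S \ A)) x z) by ring, this, Finset.mul_sum]
      refine Finset.sum_congr rfl fun j hj => ?_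
      have hjA : j ∉ A := (Finset.mem_sdiff.1 hj).2
      rw [hupd (B := A) hjA, pairing_congr (S := A) (fun _ _ => rfl) fun i hi k hk =>
        mergedPairing_of_ne (by rintro rfl; exact hjA hi) (by rintro rfl; exact hjA hk),
        pairing_add_mul]
      ring
    · rw [Finset.sum_eq_zero fun j hj => by
        rw [parkeTaylor_of_card_le_one T (by omega : (S \ A).card ≤ 1)]; ring]
      rcases Nat.le_one_iff_eq_zero_or_eq_one.1 (by omega : (S \ A).card ≤ 1) with hc | hc
      · rw [Finset.card_eq_zero.1 hc]; simp [pairing]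
      · obtain ⟨j, hj⟩ := Finset.card_eq_one.1 hc
        rw [hj, pairing_singleton]
        ring
  rw [doubleTrace, Finset.sum_powerset_insert hm, ← Finset.sum_add_distrib]
  simp only [doubleTrace, Finset.mul_sum]
  rw [Finset.sum_comm]
  refine Finset.sum_congr rfl fun A hA => ?_
  have hAS := Finset.mem_powerset.1 hA
  have hmA : m ∉ A := fun hh => hm (hAS hh)
  rw [Finset.insert_sdiff_of_notMem _ hmA, Finset.insert_sdiff_insert,
    Finset.sdiff_insert_of_notMem hm, hright A hA, hleft A hA, Finset.sum_sdiff hAS]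

end Recursion

/-! ### The four-point case and the on-shell identity -/

section OnShell

variable {ι : Type*} [DecidableEq ι] {g : Type*} [LieRing g] [LieAlgebra ℂ g]

/-- The sum of a function of four letters over their orderings. -/
def permSum {α β : Type*} [Add β] (F : α → α → α → α → β) (a b c d : α) : β :=
  F a b c d + F a b d c + F a c b d + F a c d b + F a d b c + F a d c b
  + (F b a c d + F b a d c + F b c a d + F b c d a + F b d a c + F b d c a)
  + (F c a b d + F c a d b + F c b a d + F c b d a + F c d a b + F c d b a)
  + (F d a b c + F d a c b + F d b a c + F d b c a + F d c a b + F d c b a)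

lemma sum_orderings_four {a b c d : ι} (hab : a ≠ b) (hac : a ≠ c) (had : a ≠ d) (hbc : b ≠ c)
    (hbd : b ≠ d) (hcd : c ≠ d) (F : List ι → ℂ) :
    ∑ l ∈ orderings {a, b, c, d}, F l = permSum (fun i j k l => F [i, j, k, l]) a b c d := by
  have two : ∀ {i j : ι}, i ≠ j → ∀ G : List ι → ℂ,
      ∑ l ∈ orderings {i, j}, G l = G [i, j] + G [j, i] := by
    intro i j hij G
    rw [sum_orderings_cons ⟨i, by simp⟩, Finset.sum_pair hij,
      show ({i, j} : Finset ι).erase i = {j} by ext; simp; grind,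
      show ({i, j} : Finset ι).erase j = {i} by ext; simp; grind]
    simp [orderings_singleton]
  have three : ∀ {i j k : ι}, i ≠ j → i ≠ k → j ≠ k → ∀ G : List ι → ℂ,
      ∑ l ∈ orderings {i, j, k}, G l = G [i, j, k] + G [i, k, j] + (G [j, i, k] + G [j, k, i])
        + (G [k, i, j] + G [k, j, i]) := by
    intro i j k hij hik hjk G
    rw [sum_orderings_cons ⟨i, by simp⟩, Finset.sum_insert (by simp [hij, hik]),
      Finset.sum_pair hjk,
      show ({i, j, k} : Finset ι).erase i = {j, k} by ext; simp; grind,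
      show ({i, j, k} : Finset ι).erase j = {i, k} by ext; simp; grind,
      show ({i, j, k} : Finset ι).erase k = {i, j} by ext; simp; grind,
      two hjk, two hik, two hij]
    ring
  rw [sum_orderings_cons ⟨a, by simp⟩, Finset.sum_insert (by simp [hab, hac, had]),
    Finset.sum_insert (by simp [hbc, hbd]), Finset.sum_pair hcd,
    show ({a, b, c, d} : Finset ι).erase a = {b, c, d} by ext; simp; grind,
    show ({a, b, c, d} : Finset ι).erase b = {a, c, d} by ext; simp; grind,
    show ({a, b, c, d} : Finset ι).erase c = {a, b, d} by ext; simp; grind,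
    show ({a, b, c, d} : Finset ι).erase d = {a, b, c} by ext; simp; grind,
    three hbc hbd hcd, three hac had hcd, three hab had hbd, three hab hac hbc]
  simp only [permSum]
  ring

/-- For four labels a conserved pairing is determined by one factor. -/
def IsFourPointFactor (z : ι → ℂ) (ω : ι → ι → ℂ) (a b c d : ι) (κ : ℂ) : Prop :=
  ω a b = κ * (z c - z d) ∧ ω a c = κ * (z d - z b) ∧ ω a d = κ * (z b - z c) ∧
    ω b c = κ * (z a - z d) ∧ ω b d = κ * (z c - z a) ∧ ω c d = κ * (z a - z b)

/-- An antisymmetric 4 × 4 matrix annihilating the independent vectors 1 and z is determined up to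
scale; its entries are the differences of the complementary positions. The factor is read off from ω
a b. -/
lemma IsConserved.exists_isFourPointFactor {a b c d : ι} (hab : a ≠ b) (hac : a ≠ c) (had : a ≠ d)
    (hbc : b ≠ c) (hbd : b ≠ d) (hcd : c ≠ d) {z : ι → ℂ} {ω : ι → ι → ℂ}
    (h : IsConserved {a, b, c, d} z ω) (hz : z c - z d ≠ 0) :
    ∃ κ, IsFourPointFactor z ω a b c d κ := by
  unfold IsFourPointFactor
  have sum4 : ∀ f : ι → ℂ, ∑ i ∈ ({a, b, c, d} : Finset ι), f i = f a + (f b + (f c + f d)) := by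
    intro f
    rw [Finset.sum_insert (by simp [hab, hac, had]), Finset.sum_insert (by simp [hbc, hbd]),
      Finset.sum_pair hcd]
  have a1 := h.sum_eq_zero a (by simp)
  have a2 := h.sum_mul_eq_zero a (by simp)
  have b1 := h.sum_eq_zero b (by simp)
  have b2 := h.sum_mul_eq_zero b (by simp)
  have c1 := h.sum_eq_zero c (by simp)
  have c2 := h.sum_mul_eq_zero c (by simp)
  rw [sum4, h.self_eq_zero] at a1 a2 b1 b2 c1 c2
  rw [h.antisymm b a] at b1 b2
  rw [h.antisymm c a, h.antisymm c b] at c1 c2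
  generalize ω a b = p at *
  generalize ω a c = q at *
  generalize ω a d = r at *
  generalize ω b c = s at *
  generalize ω b d = t at *
  generalize ω c d = u at *
  refine ⟨p / (z c - z d), ?_, ?_, ?_, ?_, ?_, ?_⟩
  · field_simp
  · field_simp
    linear_combination a2 - z d * a1
  · field_simp
    linear_combination -a2 + z c * a1
  · field_simp
    linear_combination b2 - z d * b1
  · field_simp
    linear_combination -b2 + z c * b1
  · have hs : s * (z c - z d) = p * (z a - z d) := by linear_combination b2 - z d * b1
    have hq : q * (z c - z d) = p * (z d - z b) := by linear_combination a2 - z d * a1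
    field_simp
    linear_combination (z c - z d) * c1 + hs + hq

/-- Each of the 24 words contains one quadruple, and its two pairings equal κ κ' times the two
remaining factors of the Parke-Taylor denominator. All positions cancel; 1/4 is the cyclic
prefactor. -/
lemma singleTrace_eq_permSum (T : List g → ℂ)
    {a b c d : ι} (hab : a ≠ b) (hac : a ≠ c) (had : a ≠ d) (hbc : b ≠ c) (hbd : b ≠ d)
    (hcd : c ≠ d) {z : ι → ℂ} (hz : Set.InjOn z ({a, b, c, d} : Finset ι)) (x : ι → g)
    {ω ω' : ι → ι → ℂ} (h : IsConserved {a, b, c, d} z ω)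
    (h' : IsConserved {a, b, c, d} z ω')
    {κ κ' : ℂ} (hκ : IsFourPointFactor z ω a b c d κ)
    (hκ' : IsFourPointFactor z ω' a b c d κ') :
    singleTrace T {a, b, c, d} x z ω ω'
      = κ * κ' / 4 * permSum (fun i j k l => T [i, j, k, l]) (x a) (x b) (x c) (x d) := by
  have hne : ∀ i ∈ ({a, b, c, d} : Finset ι), ∀ j ∈ ({a, b, c, d} : Finset ι), i ≠ j →
      z i - z j ≠ 0 := fun i hi j hj hij e => hij (hz hi hj (sub_eq_zero.1 e))
  have dab := hne a (by simp) b (by simp) hab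
  have dac := hne a (by simp) c (by simp) hac
  have dad := hne a (by simp) d (by simp) had
  have dbc := hne b (by simp) c (by simp) hbc
  have dbd := hne b (by simp) d (by simp) hbd
  have dcd := hne c (by simp) d (by simp) hcd
  obtain ⟨p1, p2, p3, p4, p5, p6⟩ := hκ
  obtain ⟨q1, q2, q3, q4, q5, q6⟩ := hκ'
  have hcard : ({a, b, c, d} : Finset ι).card = 4 :=
    Finset.card_eq_four.2 ⟨a, b, c, d, hab, hac, had, hbc, hbd, hcd, rfl⟩
  have hn : ∀ {F : ι → ι → ι → ι → ℂ} {i j k l : ι}, quadSum F [i, j, k, l] = F i j k l := by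
    intro F i j k l
    simp [quadSum, tripleSum, pairSum]
  rw [singleTrace, hcard, sum_orderings_four hab hac had hbc hbd hcd]
  have dba := hne b (by simp) a (by simp) hab.symm
  have dca := hne c (by simp) a (by simp) hac.symm
  have dda := hne d (by simp) a (by simp) had.symm
  have dcb := hne c (by simp) b (by simp) hbc.symm
  have ddb := hne d (by simp) b (by simp) hbd.symm
  have ddc := hne d (by simp) c (by simp) hcd.symm
  have term : ∀ (i j k l : ι) (t : ℂ), z i - z j ≠ 0 → z j - z k ≠ 0 → z k - z l ≠ 0 →
      z l - z i ≠ 0 → ω j k * ω' l i = κ * κ' * ((z j - z k) * (z l - z i)) →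
      numerator z ω ω' [i, j, k, l] * t / cyc z [i, j, k, l] = κ * κ' * t := by
    intro i j k l t h1 h2 h3 h4 h5
    simp only [numerator, hn, cyc, path, List.cons_append, List.nil_append, mul_one]
    field_simp
    linear_combination t * h5
  have r1 : ω b a = -(κ * (z c - z d)) := by rw [h.antisymm, p1]
  have r2 : ω c a = -(κ * (z d - z b)) := by rw [h.antisymm, p2]
  have r3 : ω d a = -(κ * (z b - z c)) := by rw [h.antisymm, p3]
  have r4 : ω c b = -(κ * (z a - z d)) := by rw [h.antisymm, p4]
  have r5 : ω d b = -(κ * (z c - z a)) := by rw [h.antisymm, p5]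
  have r6 : ω d c = -(κ * (z a - z b)) := by rw [h.antisymm, p6]
  have s1 : ω' b a = -(κ' * (z c - z d)) := by rw [h'.antisymm, q1]
  have s2 : ω' c a = -(κ' * (z d - z b)) := by rw [h'.antisymm, q2]
  have s3 : ω' d a = -(κ' * (z b - z c)) := by rw [h'.antisymm, q3]
  have s4 : ω' c b = -(κ' * (z a - z d)) := by rw [h'.antisymm, q4]
  have s5 : ω' d b = -(κ' * (z c - z a)) := by rw [h'.antisymm, q5]
  have s6 : ω' d c = -(κ' * (z a - z b)) := by rw [h'.antisymm, q6]
  simp (disch := first | assumption | (simp only [p1, p2, p3, p4, p5, p6, q1, q2, q3, q4, q5, q6,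
    r1, r2, r3, r4, r5, r6, s1, s2, s3, s4, s5, s6]; ring)) only [permSum, term, List.map_cons,
    List.map_nil]
  push_cast
  ring

lemma sdiff_pair_of_four {a b c d : ι} (hab : a ≠ b) (hac : a ≠ c) (had : a ≠ d) (hbc : b ≠ c)
    (hbd : b ≠ d) (hcd : c ≠ d) :
    (({a, b, c, d} \ {a, b} : Finset ι) = {c, d} ∧ ({a, b, c, d} \ {a, c} : Finset ι) = {b, d} ∧
      ({a, b, c, d} \ {a, d} : Finset ι) = {b, c}) ∧
    (({a, b, c, d} \ {b, c} : Finset ι) = {a, d} ∧ ({a, b, c, d} \ {b, d} : Finset ι) = {a, c} ∧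
      ({a, b, c, d} \ {c, d} : Finset ι) = {a, b}) := by
  refine ⟨⟨?_, ?_, ?_⟩, ?_, ?_, ?_⟩ <;> ext <;>
    simp only [Finset.mem_sdiff, Finset.mem_insert, Finset.mem_singleton] <;> grind

/-- Only splittings into two pairs survive, because a group with at most one label has zero
Parke-Taylor sum. Each of the three splittings occurs twice, as ω may go to either pair. -/
lemma doubleTrace_four {T : List g → ℂ} (hT : IsColourTrace T)
    {a b c d : ι} (hab : a ≠ b) (hac : a ≠ c) (had : a ≠ d) (hbc : b ≠ c) (hbd : b ≠ d)
    (hcd : c ≠ d) {z : ι → ℂ} (hz : Set.InjOn z ({a, b, c, d} : Finset ι)) (x : ι → g)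
    {ω ω' : ι → ι → ℂ} (h : IsConserved {a, b, c, d} z ω)
    (h' : IsConserved {a, b, c, d} z ω')
    {κ κ' : ℂ} (hκ : IsFourPointFactor z ω a b c d κ)
    (hκ' : IsFourPointFactor z ω' a b c d κ') :
    doubleTrace T {a, b, c, d} x z ω ω' = 2 * κ * κ' *
      (T [x a, x b] * T [x c, x d] + T [x a, x c] * T [x b, x d]
        + T [x a, x d] * T [x b, x c]) := by
  have hne : ∀ i ∈ ({a, b, c, d} : Finset ι), ∀ j ∈ ({a, b, c, d} : Finset ι), i ≠ j →
      z i - z j ≠ 0 := fun i hi j hj hij e => hij (hz hi hj (sub_eq_zero.1 e))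
  have dab := hne a (by simp) b (by simp) hab
  have dac := hne a (by simp) c (by simp) hac
  have dad := hne a (by simp) d (by simp) had
  have dbc := hne b (by simp) c (by simp) hbc
  have dbd := hne b (by simp) d (by simp) hbd
  have dcd := hne c (by simp) d (by simp) hcd
  obtain ⟨p1, p2, p3, p4, p5, p6⟩ := hκ
  obtain ⟨q1, q2, q3, q4, q5, q6⟩ := hκ'
  have hcard : ({a, b, c, d} : Finset ι).card = 4 :=
    Finset.card_eq_four.2 ⟨a, b, c, d, hab, hac, had, hbc, hbd, hcd, rfl⟩
  obtain ⟨⟨e1, e2, e3⟩, e4, e5, e6⟩ := sdiff_pair_of_four hab hac had hbc hbd hcd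
  set f : Finset ι → ℂ := fun A => (parkeTaylor T A x z * pairing A z ω) *
    (parkeTaylor T ({a, b, c, d} \ A) x z * pairing ({a, b, c, d} \ A) z ω') with hf
  have small : ∀ A : Finset ι, A.card ≤ 1 → f A = 0 := fun A hA => by
    simp only [hf]
    rw [parkeTaylor_of_card_le_one T hA]
    ring
  have large : ∀ A : Finset ι, A ⊆ {a, b, c, d} → 3 ≤ A.card → f A = 0 := fun A hA hA3 => by
    have := Finset.card_sdiff_add_card_eq_card hA
    simp only [hf]
    rw [parkeTaylor_of_card_le_one T (by omega : ({a, b, c, d} \ A).card ≤ 1)]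
    ring
  have pair : ∀ i j k l : ι, i ≠ j → k ≠ l → ({a, b, c, d} \ {i, j} : Finset ι) = {k, l} →
      z i - z j ≠ 0 → z k - z l ≠ 0 → ω i j * ω' k l = κ * κ' * ((z i - z j) * (z k - z l)) →
      f {i, j} = κ * κ' * (T [x i, x j] * T [x k, x l]) := by
    intro i j k l hij hkl hset h1 h2 h3
    simp only [hf]
    rw [hset, parkeTaylor_pair hT hij, parkeTaylor_pair hT hkl,
      pairing_pair h.antisymm hij, pairing_pair h'.antisymm hkl,
      show z j - z i = -(z i - z j) by ring, show z l - z k = -(z k - z l) by ring]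
    field_simp
    linear_combination T [x i, x j] * T [x k, x l] * h3
  have three : ∀ {i j k : ι}, i ≠ j → i ≠ k → j ≠ k → 3 ≤ ({i, j, k} : Finset ι).card :=
    fun hij hik hjk => (Finset.card_eq_three.2 ⟨_, _, _, hij, hik, hjk, rfl⟩).ge
  change ∑ A ∈ ({a, b, c, d} : Finset ι).powerset, f A = _
  have ia : a ∉ ({b, c, d} : Finset ι) := by simp [hab, hac, had]
  have ib : b ∉ ({c, d} : Finset ι) := by simp [hbc, hbd]
  have ic : c ∉ ({d} : Finset ι) := by simpa using hcd
  have hps : ({d} : Finset ι).powerset = {∅, {d}} := by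
    ext; simp [Finset.subset_singleton_iff]
  simp only [Finset.sum_powerset_insert ia, Finset.sum_powerset_insert ib,
    Finset.sum_powerset_insert ic, hps, Finset.sum_pair (Finset.singleton_ne_empty d).symm,
    insert_empty_eq]
  rw [small ∅ (by simp), small {d} (by simp), small {c} (by simp), small {b} (by simp),
    small {a} (by simp), large {b, c, d} (Finset.subset_insert _ _) (three hbc hbd hcd),
    large {a, c, d} (Finset.insert_subset_insert _ (Finset.subset_insert _ _)) (three hac had hcd),
    large {a, b, d} (Finset.insert_subset_insert _ (Finset.insert_subset_insert _
      (Finset.subset_insert _ _))) (three hab had hbd),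
    large {a, b, c} (Finset.insert_subset_insert _ (Finset.insert_subset_insert _ (by simp))) (three hab hac hbc),
    large {a, b, c, d} subset_rfl (by omega),
    pair a b c d hab hcd e1 dab dcd (by rw [p1, q6]; ring),
    pair a c b d hac hbd e2 dac dbd (by rw [p2, q5]; ring),
    pair a d b c had hbc e3 dad dbc (by rw [p3, q4]; ring),
    pair b c a d hbc had e4 dbc dad (by rw [p4, q3]; ring),
    pair b d a c hbd hac e5 dbd dac (by rw [p5, q2]; ring),
    pair c d a b hcd hab e6 dcd dab (by rw [p6, q1]; ring)]
  ring

/-- The constants match: (κ κ' / 4) · 8 λ² = λ² · 2 κ κ'. -/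
lemma singleTrace_four {T T' : List g → ℂ} (hT' : IsColourTrace T') {lam : ℂ}
    (h4 : ∀ x₁ x₂ x₃ x₄ : g, permSum (fun i j k l => T [i, j, k, l]) x₁ x₂ x₃ x₄
      = 8 * lam ^ 2 * (T' [x₁, x₂] * T' [x₃, x₄] + T' [x₁, x₃] * T' [x₂, x₄]
        + T' [x₁, x₄] * T' [x₂, x₃]))
    {a b c d : ι} (hab : a ≠ b) (hac : a ≠ c) (had : a ≠ d) (hbc : b ≠ c) (hbd : b ≠ d)
    (hcd : c ≠ d) {z : ι → ℂ} (hz : Set.InjOn z ({a, b, c, d} : Finset ι)) (x : ι → g)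
    {ω ω' : ι → ι → ℂ} (h : IsConserved {a, b, c, d} z ω)
    (h' : IsConserved {a, b, c, d} z ω') :
    singleTrace T {a, b, c, d} x z ω ω' = lam ^ 2 * doubleTrace T' {a, b, c, d} x z ω ω' := by
  have dcd : z c - z d ≠ 0 := fun e => hcd (hz (by simp) (by simp) (sub_eq_zero.1 e))
  obtain ⟨κ, hκ⟩ := h.exists_isFourPointFactor hab hac had hbc hbd hcd dcd
  obtain ⟨κ', hκ'⟩ := h'.exists_isFourPointFactor hab hac had hbc hbd hcd dcd
  rw [singleTrace_eq_permSum T hab hac had hbc hbd hcd hz x h h' hκ hκ', h4,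
    doubleTrace_four hT' hab hac had hbc hbd hcd hz x h h' hκ hκ']
  ring

/-- The vector supported on `k`, `p`, `q` that satisfies momentum conservation. -/
noncomputable def conservedVector (z : ι → ℂ) (p q k i : ι) : ℂ :=
  (if i = k then 1 else 0) + (if i = p then (z q - z k) / (z p - z q) else 0)
    + (if i = q then (z k - z p) / (z p - z q) else 0)

lemma sum_conservedVector {S : Finset ι} {z : ι → ℂ} {p q k : ι} (hp : p ∈ S) (hq : q ∈ S)
    (hk : k ∈ S) (hpq : z p - z q ≠ 0) : ∑ i ∈ S, conservedVector z p q k i = 0 := by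
  simp only [conservedVector, Finset.sum_add_distrib, Finset.sum_ite_eq', hp, hq, hk, if_true]
  field_simp
  ring

lemma sum_mul_conservedVector {S : Finset ι} {z : ι → ℂ} {p q k : ι} (hp : p ∈ S) (hq : q ∈ S)
    (hk : k ∈ S) (hpq : z p - z q ≠ 0) : ∑ i ∈ S, z i * conservedVector z p q k i = 0 := by
  simp only [conservedVector, mul_add, mul_ite, mul_zero, Finset.sum_add_distrib,
    Finset.sum_ite_eq', hp, hq, hk, if_true]
  field_simp
  ring

lemma isConserved_conservedVector {S : Finset ι} {z : ι → ℂ} {p q k l : ι} (hp : p ∈ S)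
    (hq : q ∈ S) (hk : k ∈ S) (hl : l ∈ S) (hpq : z p - z q ≠ 0) :
    IsConserved S z fun i j => conservedVector z p q k i * conservedVector z p q l j
      - conservedVector z p q l i * conservedVector z p q k j := by
  refine ⟨fun i j => by ring, fun i _ => ?_, fun i _ => ?_⟩
  · simp only [Finset.sum_sub_distrib, ← Finset.mul_sum, sum_conservedVector hp hq hk hpq,
      sum_conservedVector hp hq hl hpq]
    ring
  · simp only [mul_sub, mul_left_comm (z _), Finset.sum_sub_distrib, ← Finset.mul_sum,
      sum_mul_conservedVector hp hq hk hpq, sum_mul_conservedVector hp hq hl hpq]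
    ring

/-- Contracting ω with the vectors `conservedVector` reproduces ω: their entries at p and q are
affine in z k, and conservation annihilates these. Doing this in both arguments and antisymmetrising
writes ω in pairings supported on four labels. -/
lemma IsConserved.eq_sum {S : Finset ι} {z : ι → ℂ} {p q : ι} {ω : ι → ι → ℂ}
    (h : IsConserved S z ω) {i j : ι} (hi : i ∈ S) (hj : j ∈ S) :
    ω i j = ∑ k ∈ S ×ˢ S, ω k.1 k.2 / 2 *
      (conservedVector z p q k.1 i * conservedVector z p q k.2 j
        - conservedVector z p q k.2 i * conservedVector z p q k.1 j) := by
  have step : ∀ k ∈ S, ∀ i ∈ S, ∑ l ∈ S, ω k l * conservedVector z p q l i = ω k i := by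
    intro k hk i hi
    have h1 := h.sum_eq_zero k hk
    have h2 := h.sum_mul_eq_zero k hk
    simp only [conservedVector, mul_add, mul_ite, mul_one, mul_zero, Finset.sum_add_distrib,
      Finset.sum_ite_eq, hi, if_true]
    have e1 : ∑ l ∈ S, ω k l * ((z q - z l) / (z p - z q)) = 0 := by
      have : ∀ l, ω k l * ((z q - z l) / (z p - z q))
          = (z q / (z p - z q)) * ω k l - (1 / (z p - z q)) * (z l * ω k l) := fun l => by ring
      simp only [this, Finset.sum_sub_distrib, ← Finset.mul_sum, h1, h2]
      ring
    have e2 : ∑ l ∈ S, ω k l * ((z l - z p) / (z p - z q)) = 0 := by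
      have : ∀ l, ω k l * ((z l - z p) / (z p - z q))
          = (1 / (z p - z q)) * (z l * ω k l) - (z p / (z p - z q)) * ω k l := fun l => by ring
      simp only [this, Finset.sum_sub_distrib, ← Finset.mul_sum, h1, h2]
      ring
    have e3 : ∀ f : ι → ℂ, ∀ P : Prop, [Decidable P] → ∑ l ∈ S, f l = 0 →
        ∑ l ∈ S, (if P then f l else 0) = 0 := by
      intro f P _ hf
      split_ifs
      · exact hf
      · simp
    rw [e3 _ _ e1, e3 _ _ e2]
    ring
  have key : ∀ i ∈ S, ∀ j ∈ S, ∑ k ∈ S, ∑ l ∈ S,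
      ω k l * (conservedVector z p q k i * conservedVector z p q l j) = ω i j := by
    intro i hi j hj
    rw [h.antisymm, ← step j hj i hi, ← Finset.sum_neg_distrib]
    refine Finset.sum_congr rfl fun k hk => ?_
    rw [← neg_mul, ← h.antisymm, ← step k hk j hj, Finset.sum_mul]
    exact Finset.sum_congr rfl fun _ _ => by ring
  rw [Finset.sum_product]
  have e1 := key i hi j hj
  have e2 := key j hj i hi
  rw [h.antisymm j i] at e2
  have : ∀ k l, ω k l / 2 * (conservedVector z p q k i * conservedVector z p q l j
        - conservedVector z p q l i * conservedVector z p q k j)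
      = 1 / 2 * (ω k l * (conservedVector z p q k i * conservedVector z p q l j))
        - 1 / 2 * (ω k l * (conservedVector z p q k j * conservedVector z p q l i)) :=
    fun k l => by ring
  simp only [this, Finset.sum_sub_distrib, ← Finset.mul_sum, e1, e2]
  ring

/-- On the locus of momentum conservation, the single-trace one-loop expression agrees with the
axion exchange. -/
theorem singleTrace_eq_doubleTrace {T T' : List g → ℂ} (hT : IsColourTrace T)
    (hT' : IsColourTrace T') {lam : ℂ}
    (h4 : ∀ x₁ x₂ x₃ x₄ : g, permSum (fun i j k l => T [i, j, k, l]) x₁ x₂ x₃ x₄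
      = 8 * lam ^ 2 * (T' [x₁, x₂] * T' [x₃, x₄] + T' [x₁, x₃] * T' [x₂, x₄]
        + T' [x₁, x₄] * T' [x₂, x₃]))
    (S : Finset ι) {z : ι → ℂ} (hz : Set.InjOn z S) (x : ι → g) {ω ω' : ι → ι → ℂ}
    (h : IsConserved S z ω) (h' : IsConserved S z ω') :
    singleTrace T S x z ω ω' = lam ^ 2 * doubleTrace T' S x z ω ω' := by
  induction hn : S.card using Nat.strong_induction_on generalizing S x ω ω' with
  | _ n ih =>
  subst hn
  rcases lt_trichotomy S.card 4 with hS | hS | hS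
  · have e1 : singleTrace T S x z ω ω' = 0 := by
      rw [singleTrace, Finset.sum_eq_zero fun l hl => by
        rw [numerator, quadSum_eq_zero_of_length_lt (by
          rw [length_of_mem_orderings hl]; exact hS)]; simp]
      ring
    have e2 : doubleTrace T' S x z ω ω' = 0 := by
      refine Finset.sum_eq_zero fun A hA => ?_
      have := Finset.card_sdiff_add_card_eq_card (Finset.mem_powerset.1 hA)
      rcases (by omega : A.card ≤ 1 ∨ (S \ A).card ≤ 1) with hc | hc
      · rw [parkeTaylor_of_card_le_one T' hc]; ring
      · rw [parkeTaylor_of_card_le_one T' hc]; ring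
    rw [e1, e2, mul_zero]
  · obtain ⟨a, b, c, d, hab, hac, had, hbc, hbd, hcd, rfl⟩ := Finset.card_eq_four.1 hS
    exact singleTrace_four hT' h4 hab hac had hbc hbd hcd hz x h h'
  · obtain ⟨p, hp, q, hq, hpq⟩ := Finset.one_lt_card.1 (by omega : 1 < S.card)
    have hd : z p - z q ≠ 0 := fun e => hpq (hz hp hq (sub_eq_zero.1 e))
    -- By linearity ω' may be taken to be the wedge of two vectors `conservedVector`, whose support
    -- lies in {p, q, k.1, k.2}.
    rw [singleTrace_congr_right x fun i hi j hj => h'.eq_sum (p := p) (q := q) hi hj,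
      doubleTrace_congr_right x fun i hi j hj => h'.eq_sum (p := p) (q := q) hi hj,
      singleTrace_sum_mul, doubleTrace_sum_mul, Finset.mul_sum]
    refine Finset.sum_congr rfl fun k hk => ?_
    obtain ⟨hk1, hk2⟩ := Finset.mem_product.1 hk
    rw [mul_left_comm]
    congr 1
    have hc := isConserved_conservedVector hp hq hk1 hk2 hd
    -- With at least five labels, one lies outside the support of ω'; this is the label that is
    -- removed.
    obtain ⟨m, hm, hmn⟩ : ∃ m ∈ S, m ∉ ({p, q, k.1, k.2} : Finset ι) := by
      by_contra! hcon
      have := Finset.card_le_card (show S ⊆ {p, q, k.1, k.2} from hcon)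
      have := Finset.card_le_four (a := p) (b := q) (c := k.1) (d := k.2)
      omega
    simp only [Finset.mem_insert, Finset.mem_singleton, not_or] at hmn
    have hmv : ∀ l, m ≠ l → conservedVector z p q l m = 0 := fun l hl => by
      simp [conservedVector, hmn.1, hmn.2.1, hl]
    set θ : ι → ι → ℂ := fun i j => conservedVector z p q k.1 i * conservedVector z p q k.2 j
      - conservedVector z p q k.2 i * conservedVector z p q k.1 j with hθ
    have hmS := Finset.notMem_erase m S
    have hcard := Finset.card_erase_of_mem hm
    have hθ0 : ∀ i ∈ S.erase m, θ i m = 0 := fun i _ => by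
      simp [hθ, hmv _ hmn.2.2.1, hmv _ hmn.2.2.2]
    have hz' : Set.InjOn z (insert m (S.erase m) : Finset ι) := by
      rwa [Finset.insert_erase hm]
    rw [← Finset.insert_erase hm] at h hc
    obtain ⟨η, hη⟩ := exists_isBalancing hmS (by omega) hz' h
    rw [← Finset.insert_erase hm, singleTrace_insert hT hmS (by omega) hz' x h hc hθ0 hη,
      doubleTrace_insert hT' hmS hz' x h hc hθ0 hη, Finset.mul_sum]
    refine Finset.sum_congr rfl fun j hj => ?_
    rw [ih _ (by omega) (S.erase m) (hz.mono (by simp)) _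
      (h.mergedPairing hmS hη hj) (hc.of_insert hmS hθ0) rfl]
    ring

end OnShell

/-! ### Traces in representations and the polarised quartic identity -/

section LieTraces

variable {g : Type*} [LieRing g] [LieAlgebra ℂ g]

/-- The trace of a word in a representation. -/
noncomputable def repTrace (M : Type*) [AddCommGroup M] [Module ℂ M] [LieRingModule g M]
    [LieModule ℂ g M] (l : List g) : ℂ :=
  LinearMap.trace ℂ M (l.map (LieModule.toEnd ℂ g M)).prod

lemma isColourTrace_repTrace (M : Type*) [AddCommGroup M] [Module ℂ M] [LieRingModule g M]
    [LieModule ℂ g M] : IsColourTrace (repTrace (g := g) M) where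
  rotate a l := by
    simp only [repTrace, List.map_append, List.map_cons, List.map_nil, List.prod_append,
      List.prod_cons, List.prod_nil, mul_one]
    exact LinearMap.trace_mul_comm ℂ _ _
  bracket a b l := by
    simp only [repTrace, List.map_cons, List.prod_cons, LieHom.map_lie,
      LieRing.of_associative_ring_bracket, sub_mul, map_sub, mul_assoc]
  linear c a b l := by
    simp only [repTrace, List.map_cons, List.prod_cons, map_add, map_smul, add_mul, smul_mul_assoc,
      smul_eq_mul]

lemma IsColourTrace.sub {T T' : List g → ℂ} (hT : IsColourTrace T) (hT' : IsColourTrace T') :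
    IsColourTrace fun l => T l - T' l where
  rotate a l := by rw [hT.rotate, hT'.rotate]
  bracket a b l := by rw [hT.bracket, hT'.bracket]; ring
  linear c a b l := by rw [hT.linear, hT'.linear]; ring

lemma gaugeTrace_eq (R : Type*) [AddCommGroup R] [Module ℂ R] [LieRingModule g R]
    [LieModule ℂ g R] (l : List g) : gaugeTrace R l = repTrace g l - repTrace R l := rfl

lemma isColourTrace_gaugeTrace (R : Type*) [AddCommGroup R] [Module ℂ R] [LieRingModule g R]
    [LieModule ℂ g R] : IsColourTrace (gaugeTrace (g := g) R) :=
  (isColourTrace_repTrace g).sub (isColourTrace_repTrace R)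

lemma repTrace_pair (V : Type*) [AddCommGroup V] [Module ℂ V] [LieRingModule g V]
    [LieModule ℂ g V] (x y : g) : repTrace V [x, y] = trPair V x y := by
  simp [repTrace, trPair]

/-- Inclusion-exclusion over the subsets of the four letters leaves exactly the noncommutative
monomials that use all of them. -/
lemma permSum_mul_eq {A : Type*} [Ring A] (a b c d : A) :
    permSum (fun i j k l => i * (j * (k * l))) a b c d
      = (a + b + c + d) ^ 4 - (a + b + c) ^ 4 - (a + b + d) ^ 4 - (a + c + d) ^ 4 - (b + c + d) ^ 4
        + (a + b) ^ 4 + (a + c) ^ 4 + (a + d) ^ 4 + (b + c) ^ 4 + (b + d) ^ 4 + (c + d) ^ 4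
        - a ^ 4 - b ^ 4 - c ^ 4 - d ^ 4 := by
  simp only [permSum]
  noncomm_ring

lemma permSum_repTrace (M : Type*) [AddCommGroup M] [Module ℂ M] [LieRingModule g M]
    [LieModule ℂ g M] (a b c d : g) :
    permSum (fun i j k l => repTrace M [i, j, k, l]) a b c d
      = (fun X : g => repTrace M [X, X, X, X]) (a + b + c + d)
        - (fun X : g => repTrace M [X, X, X, X]) (a + b + c)
        - (fun X : g => repTrace M [X, X, X, X]) (a + b + d)
        - (fun X : g => repTrace M [X, X, X, X]) (a + c + d)
        - (fun X : g => repTrace M [X, X, X, X]) (b + c + d)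
        + (fun X : g => repTrace M [X, X, X, X]) (a + b)
        + (fun X : g => repTrace M [X, X, X, X]) (a + c)
        + (fun X : g => repTrace M [X, X, X, X]) (a + d)
        + (fun X : g => repTrace M [X, X, X, X]) (b + c)
        + (fun X : g => repTrace M [X, X, X, X]) (b + d)
        + (fun X : g => repTrace M [X, X, X, X]) (c + d)
        - (fun X : g => repTrace M [X, X, X, X]) a - (fun X : g => repTrace M [X, X, X, X]) b
        - (fun X : g => repTrace M [X, X, X, X]) c - (fun X : g => repTrace M [X, X, X, X]) d := by
  have h := congrArg (LinearMap.trace ℂ M) (permSum_mul_eq (LieModule.toEnd ℂ g M a)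
    (LieModule.toEnd ℂ g M b) (LieModule.toEnd ℂ g M c) (LieModule.toEnd ℂ g M d))
  have hpow : ∀ X : g, repTrace M [X, X, X, X]
      = LinearMap.trace ℂ M (LieModule.toEnd ℂ g M X ^ 4) := by
    intro X
    rw [pow_succ', pow_succ', pow_succ', pow_one]
    simp [repTrace]
  simp only [hpow, map_add, map_sub] at h ⊢
  rw [← h]
  simp [permSum, repTrace]

lemma trPair_add_left (V : Type*) [AddCommGroup V] [Module ℂ V] [LieRingModule g V]
    [LieModule ℂ g V] (x y w : g) : trPair V (x + y) w = trPair V x w + trPair V y w := by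
  simp [trPair, add_mul]

lemma trPair_comm (V : Type*) [AddCommGroup V] [Module ℂ V] [LieRingModule g V]
    [LieModule ℂ g V] (x y : g) : trPair V x y = trPair V y x :=
  LinearMap.trace_mul_comm ℂ _ _

lemma trPair_add_right (V : Type*) [AddCommGroup V] [Module ℂ V] [LieRingModule g V]
    [LieModule ℂ g V] (x y w : g) : trPair V w (x + y) = trPair V w x + trPair V w y := by
  simp [trPair, mul_add]

/-- The polarised form of the quartic trace identity. -/
lemma permSum_gaugeTrace {V : Type*} [AddCommGroup V] [Module ℂ V] [LieRingModule g V]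
    [LieModule ℂ g V] {R : Type*} [AddCommGroup R] [Module ℂ R] [LieRingModule g R]
    [LieModule ℂ g R] {lam : ℂ}
    (hlam : ∀ X : g, gaugeTrace R [X, X, X, X] = lam ^ 2 * trPair V X X ^ 2) (a b c d : g) :
    permSum (fun i j k l => gaugeTrace R [i, j, k, l]) a b c d
      = 8 * lam ^ 2 * (repTrace V [a, b] * repTrace V [c, d]
        + repTrace V [a, c] * repTrace V [b, d] + repTrace V [a, d] * repTrace V [b, c]) := by
  have h1 : permSum (fun i j k l => gaugeTrace R [i, j, k, l]) a b c d
      = permSum (fun i j k l => repTrace g [i, j, k, l]) a b c d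
        - permSum (fun i j k l => repTrace R [i, j, k, l]) a b c d := by
    simp only [permSum, gaugeTrace_eq]
    ring
  have h2 : ∀ X : g, repTrace g [X, X, X, X]
      = repTrace R [X, X, X, X] + lam ^ 2 * trPair V X X ^ 2 := by
    intro X
    rw [← hlam, gaugeTrace_eq]
    ring
  rw [h1, permSum_repTrace, permSum_repTrace]
  -- In the polarisation of tr(X²)², each of the three pairings of the four letters arises from 8 of
  -- the 24 orderings.
  simp only [h2, repTrace_pair, trPair_add_left, trPair_add_right]
  rw [trPair_comm V b a, trPair_comm V c a, trPair_comm V d a, trPair_comm V c b,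
    trPair_comm V d b, trPair_comm V d c]
  ring

end LieTraces

/-! ### Rational functions with poles at coincident points -/

section RationalFunctions

variable {ι : Type*}

/-- Rational functions of the positions whose poles are at coincident points of `S`. -/
inductive IsRationalOn (S : Finset ι) : ((ι → ℂ) → ℂ) → Prop
  | const (c : ℂ) : IsRationalOn S fun _ => c
  | coord (i : ι) : IsRationalOn S fun z => z i
  | inv {i j : ι} (hi : i ∈ S) (hj : j ∈ S) (hij : i ≠ j) : IsRationalOn S fun z => (z i - z j)⁻¹
  | add {f g : (ι → ℂ) → ℂ} (hf : IsRationalOn S f) (hg : IsRationalOn S g) :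
      IsRationalOn S fun z => f z + g z
  | mul {f g : (ι → ℂ) → ℂ} (hf : IsRationalOn S f) (hg : IsRationalOn S g) :
      IsRationalOn S fun z => f z * g z

lemma sub_dvd_prod_prod_Ioi {R : Type*} [CommRing R] {n : ℕ} (x : Fin n → R) {i j : Fin n}
    (hij : i < j) : x i - x j ∣ ∏ i, ∏ j ∈ Finset.Ioi i, (x i - x j) := by
  have h1 : x i - x j ∣ ∏ k ∈ Finset.Ioi i, (x i - x k) :=
    Finset.dvd_prod_of_mem (fun k => x i - x k) (Finset.mem_Ioi.2 hij)
  exact h1.trans (Finset.dvd_prod_of_mem (fun i => ∏ k ∈ Finset.Ioi i, (x i - x k))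
    (Finset.mem_univ i))

namespace IsRationalOn

variable {S : Finset ι}

lemma mono {S' : Finset ι} (hS : S ⊆ S') {f : (ι → ℂ) → ℂ} (hf : IsRationalOn S f) :
    IsRationalOn S' f := by
  induction hf with
  | const c => exact const c
  | coord i => exact coord i
  | inv hi hj hij => exact inv (hS hi) (hS hj) hij
  | add _ _ h1 h2 => exact add h1 h2
  | mul _ _ h1 h2 => exact mul h1 h2

lemma sub {f g : (ι → ℂ) → ℂ} (hf : IsRationalOn S f) (hg : IsRationalOn S g) :
    IsRationalOn S fun z => f z - g z := by
  have := hf.add ((const (-1)).mul hg)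
  convert this using 2
  ring

lemma sum {κ : Type*} {s : Finset κ} {f : κ → (ι → ℂ) → ℂ}
    (h : ∀ k ∈ s, IsRationalOn S (f k)) : IsRationalOn S fun z => ∑ k ∈ s, f k z := by
  classical
  induction s using Finset.induction_on with
  | empty => simpa using const 0
  | insert k s hk ih =>
    simp only [Finset.sum_insert hk]
    exact (h k (Finset.mem_insert_self k s)).add
      (ih fun j hj => h j (Finset.mem_insert_of_mem hj))

lemma inv_sub {i j : ι} (hi : i ∈ S) (hj : j ∈ S) : IsRationalOn S fun z => (z i - z j)⁻¹ := by
  by_cases hij : i = j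
  · subst hij
    simpa using const 0
  · exact inv hi hj hij

lemma inv_path {l : List ι} (hl : ∀ i ∈ l, i ∈ S) : IsRationalOn S fun z => (path z l)⁻¹ := by
  induction l with
  | nil => simpa [path] using const 1
  | cons a l ih =>
    rcases l with _ | ⟨b, l⟩
    · simpa [path] using const 1
    · simp only [path, mul_inv]
      exact (inv_sub (hl a (by simp)) (hl b (by simp))).mul
        (ih fun i hi => hl i (List.mem_cons_of_mem _ hi))

lemma inv_cyc {l : List ι} (hl : ∀ i ∈ l, i ∈ S) : IsRationalOn S fun z => (cyc z l)⁻¹ := by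
  rcases l with _ | ⟨a, l⟩
  · simpa [cyc] using const 1
  · exact inv_path fun i hi => hl i (by simpa [or_comm, or_assoc] using hi)

lemma differentiableAt [Fintype ι] {f : (ι → ℂ) → ℂ} (hf : IsRationalOn S f) {z : ι → ℂ}
    (hz : Set.InjOn z S) : DifferentiableAt ℂ f z := by
  induction hf with
  | const c => exact differentiableAt_const c
  | coord i => exact differentiableAt_apply i z
  | inv hi hj hij =>
    exact ((differentiableAt_apply _ z).sub (differentiableAt_apply _ z)).inv
      fun h => hij (hz hi hj (sub_eq_zero.1 h))
  | add _ _ h1 h2 => exact h1.add h2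
  | mul _ _ h1 h2 => exact h1.mul h2

/-- Up to sign every difference of positions divides the Vandermonde product, so its powers serve as
common denominators. -/
lemma exists_eq_div {n : ℕ} {S : Finset (Fin n)} {f : (Fin n → ℂ) → ℂ} (hf : IsRationalOn S f) :
    ∃ (P : MvPolynomial (Fin n) ℂ) (m : ℕ), ∀ z : Fin n → ℂ, Function.Injective z →
      f z = MvPolynomial.eval z P / (∏ i, ∏ j ∈ Finset.Ioi i, (z i - z j)) ^ m := by
  set D : (Fin n → ℂ) → ℂ := fun z => ∏ i, ∏ j ∈ Finset.Ioi i, (z i - z j) with hD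
  set DP : MvPolynomial (Fin n) ℂ := ∏ i, ∏ j ∈ Finset.Ioi i, (MvPolynomial.X i - MvPolynomial.X j)
    with hDP
  have hev : ∀ z, MvPolynomial.eval z DP = D z := fun z => by simp [hD, hDP, map_prod]
  have hne : ∀ z, Function.Injective z → D z ≠ 0 := fun z hz =>
    Finset.prod_ne_zero_iff.2 fun i _ => Finset.prod_ne_zero_iff.2 fun j hj h =>
      (Finset.mem_Ioi.1 hj).ne (hz (sub_eq_zero.1 h))
  induction hf with
  | const c => exact ⟨MvPolynomial.C c, 0, fun z _ => by simp⟩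
  | coord i => exact ⟨MvPolynomial.X i, 0, fun z _ => by simp⟩
  | @inv i j _ _ hij =>
    have key : ∀ i j : Fin n, i < j → ∃ P : MvPolynomial (Fin n) ℂ, ∀ z : Fin n → ℂ,
        Function.Injective z → (z i - z j)⁻¹ = MvPolynomial.eval z P / D z ^ 1 := by
      intro i j hij
      obtain ⟨P, hP⟩ : (MvPolynomial.X i - MvPolynomial.X j : MvPolynomial (Fin n) ℂ) ∣ DP :=
        sub_dvd_prod_prod_Ioi (R := MvPolynomial (Fin n) ℂ) MvPolynomial.X hij
      refine ⟨P, fun z hz => ?_⟩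
      have h1 : D z = (z i - z j) * MvPolynomial.eval z P := by rw [← hev, hP]; simp
      have h2 := hne z hz
      rw [h1] at h2
      have h3 := left_ne_zero_of_mul h2
      have h4 := right_ne_zero_of_mul h2
      rw [h1]
      field_simp
    rcases lt_or_gt_of_ne hij with h | h
    · obtain ⟨P, hP⟩ := key i j h
      exact ⟨P, 1, hP⟩
    · obtain ⟨P, hP⟩ := key j i h
      refine ⟨-P, 1, fun z hz => ?_⟩
      change (z i - z j)⁻¹ = _ / D z ^ 1
      rw [← neg_sub, inv_neg, hP z hz, map_neg, neg_div]
  | add _ _ h1 h2 =>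
    obtain ⟨P, m, hP⟩ := h1
    obtain ⟨Q, k, hQ⟩ := h2
    refine ⟨P * DP ^ k + Q * DP ^ m, m + k, fun z hz => ?_⟩
    have := hne z hz
    beta_reduce
    rw [hP z hz, hQ z hz]
    simp only [map_add, map_mul, map_pow, hev]
    change _ / D z ^ m + _ / D z ^ k = _ / D z ^ (m + k)
    rw [pow_add]
    field_simp
  | mul _ _ h1 h2 =>
    obtain ⟨P, m, hP⟩ := h1
    obtain ⟨Q, k, hQ⟩ := h2
    refine ⟨P * Q, m + k, fun z hz => ?_⟩
    beta_reduce
    rw [hP z hz, hQ z hz, map_mul, div_mul_div_comm, pow_add]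

end IsRationalOn

end RationalFunctions

/-! ### Relabelling, rationality and linearity of the building blocks -/

section Reindexing

variable {ι κ : Type*} [DecidableEq ι] [DecidableEq κ] {g : Type*} [LieRing g] [LieAlgebra ℂ g]

lemma path_map (e : ι → κ) (z : κ → ℂ) (l : List ι) : path z (l.map e) = path (z ∘ e) l := by
  induction l with
  | nil => rfl
  | cons a l ih =>
    rcases l with _ | ⟨b, l⟩
    · rfl
    · simp only [List.map_cons, path, Function.comp_apply] at ih ⊢
      rw [ih]

lemma cyc_map (e : ι → κ) (z : κ → ℂ) (l : List ι) : cyc z (l.map e) = cyc (z ∘ e) l := by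
  rcases l with _ | ⟨a, l⟩
  · rfl
  · rw [List.map_cons, cyc, cyc, ← path_map]
    simp

lemma sum_orderings_map (e : ι ↪ κ) (S : Finset ι) (F : List κ → ℂ) :
    ∑ l ∈ orderings (S.map e), F l = ∑ l ∈ orderings S, F (l.map e) := by
  symm
  refine Finset.sum_nbij (List.map e) (fun l hl => ?_)
    ((List.map_injective_iff.2 e.injective).injOn) (fun l hl => ?_) fun _ _ => rfl
  · obtain ⟨h1, h2⟩ := mem_orderings.1 hl
    exact mem_orderings.2 ⟨h1.map e.injective, fun a => by simp [h2]⟩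
  · obtain ⟨h1, h2⟩ := mem_orderings.1 hl
    have : l ∈ Set.range (List.map e) := by
      rw [Set.range_list_map]
      intro a ha
      obtain ⟨b, _, hb⟩ := Finset.mem_map.1 ((h2 a).1 ha)
      exact ⟨b, hb⟩
    obtain ⟨l', rfl⟩ := this
    refine ⟨l', mem_orderings.2 ⟨List.Nodup.of_map _ h1, fun a => ?_⟩, rfl⟩
    have := h2 (e a)
    simpa using this

lemma parkeTaylor_map (e : ι ↪ κ) (T : List g → ℂ) (S : Finset ι) (x : κ → g) (z : κ → ℂ) :
    parkeTaylor T (S.map e) x z = parkeTaylor T S (x ∘ e) (z ∘ e) := by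
  simp only [parkeTaylor, sum_orderings_map, Finset.card_map, cyc_map, List.map_map]

lemma pairing_map (e : ι ↪ κ) (S : Finset ι) (z : κ → ℂ) (ω : κ → κ → ℂ) :
    pairing (S.map e) z ω = pairing S (z ∘ e) fun i j => ω (e i) (e j) := by
  simp [pairing]

lemma isRationalOn_parkeTaylor (T : List g → ℂ) (S : Finset ι) (x : ι → g) :
    IsRationalOn S fun z => parkeTaylor T S x z := by
  simp only [parkeTaylor, div_eq_mul_inv]
  exact (IsRationalOn.const _).mul (IsRationalOn.sum fun l hl =>
    (IsRationalOn.const _).mul (IsRationalOn.inv_cyc fun i hi => ((mem_orderings.1 hl).2 i).1 hi))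

lemma isRationalOn_pairing (S : Finset ι) (ω : ι → ι → ℂ) :
    IsRationalOn S fun z => pairing S z ω :=
  (IsRationalOn.const _).mul (IsRationalOn.sum fun _ _ => IsRationalOn.sum fun _ _ =>
    (IsRationalOn.const _).mul ((IsRationalOn.coord _).sub (IsRationalOn.coord _)))

lemma parkeTaylor_linear {T : List g → ℂ} (hT : IsColourTrace T) {S : Finset ι} {m : ι}
    (hm : m ∉ S) {x₁ x₂ x₃ : ι → g} (h₁ : ∀ i ∈ S, x₁ i = x₃ i) (h₂ : ∀ i ∈ S, x₂ i = x₃ i) {c : ℂ}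
    (h₃ : x₃ m = c • x₁ m + x₂ m) (z : ι → ℂ) :
    parkeTaylor T (insert m S) x₃ z
      = c * parkeTaylor T (insert m S) x₁ z + parkeTaylor T (insert m S) x₂ z := by
  simp only [parkeTaylor_eq hT (Finset.mem_insert_self m S), Finset.erase_insert hm,
    Finset.mul_sum, ← Finset.sum_add_distrib]
  refine Finset.sum_congr rfl fun t ht => ?_
  have hmem := (mem_orderings.1 ht).2
  rw [List.map_cons, List.map_cons, List.map_cons, h₃, hT.linear,
    List.map_congr_left fun a ha => h₁ a ((hmem a).1 ha),
    List.map_congr_left fun a ha => h₂ a ((hmem a).1 ha)]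
  ring

end Reindexing

/-! ### Correlators with a single axion field -/

section Components

variable {ι κ : Type*} [DecidableEq ι] [DecidableEq κ] {g : Type*} [LieRing g] [LieAlgebra ℂ g]

namespace Gen

/-- The colour of a generator in the `J` tower. -/
def colour : Gen g → g
  | J x _ _ => x
  | _ => 0

/-- The first mode number of a generator in the `J` tower. -/
def mode₁ : Gen g → ℕ
  | J _ r _ => r
  | _ => 0

/-- The second mode number of a generator in the `J` tower. -/
def mode₂ : Gen g → ℕ
  | J _ _ s => s
  | _ => 0

/-- The gluon that appears in the operator product of two gluons. -/
def fuse : Gen g → Gen g → Gen g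
  | J x r s, J y t u => J ⁅x, y⁆ (r + t) (s + u)
  | _, b => b

lemma IsJ.eq {a : Gen g} (h : a.IsJ) : a = J a.colour a.mode₁ a.mode₂ := by
  cases a <;> first | rfl | exact h.elim

end Gen

open Gen

/-- The antisymmetric pairing of the mode numbers. -/
def modePairing (A : ι → Gen g) (i j : ι) : ℂ :=
  (A i).mode₁ * (A j).mode₂ - (A i).mode₂ * (A j).mode₁

lemma modePairing_antisymm (A : ι → Gen g) (i j : ι) : modePairing A i j = -modePairing A j i := by
  simp only [modePairing]; ring

/-- Each of the two mode numbers adds up to `1`. -/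
def HasUnitModes (S : Finset ι) (A : ι → Gen g) : Prop :=
  ∑ i ∈ S, (A i).mode₁ = 1 ∧ ∑ i ∈ S, (A i).mode₂ = 1

section

variable (V : Type*) [AddCommGroup V] [Module ℂ V] [LieRingModule g V] [LieModule ℂ g V] (lam : ℂ)

open Classical in
/-- The correlator of the generators in `S` with a single axion field of `(tr ρ)²`. -/
noncomputable def component (S : Finset ι) (A : ι → Gen g) (z : ι → ℂ) : ℂ :=
  if ∀ i ∈ S, (A i).IsJ then
    if HasUnitModes S A then
      -axionCoupling lam *
        (parkeTaylor (repTrace V) S (fun i => (A i).colour) z * pairing S z (modePairing A))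
    else 0
  else if ∃ i, S = {i} ∧ A i = F 0 0 then 1 else 0

variable {V lam} {S : Finset ι} {A : ι → Gen g} {z : ι → ℂ}

lemma component_of_isJ (h : ∀ i ∈ S, (A i).IsJ) (h1 : HasUnitModes S A) :
    component V lam S A z = -axionCoupling lam *
        (parkeTaylor (repTrace V) S (fun i => (A i).colour) z * pairing S z (modePairing A)) := by
  rw [component, if_pos h, if_pos h1]

lemma component_of_not_hasUnitModes (h : ∀ i ∈ S, (A i).IsJ) (h1 : ¬HasUnitModes S A) :
    component V lam S A z = 0 := by
  rw [component, if_pos h, if_neg h1]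

lemma component_eq_zero_of_two_mem {i j : ι} (hi : i ∈ S) (hj : j ∈ S) (hij : i ≠ j)
    (h : ¬(A i).IsJ) : component V lam S A z = 0 := by
  rw [component, if_neg fun h' => h (h' i hi), if_neg]
  rintro ⟨k, rfl, _⟩
  rw [Finset.mem_singleton] at hi hj
  exact hij (hi.trans hj.symm)

lemma component_eq_zero_of_mem {i : ι} (hi : i ∈ S) (h : ¬(A i).IsJ) (h' : A i ≠ F 0 0) :
    component V lam S A z = 0 := by
  rw [component, if_neg fun h' => h (h' i hi), if_neg]
  rintro ⟨k, rfl, hk⟩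
  rw [Finset.mem_singleton] at hi
  exact h' (hi ▸ hk)

lemma component_empty : component V lam (∅ : Finset ι) A z = 0 :=
  component_of_not_hasUnitModes (by simp) (by simp [HasUnitModes])

lemma component_singleton_F {i : ι} (h : A i = F 0 0) : component V lam {i} A z = 1 := by
  rw [component, if_neg, if_pos ⟨i, rfl, h⟩]
  intro h'
  have := h' i (Finset.mem_singleton_self i)
  rw [h] at this
  exact this

lemma component_singleton_of_ne {i : ι} (h : A i ≠ F 0 0) : component V lam {i} A z = 0 := by
  by_cases hJ : (A i).IsJ
  · by_cases h1 : HasUnitModes {i} A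
    · rw [component_of_isJ (by simpa using hJ) h1, pairing_singleton]; ring
    · exact component_of_not_hasUnitModes (by simpa using hJ) h1
  · exact component_eq_zero_of_mem (Finset.mem_singleton_self i) hJ h

lemma ite_eq_ite {α : Type*} {p q : Prop} {_ : Decidable p} {_ : Decidable q} {a b c d : α}
    (h : p ↔ q) (h1 : a = c) (h2 : b = d) : (if p then a else b) = if q then c else d :=
  if_congr h h1 h2

lemma component_congr {A' : ι → Gen g} {z' : ι → ℂ} (hA : ∀ i ∈ S, A i = A' i)
    (hz : ∀ i ∈ S, z i = z' i) : component V lam S A z = component V lam S A' z' := by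
  have e1 : (∀ i ∈ S, (A i).IsJ) ↔ ∀ i ∈ S, (A' i).IsJ :=
    forall₂_congr fun i hi => by rw [hA i hi]
  have e2 : HasUnitModes S A ↔ HasUnitModes S A' := by
    rw [HasUnitModes, HasUnitModes, Finset.sum_congr rfl fun i hi => by rw [hA i hi],
      Finset.sum_congr (s₁ := S) (f := fun i => (A i).mode₂) rfl fun i hi => by rw [hA i hi]]
  have e3 : (∃ i, S = {i} ∧ A i = F 0 0) ↔ ∃ i, S = {i} ∧ A' i = F 0 0 :=
    exists_congr fun i => and_congr_right fun h => by rw [hA i (by simp [h])]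
  rw [component, component]
  refine ite_eq_ite e1 (ite_eq_ite e2 ?_ rfl) (ite_eq_ite e3 rfl rfl)
  rw [parkeTaylor_congr (fun i hi => by rw [hA i hi]) hz,
    pairing_congr hz fun i hi j hj => by rw [modePairing, hA i hi, hA j hj]]
  rfl

lemma component_map (e : ι ↪ κ) (S : Finset ι) (A : κ → Gen g) (z : κ → ℂ) :
    component V lam (S.map e) A z = component V lam S (A ∘ e) (z ∘ e) := by
  have e3 : (∃ i, S.map e = {i} ∧ A i = F 0 0) ↔ ∃ i, S = {i} ∧ A (e i) = F 0 0 := by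
    constructor
    · rintro ⟨i, h1, h2⟩
      have : i ∈ S.map e := by simp [h1]
      obtain ⟨j, _, rfl⟩ := Finset.mem_map.1 this
      refine ⟨j, ?_, h2⟩
      rwa [← Finset.map_singleton, Finset.map_inj] at h1
    · rintro ⟨i, rfl, h2⟩
      exact ⟨e i, by simp, h2⟩
  have e2 : HasUnitModes (S.map e) A ↔ HasUnitModes S (A ∘ e) := by
    simp [HasUnitModes]
  rw [component, component]
  refine ite_eq_ite Finset.forall_mem_map (ite_eq_ite e2 ?_ rfl) (ite_eq_ite e3 rfl rfl)
  rw [parkeTaylor_map, pairing_map]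
  rfl

lemma isRationalOn_component (S : Finset ι) (A : ι → Gen g) :
    IsRationalOn S fun z => component V lam S A z := by
  unfold component
  split_ifs
  · exact (IsRationalOn.const _).mul
      ((isRationalOn_parkeTaylor _ _ _).mul (isRationalOn_pairing _ _))
  all_goals exact IsRationalOn.const _

lemma component_linear {m : ι} (hm : m ∉ S) {A₁ A₂ A₃ : ι → Gen g} (h₁ : ∀ i ∈ S, A₁ i = A₃ i)
    (h₂ : ∀ i ∈ S, A₂ i = A₃ i) {c : ℂ} {x y : g} {r s : ℕ} (e₁ : A₁ m = J x r s)
    (e₂ : A₂ m = J y r s) (e₃ : A₃ m = J (c • x + y) r s) :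
    component V lam (insert m S) A₃ z
      = c * component V lam (insert m S) A₁ z + component V lam (insert m S) A₂ z := by
  by_cases hJ : ∀ i ∈ S, (A₃ i).IsJ
  · have j₁ : ∀ i ∈ insert m S, (A₁ i).IsJ := fun i hi => by
      rcases Finset.mem_insert.1 hi with rfl | hi
      · rw [e₁]; trivial
      · rw [h₁ i hi]; exact hJ i hi
    have j₂ : ∀ i ∈ insert m S, (A₂ i).IsJ := fun i hi => by
      rcases Finset.mem_insert.1 hi with rfl | hi
      · rw [e₂]; trivial
      · rw [h₂ i hi]; exact hJ i hi
    have j₃ : ∀ i ∈ insert m S, (A₃ i).IsJ := fun i hi => by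
      rcases Finset.mem_insert.1 hi with rfl | hi
      · rw [e₃]; trivial
      · exact hJ i hi
    have r₁ : ∀ i ∈ insert m S, (A₁ i).mode₁ = (A₃ i).mode₁ ∧ (A₁ i).mode₂ = (A₃ i).mode₂ :=
      fun i hi => by
      rcases Finset.mem_insert.1 hi with rfl | hi
      · rw [e₁, e₃]; exact ⟨rfl, rfl⟩
      · rw [h₁ i hi]; exact ⟨rfl, rfl⟩
    have r₂ : ∀ i ∈ insert m S, (A₂ i).mode₁ = (A₃ i).mode₁ ∧ (A₂ i).mode₂ = (A₃ i).mode₂ :=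
      fun i hi => by
      rcases Finset.mem_insert.1 hi with rfl | hi
      · rw [e₂, e₃]; exact ⟨rfl, rfl⟩
      · rw [h₂ i hi]; exact ⟨rfl, rfl⟩
    have u₁ : HasUnitModes (insert m S) A₁ ↔ HasUnitModes (insert m S) A₃ := by
      rw [HasUnitModes, HasUnitModes, Finset.sum_congr rfl fun i hi => (r₁ i hi).1,
        Finset.sum_congr (f := fun i => (A₁ i).mode₂) rfl fun i hi => (r₁ i hi).2]
    have u₂ : HasUnitModes (insert m S) A₂ ↔ HasUnitModes (insert m S) A₃ := by
      rw [HasUnitModes, HasUnitModes, Finset.sum_congr rfl fun i hi => (r₂ i hi).1,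
        Finset.sum_congr (f := fun i => (A₂ i).mode₂) rfl fun i hi => (r₂ i hi).2]
    by_cases hu : HasUnitModes (insert m S) A₃
    · rw [component_of_isJ j₁ (u₁.2 hu), component_of_isJ j₂ (u₂.2 hu), component_of_isJ j₃ hu,
        parkeTaylor_linear (isColourTrace_repTrace V) hm (x₁ := fun i => (A₁ i).colour)
          (x₂ := fun i => (A₂ i).colour) (c := c) (fun i hi => by rw [h₁ i hi])
          (fun i hi => by rw [h₂ i hi]) (by rw [e₁, e₂, e₃]; rfl),
        pairing_congr (fun _ _ => rfl) fun i hi j hj =>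
          show modePairing A₁ i j = modePairing A₃ i j by
            rw [modePairing, (r₁ i hi).1, (r₁ i hi).2, (r₁ j hj).1, (r₁ j hj).2]; rfl,
        pairing_congr (fun _ _ => rfl) fun i hi j hj =>
          show modePairing A₂ i j = modePairing A₃ i j by
            rw [modePairing, (r₂ i hi).1, (r₂ i hi).2, (r₂ j hj).1, (r₂ j hj).2]; rfl]
      ring
    · rw [component_of_not_hasUnitModes j₁ (fun h => hu (u₁.1 h)),
        component_of_not_hasUnitModes j₂ (fun h => hu (u₂.1 h)),
        component_of_not_hasUnitModes j₃ hu]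
      ring
  · push Not at hJ
    obtain ⟨i, hi, hJ⟩ := hJ
    have hne : i ≠ m := by rintro rfl; exact hm hi
    have h0 : ∀ A : ι → Gen g, A i = A₃ i → component V lam (insert m S) A z = 0 := fun A hA =>
      component_eq_zero_of_two_mem (Finset.mem_insert_of_mem hi) (Finset.mem_insert_self m S) hne
        (by rwa [hA])
    rw [h0 A₁ (h₁ i hi), h0 A₂ (h₂ i hi), h0 A₃ rfl]
    ring

/-- Mode numbers add when two gluons fuse and the mode pairing is bilinear in them, so they behave
like momenta. -/
lemma modePairing_update_fuse {m j : ι} (hm : (A m).IsJ) (hj : (A j).IsJ) (i k : ι) :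
    merge (modePairing A) m j i k = modePairing (Function.update A j ((A m).fuse (A j))) i k := by
  have h1 : ((A m).fuse (A j)).mode₁ = (A m).mode₁ + (A j).mode₁ := by rw [hm.eq, hj.eq]; rfl
  have h2 : ((A m).fuse (A j)).mode₂ = (A m).mode₂ + (A j).mode₂ := by rw [hm.eq, hj.eq]; rfl
  by_cases hij : i = j <;> by_cases hkj : k = j
  · subst hij hkj
    simp only [merge, modePairing, Function.update_self, h1, h2, if_true]
    push_cast; ring
  · subst hij
    simp only [merge, modePairing, Function.update_self, Function.update_of_ne hkj, h1, h2, if_true,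
      if_neg hkj]
    push_cast; ring
  · subst hkj
    simp only [merge, modePairing, Function.update_self, Function.update_of_ne hij, h1, h2, if_true,
      if_neg hij]
    push_cast; ring
  · simp [merge, modePairing, hij, hkj]

/-- The recursion for the correlator with a single axion field: the poles in the position of a gluon
are those of the operator product with the other gluons. -/
lemma component_insert {m : ι} (hm : m ∉ S) (hS : 2 ≤ S.card)
    (hz : Set.InjOn z (insert m S : Finset ι)) (hJ : (A m).IsJ) :
    component V lam (insert m S) A z = ∑ j ∈ S, 1 / (z m - z j) *
      component V lam S (Function.update A j ((A m).fuse (A j))) z := by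
  have hmj : ∀ j ∈ S, m ≠ j := fun j hj => by rintro rfl; exact hm hj
  by_cases hJS : ∀ i ∈ S, (A i).IsJ
  · have hins : ∀ i ∈ insert m S, (A i).IsJ := by
      simpa [hJ] using hJS
    have hJ' : ∀ j ∈ S, ∀ i ∈ S, (Function.update A j ((A m).fuse (A j)) i).IsJ := by
      intro j hj i hi
      by_cases hij : i = j
      · subst hij
        rw [Function.update_self, hJ.eq, (hJS i hi).eq]
        trivial
      · rw [Function.update_of_ne hij]; exact hJS i hi
    have hsum : ∀ (f : Gen g → ℕ), (∀ j ∈ S, f ((A m).fuse (A j)) = f (A m) + f (A j)) →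
        ∀ j ∈ S, ∑ i ∈ S, f (Function.update A j ((A m).fuse (A j)) i)
          = ∑ i ∈ insert m S, f (A i) := by
      intro f hf j hj
      rw [Finset.sum_insert hm, ← Finset.add_sum_erase _ _ hj, Function.update_self, hf j hj,
        ← Finset.add_sum_erase S (fun i => f (A i)) hj,
        Finset.sum_congr rfl fun i hi => by rw [Function.update_of_ne (Finset.ne_of_mem_erase hi)]]
      ring
    have hu : ∀ j ∈ S, (HasUnitModes S (Function.update A j ((A m).fuse (A j)))
        ↔ HasUnitModes (insert m S) A) := by
      intro j hj
      rw [HasUnitModes, HasUnitModes,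
        hsum mode₁ (fun j hj => by rw [hJ.eq, (hJS j hj).eq]; rfl) j hj,
        hsum mode₂ (fun j hj => by rw [hJ.eq, (hJS j hj).eq]; rfl) j hj]
    by_cases h1 : HasUnitModes (insert m S) A
    -- The modes stay fixed while m moves and no conservation law has to be maintained, so η = 0.
    · rw [component_of_isJ hins h1, parkeTaylor_mul_pairing_insert (isColourTrace_repTrace V) hm hS
        hz _ (η := fun _ _ => 0) (modePairing_antisymm A) (by simp) (by simp), Finset.mul_sum]
      refine Finset.sum_congr rfl fun j hj => ?_
      rw [component_of_isJ (hJ' j hj) ((hu j hj).2 h1)]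
      have e1 : parkeTaylor (repTrace V) S (Function.update (fun i => (A i).colour) j
          ⁅(A m).colour, (A j).colour⁆) z = parkeTaylor (repTrace V) S
            (fun i => (Function.update A j ((A m).fuse (A j)) i).colour) z := by
        refine parkeTaylor_congr (fun i hi => ?_) fun _ _ => rfl
        by_cases hij : i = j
        · subst hij
          rw [Function.update_self, Function.update_self, hJ.eq, (hJS i hi).eq]
          rfl
        · rw [Function.update_of_ne hij, Function.update_of_ne hij]
      rw [e1, pairing_congr (fun _ _ => rfl) fun i hi k hk => by
        simp only [mul_zero, add_zero]
        exact modePairing_update_fuse hJ (hJS j hj) i k]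
      ring
    · rw [component_of_not_hasUnitModes hins h1, Finset.sum_eq_zero]
      intro j hj
      rw [component_of_not_hasUnitModes (hJ' j hj) fun h => h1 ((hu j hj).1 h), mul_zero]
  · push Not at hJS
    obtain ⟨i, hi, hJi⟩ := hJS
    rw [component_eq_zero_of_two_mem (Finset.mem_insert_of_mem hi) (Finset.mem_insert_self m S)
      (hmj i hi).symm hJi, Finset.sum_eq_zero]
    intro j hj
    obtain ⟨k, hk, hki⟩ := Finset.exists_mem_ne hS i
    rw [component_eq_zero_of_two_mem hi hk hki.symm, mul_zero]
    by_cases hij : i = j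
    · subst hij
      have : (A m).fuse (A i) = A i := by
        rw [hJ.eq]
        revert hJi
        generalize A i = b
        intro hb
        cases b <;> first | rfl | exact (hb trivial).elim
      rwa [Function.update_self, this]
    · rwa [Function.update_of_ne hij]

/-- This explains the normalisation −λ̂ of `component`: the Parke-Taylor factor of a pair is
−tr(xy)/(z m − z j)², and the two signs combine into the F coefficient of the product of two gluons.
-/
lemma component_pair {m j : ι} (hmj : m ≠ j) (hz : z m ≠ z j) {x y : g} {r s t u : ℕ}
    (hm : A m = J x r s) (hj : A j = J y t u) :
    component V lam {m, j} A z = if r + t = 1 ∧ s + u = 1 then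
      axionCoupling lam * trPair V x y * ((r : ℂ) * u - (s : ℂ) * t) / (z m - z j) else 0 := by
  have hJ : ∀ i ∈ ({m, j} : Finset ι), (A i).IsJ := by
    simp [hm, hj, IsJ]
  have hu : HasUnitModes {m, j} A ↔ r + t = 1 ∧ s + u = 1 := by
    rw [HasUnitModes, Finset.sum_pair hmj, Finset.sum_pair hmj, hm, hj]
    rfl
  have h1 : z m - z j ≠ 0 := sub_ne_zero.2 hz
  split_ifs with h
  · rw [component_of_isJ hJ (hu.2 h), parkeTaylor_pair (isColourTrace_repTrace V) hmj,
      pairing_pair (modePairing_antisymm A) hmj, repTrace_pair, modePairing, hm, hj,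
      show z j - z m = -(z m - z j) by ring]
    simp only [colour, mode₁, mode₂]
    field_simp
  · exact component_of_not_hasUnitModes hJ fun h' => h (hu.1 h')

lemma sum_dim_of_component_ne_zero (h : component V lam S A z ≠ 0) : ∑ i ∈ S, (A i).dim = -2 := by
  by_cases hJ : ∀ i ∈ S, (A i).IsJ
  · by_cases h1 : HasUnitModes S A
    · have : ∀ i ∈ S, (A i).dim = -((A i).mode₁ : ℤ) - ((A i).mode₂ : ℤ) := by
        intro i hi
        rw [(hJ i hi).eq]
        simp only [dim, mode₁, mode₂]
        ring
      rw [Finset.sum_congr rfl this, Finset.sum_sub_distrib, Finset.sum_neg_distrib]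
      have h2 : (∑ i ∈ S, ((A i).mode₁ : ℤ)) = 1 := by exact_mod_cast h1.1
      have h3 : (∑ i ∈ S, ((A i).mode₂ : ℤ)) = 1 := by exact_mod_cast h1.2
      rw [h2, h3]
      norm_num
    · exact absurd (component_of_not_hasUnitModes hJ h1) h
  · rw [component, if_neg hJ] at h
    split_ifs at h with h1
    · obtain ⟨i, rfl, hi⟩ := h1
      simp [hi, dim]
    · exact absurd rfl h

end

end Components

/-! ### Behaviour at infinity -/

section Growth

variable {ι : Type*} [DecidableEq ι] {g : Type*} [LieRing g] [LieAlgebra ℂ g]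

open Gen

lemma isBigO_inv_sub (c : ℂ) : (fun ζ : ℂ => (ζ - c)⁻¹) =O[cocompact ℂ] fun ζ : ℂ => ζ⁻¹ := by
  refine IsBigO.of_bound 2 ?_
  have h := tendsto_norm_cocompact_atTop (E := ℂ)
  filter_upwards [h.eventually_ge_atTop (2 * ‖c‖ + 1)] with ζ hζ
  have hc := norm_nonneg c
  have h1 : ‖ζ‖ ≤ 2 * ‖ζ - c‖ := by
    have := norm_sub_norm_le ζ c
    linarith
  have h2 : 0 < ‖ζ‖ := by linarith
  have h3 : 0 < ‖ζ - c‖ := by linarith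
  rw [norm_inv, norm_inv]
  field_simp
  linarith

lemma cyc_cons_of_mem_orderings {S : Finset ι} (hS : S.Nonempty) {t : List ι}
    (ht : t ∈ orderings S) : ∃ a ∈ S, ∃ b ∈ S, ∀ (m : ι) (z : ι → ℂ),
      cyc z (m :: t) = (z m - z b) * path z t * (z a - z m) := by
  have hmem := (mem_orderings.1 ht).2
  rcases List.eq_nil_or_concat t with rfl | ⟨t', a, rfl⟩
  · obtain ⟨b, hb⟩ := hS
    simpa using (hmem b).2 hb
  · rw [List.concat_eq_append] at ht hmem ⊢
    obtain ⟨b, t'', hb⟩ : ∃ b t'', t' ++ [a] = b :: t'' := by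
      rcases h : t' ++ [a] with _ | ⟨b, t''⟩
      · simp at h
      · exact ⟨b, t'', rfl⟩
    refine ⟨a, (hmem a).1 (by simp), b, (hmem b).1 (by simp [hb]), fun m z => ?_⟩
    have e1 : path z (m :: (t' ++ [a]) ++ [m])
        = (z m - z b) * path z (t' ++ [a] ++ [m]) := by
      rw [hb]; rfl
    rw [cyc, e1, List.append_assoc, List.cons_append, List.nil_append, path_append_pair]
    ring

/-- With m as first letter, the denominator has exactly two factors containing its position. -/
lemma parkeTaylor_isBigO {T : List g → ℂ} (hT : IsColourTrace T) {S : Finset ι} {m : ι}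
    (hm : m ∉ S) (hS : S.Nonempty) (x : ι → g) (z : ι → ℂ) :
    (fun ζ => parkeTaylor T (insert m S) x (Function.update z m ζ))
      =O[cocompact ℂ] fun ζ => ζ⁻¹ * ζ⁻¹ := by
  simp only [parkeTaylor_eq hT (Finset.mem_insert_self m S), Finset.erase_insert hm]
  refine IsBigO.fun_sum fun t ht => ?_
  obtain ⟨a, ha, b, hb, h⟩ := cyc_cons_of_mem_orderings hS ht
  have hne : ∀ i ∈ S, i ≠ m := fun i hi => by rintro rfl; exact hm hi
  have hp : ∀ ζ, path (Function.update z m ζ) t = path z t := fun ζ =>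
    path_congr fun i hi => Function.update_of_ne (hne i (((mem_orderings.1 ht).2 i).1 hi)) _ _
  have key : ∀ ζ, T ((m :: t).map x) / cyc (Function.update z m ζ) (m :: t)
      = (-(T ((m :: t).map x) / path z t)) * ((ζ - z b)⁻¹ * (ζ - z a)⁻¹) := by
    intro ζ
    rw [h, hp, Function.update_self, Function.update_of_ne (hne a ha),
      Function.update_of_ne (hne b hb), ← neg_sub ζ (z a), div_eq_mul_inv, mul_inv, mul_inv,
      inv_neg]
    ring
  simp only [key]
  exact ((isBigO_inv_sub (z b)).mul (isBigO_inv_sub (z a))).const_mul_left _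

variable {V : Type*} [AddCommGroup V] [Module ℂ V] [LieRingModule g V] [LieModule ℂ g V] {lam : ℂ}

/-- The Parke-Taylor sum decays like ζ⁻², as befits spin 1; the pairing can offset this only if the
moving gluon carries modes, which lower its spin accordingly. -/
lemma component_isBigO {S : Finset ι} {m : ι} (hm : m ∉ S) {A : ι → Gen g} {x : g} {r s : ℕ}
    (hA : A m = J x r s) (z : ι → ℂ) :
    (fun ζ => component V lam (insert m S) A (Function.update z m ζ))
      =O[cocompact ℂ] fun ζ => ζ ^ (-(A m).twiceSpin) := by
  have hzero : (∀ ζ, component V lam (insert m S) A (Function.update z m ζ) = 0) →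
      (fun ζ => component V lam (insert m S) A (Function.update z m ζ))
        =O[cocompact ℂ] fun ζ => ζ ^ (-(A m).twiceSpin) := by
    intro h
    simp only [h]
    exact isBigO_zero _ _
  have hne : ∀ i ∈ S, i ≠ m := fun i hi => by rintro rfl; exact hm hi
  rcases S.eq_empty_or_nonempty with rfl | hS
  · refine hzero fun ζ => ?_
    rw [insert_empty_eq]
    exact component_singleton_of_ne (by rw [hA]; simp)
  by_cases hJ : ∀ i ∈ insert m S, (A i).IsJ
  swap
  · push Not at hJ
    obtain ⟨i, hi, hJ⟩ := hJ
    have him : i ≠ m := by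
      rintro rfl
      rw [hA] at hJ
      exact hJ trivial
    exact hzero fun ζ => component_eq_zero_of_two_mem hi (Finset.mem_insert_self m S) him hJ
  by_cases hu : HasUnitModes (insert m S) A
  swap
  · exact hzero fun ζ => component_of_not_hasUnitModes hJ hu
  have hpair : ∀ ζ, pairing (insert m S) (Function.update z m ζ) (modePairing A)
      = pairing S z (modePairing A) + ∑ k ∈ S, modePairing A m k * (ζ - z k) := by
    intro ζ
    rw [pairing_insert (modePairing_antisymm A) hm]
    congr 1
    · exact pairing_congr (fun i hi => Function.update_of_ne (hne i hi) _ _) fun _ _ _ _ => rfl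
    · exact Finset.sum_congr rfl fun k hk => by
        rw [Function.update_self, Function.update_of_ne (hne k hk)]
  obtain ⟨hu1, hu2⟩ := hu
  rw [Finset.sum_insert hm, hA] at hu1 hu2
  change r + _ = 1 at hu1
  change s + _ = 1 at hu2
  have hPT := parkeTaylor_isBigO (isColourTrace_repTrace V) hm hS (fun i => (A i).colour) z
  have hev : ∀ᶠ ζ : ℂ in cocompact ℂ, ζ ≠ 0 := by
    filter_upwards [(tendsto_norm_cocompact_atTop (E := ℂ)).eventually_gt_atTop 0] with ζ hζ
    exact norm_pos_iff.1 hζ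
  have hform : ∀ ζ, component V lam (insert m S) A (Function.update z m ζ)
      = -axionCoupling lam * (parkeTaylor (repTrace V) (insert m S) (fun i => (A i).colour)
          (Function.update z m ζ) * (pairing S z (modePairing A)
            + ∑ k ∈ S, modePairing A m k * (ζ - z k))) := by
    intro ζ
    rw [component_of_isJ hJ ⟨by rw [Finset.sum_insert hm, hA]; exact hu1,
      by rw [Finset.sum_insert hm, hA]; exact hu2⟩, hpair]
  -- If m carries no mode the pairing is constant in ζ; if it carries one, the pairing is at most
  -- linear; if it carries both, all other labels have none and the pairing is zero.
  rcases (by omega : (r = 0 ∧ s = 0) ∨ r + s = 1 ∨ (r = 1 ∧ s = 1)) with ⟨rfl, rfl⟩ | h | ⟨rfl, rfl⟩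
  · have h0 : ∀ k, modePairing A m k = 0 := fun k => by simp [modePairing, hA, mode₁, mode₂]
    simp only [hform, h0, zero_mul, Finset.sum_const_zero, add_zero]
    refine (((hPT.mul (isBigO_refl (fun _ => pairing S z (modePairing A)) _)).const_mul_left
      (-axionCoupling lam)).trans ?_)
    refine IsBigO.trans (g := fun ζ : ℂ => pairing S z (modePairing A) * (ζ⁻¹ * ζ⁻¹))
      (isBigO_of_le _ fun ζ => by rw [mul_comm]) (IsBigO.const_mul_left ?_ _)
    refine isBigO_of_le _ fun ζ => ?_
    rw [hA]
    simp only [twiceSpin]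
    norm_num
    rw [pow_two, mul_inv]
  · have hlin : (fun ζ : ℂ => pairing S z (modePairing A)
        + ∑ k ∈ S, modePairing A m k * (ζ - z k)) =O[cocompact ℂ] fun ζ : ℂ => ζ := by
      have hc : ∀ c : ℂ, (fun _ : ℂ => c) =O[cocompact ℂ] fun ζ : ℂ => ζ := fun c =>
        IsBigO.of_bound ‖c‖ (by
          filter_upwards [(tendsto_norm_cocompact_atTop (E := ℂ)).eventually_ge_atTop 1] with ζ hζ
          nlinarith [norm_nonneg c])
      exact (hc _).add (IsBigO.fun_sum fun k _ =>
        ((isBigO_refl _ _).sub (hc (z k))).const_mul_left _)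
    simp only [hform]
    refine ((hPT.mul hlin).const_mul_left (-axionCoupling lam)).trans ?_
    refine IsBigO.of_bound 1 ?_
    filter_upwards [hev] with ζ hζ
    rw [hA]
    simp only [twiceSpin]
    rw [show -(2 - ((r : ℤ) + s)) = -1 by omega, zpow_neg_one, mul_assoc, inv_mul_cancel₀ hζ,
      mul_one, one_mul]
  · have h1 : ∀ k ∈ S, (A k).mode₁ = 0 := by
      have : ∑ k ∈ S, (A k).mode₁ = 0 := by omega
      simpa using this
    have h2 : ∀ k ∈ S, (A k).mode₂ = 0 := by
      have : ∑ k ∈ S, (A k).mode₂ = 0 := by omega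
      simpa using this
    refine hzero fun ζ => ?_
    rw [hform, Finset.sum_eq_zero fun k hk => by simp [modePairing, h1 k hk, h2 k hk], pairing,
      Finset.sum_eq_zero fun i hi => Finset.sum_eq_zero fun k hk => by
        simp [modePairing, h1 k hk, h2 k hk]]
    ring

end Growth

open Gen

/-! ### Singularities of the single-axion correlators -/

section Singularities

variable {ι : Type*} [DecidableEq ι] {g : Type*} [LieRing g] [LieAlgebra ℂ g]

variable {V : Type*} [AddCommGroup V] [Module ℂ V] [LieRingModule g V] [LieModule ℂ g V] {lam : ℂ}

lemma injOn_update_insert {S : Finset ι} {m : ι} (hm : m ∉ S) {z : ι → ℂ} (hS : Set.InjOn z S)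
    {w : ℂ} (hw : ∀ i ∈ S, z i ≠ w) :
    Set.InjOn (Function.update z m w) (insert m S : Finset ι) := by
  have hne : ∀ i ∈ S, i ≠ m := fun i hi => by rintro rfl; exact hm hi
  intro i hi j hj hij
  rcases Finset.mem_insert.1 hi with rfl | hi' <;> rcases Finset.mem_insert.1 hj with rfl | hj'
  · rfl
  · rw [Function.update_self, Function.update_of_ne (hne j hj')] at hij
    exact absurd hij.symm (hw j hj')
  · rw [Function.update_self, Function.update_of_ne (hne i hi')] at hij
    exact absurd hij (hw i hi')
  · rw [Function.update_of_ne (hne i hi'), Function.update_of_ne (hne j hj')] at hij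
    exact hS hi' hj' hij

/-- A component is singular only where two of its own labels meet, and w is away from the labels in
S. -/
lemma component_isBigO_one [Fintype ι] {S : Finset ι} {m : ι} (hm : m ∉ S) (A : ι → Gen g)
    {z : ι → ℂ} (hS : Set.InjOn z S) {w : ℂ} (hw : ∀ i ∈ S, z i ≠ w) :
    (fun ζ => component V lam (insert m S) A (Function.update z m ζ))
      =O[𝓝[≠] w] fun _ => (1 : ℂ) := by
  have h1 : ContinuousAt (fun z => component V lam (insert m S) A z) (Function.update z m w) :=
    ((isRationalOn_component _ A).differentiableAt (injOn_update_insert hm hS hw)).continuousAt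
  have h2 : ContinuousAt (fun ζ : ℂ => Function.update z m ζ) w :=
    (continuous_const.update m continuous_id).continuousAt
  have h3 : ContinuousAt (fun ζ => component V lam (insert m S) A (Function.update z m ζ)) w :=
    ContinuousAt.comp (f := fun ζ : ℂ => Function.update z m ζ) h1 h2
  exact (h3.tendsto.isBigO_one ℂ).mono nhdsWithin_le_nhds

lemma eventually_ne_of_finset (S : Finset ι) (z : ι → ℂ) (w : ℂ) :
    ∀ᶠ ζ in 𝓝[≠] w, ∀ i ∈ S, z i ≠ ζ := by
  rw [Filter.eventually_all_finset]
  intro i _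
  by_cases h : z i = w
  · filter_upwards [self_mem_nhdsWithin] with ζ hζ
    rw [h]
    exact fun h' => hζ h'.symm
  · exact (eventually_ne_nhds (Ne.symm h)).filter_mono nhdsWithin_le_nhds |>.mono fun _ h => h.symm

/-- The operator product of two gluons in the correlator with a single axion field. -/
lemma component_sub_isBigO_one {S : Finset ι} {m k : ι} (hmk : m ≠ k) (hm : m ∉ S) (hk : k ∉ S)
    {A : ι → Gen g} {z : ι → ℂ} (hz : Set.InjOn z (insert k S : Finset ι)) {x y : g} {r s t u : ℕ}
    (hAm : A m = J x r s) (hAk : A k = J y t u) :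
    (fun ζ => component V lam (insert m (insert k S)) A (Function.update z m ζ)
      - (component V lam (insert k S) (Function.update A k (J ⁅x, y⁆ (r + t) (s + u))) z
        + axionCoupling lam * trPair V x y * ((r : ℂ) * u - (s : ℂ) * t)
          * component V lam (insert k S) (Function.update A k (F (r + t - 1) (s + u - 1))) z)
        / (ζ - z k)) =O[𝓝[≠] (z k)] fun _ => (1 : ℂ) := by
  have hm' : m ∉ insert k S := by simp [hmk, hm]
  have hne : ∀ i ∈ insert k S, i ≠ m := fun i hi => by rintro rfl; exact hm' hi
  rcases S.eq_empty_or_nonempty with rfl | hS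
  · refine (isBigO_zero _ _).congr' ?_ EventuallyEq.rfl
    filter_upwards [self_mem_nhdsWithin] with ζ hζ
    simp only [insert_empty_eq]
    rw [component_pair hmk (by
        rw [Function.update_self, Function.update_of_ne hmk.symm]; exact hζ) hAm hAk,
      component_singleton_of_ne (by simp), Function.update_self, Function.update_of_ne hmk.symm]
    -- Truncated subtraction also yields F[0,0] when r + t = 0 or s + u = 0, but then the
    -- coefficient r u − s t is zero.
    by_cases hF : r + t - 1 = 0 ∧ s + u - 1 = 0
    · rw [component_singleton_F (by rw [Function.update_self, hF.1, hF.2])]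
      split_ifs with h
      · ring
      · have : (r : ℂ) * u - (s : ℂ) * t = 0 := by
          rcases (by omega : (r = 0 ∧ t = 0) ∨ (s = 0 ∧ u = 0)) with ⟨rfl, rfl⟩ | ⟨rfl, rfl⟩ <;> simp
        rw [this]; simp
    · rw [component_singleton_of_ne (by
        rw [Function.update_self]
        intro h
        injection h with h1 h2
        exact hF ⟨h1, h2⟩), if_neg (by omega)]
      simp
  · have hcard : 2 ≤ (insert k S).card := by
      rw [Finset.card_insert_of_notMem hk]
      have := hS.card_pos
      omega
    obtain ⟨i, hi⟩ := hS
    have hik : i ≠ k := by rintro rfl; exact hk hi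
    -- F absorbs an axion only on its own, so in a group with further labels the F term of the
    -- operator product drops out.
    have hF : component V lam (insert k S) (Function.update A k (F (r + t - 1) (s + u - 1))) z
        = 0 := component_eq_zero_of_two_mem (Finset.mem_insert_self k S)
          (Finset.mem_insert_of_mem hi) hik.symm (by rw [Function.update_self]; exact id)
    have key : (fun ζ => ∑ j ∈ S, 1 / (ζ - z j) * component V lam (insert k S)
        (Function.update A j ((A m).fuse (A j))) z) =O[𝓝[≠] (z k)] fun _ => (1 : ℂ) := by
      refine IsBigO.fun_sum fun j hj => ?_
      have hjk : z k - z j ≠ 0 := fun h => hk (by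
        have := hz (by simp) (by simp [hj]) (sub_eq_zero.1 h)
        rwa [this])
      have hc : ContinuousAt (fun ζ => 1 / (ζ - z j) * component V lam (insert k S)
          (Function.update A j ((A m).fuse (A j))) z) (z k) :=
        (continuousAt_const.div (continuousAt_id.sub continuousAt_const) hjk).mul
          continuousAt_const
      exact (hc.tendsto.isBigO_one ℂ).mono nhdsWithin_le_nhds
    refine key.congr' ?_ EventuallyEq.rfl
    filter_upwards [eventually_ne_of_finset (insert k S) z (z k)] with ζ hζ
    rw [component_insert hm' hcard (injOn_update_insert hm' hz hζ) (by rw [hAm]; trivial),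
      Finset.sum_insert hk, hF, hAk, hAm, Function.update_self]
    have e : ∀ B : ι → Gen g, component V lam (insert k S) B (Function.update z m ζ)
        = component V lam (insert k S) B z := fun B =>
      component_congr (fun _ _ => rfl) fun i hi => Function.update_of_ne (hne i hi) _ _
    rw [e, Function.update_of_ne hmk.symm, show (J x r s).fuse (J y t u)
      = J ⁅x, y⁆ (r + t) (s + u) from rfl, mul_zero, add_zero, one_div_mul_eq_div,
      add_sub_cancel_left]
    refine Finset.sum_congr rfl fun j hj => ?_
    rw [e, Function.update_of_ne (hne j (Finset.mem_insert_of_mem hj))]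

end Singularities

/-! ### The explicit block -/

section Block

variable {g : Type*} [LieRing g] [LieAlgebra ℂ g]

open Matrix (vecCons)

lemma sum_finset_fin_succ {n : ℕ} (f : Finset (Fin (n + 1)) → ℂ) :
    ∑ S, f S = ∑ S : Finset (Fin n), (f (S.map (Fin.succEmb n))
      + f (insert 0 (S.map (Fin.succEmb n)))) := by
  have h0 : (0 : Fin (n + 1)) ∉ (Finset.univ : Finset (Fin n)).map (Fin.succEmb n) := by
    simp [Fin.succ_ne_zero]
  have hsum : ∀ f : Finset (Fin (n + 1)) → ℂ,
      ∑ S ∈ ((Finset.univ : Finset (Fin n)).map (Fin.succEmb n)).powerset, f S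
        = ∑ S : Finset (Fin n), f (S.map (Fin.succEmb n)) := by
    intro f
    symm
    refine Finset.sum_nbij (fun S => S.map (Fin.succEmb n)) (fun S _ => ?_)
      ((Finset.map_injective _).injOn) (fun S hS => ?_) fun _ _ => rfl
    · exact Finset.mem_powerset.2 (Finset.map_subset_map.2 (Finset.subset_univ S))
    · obtain ⟨T, _, rfl⟩ := Finset.subset_map_iff.1 (Finset.mem_powerset.1 hS)
      exact ⟨T, Finset.mem_coe.2 (Finset.mem_univ T), rfl⟩
  have huniv : (Finset.univ : Finset (Fin (n + 1)))
      = insert 0 ((Finset.univ : Finset (Fin n)).map (Fin.succEmb n)) := by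
    rw [Fin.univ_succ, Finset.cons_eq_insert]; rfl
  rw [← Finset.powerset_univ, huniv, Finset.sum_powerset_insert h0, hsum,
    hsum fun S => f (insert 0 S), Finset.sum_add_distrib]

lemma compl_map_succEmb {n : ℕ} (S : Finset (Fin n)) :
    (S.map (Fin.succEmb n))ᶜ = insert 0 (Sᶜ.map (Fin.succEmb n)) := by
  ext i
  refine Fin.cases ?_ (fun j => ?_) i <;> simp [Fin.succ_ne_zero]

lemma compl_insert_map_succEmb {n : ℕ} (S : Finset (Fin n)) :
    (insert 0 (S.map (Fin.succEmb n)))ᶜ = Sᶜ.map (Fin.succEmb n) := by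
  rw [← compl_compl S, ← compl_map_succEmb, compl_compl, compl_compl]

variable (V : Type*) [AddCommGroup V] [Module ℂ V] [LieRingModule g V] [LieModule ℂ g V] (lam N : ℂ)

/-- The conformal block of `(tr ρ)²`: each of the two axion fields is absorbed by a group of
generators. -/
noncomputable def axionBlock : Correlators g := fun n A z =>
  N / 2 * ∑ S : Finset (Fin n), component V lam S A z * component V lam Sᶜ A z

variable {V lam N}

lemma component_map_succEmb {n : ℕ} (S : Finset (Fin n)) (a : Gen g) (A : Fin n → Gen g) (ζ : ℂ)
    (z : Fin n → ℂ) :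
    component V lam (S.map (Fin.succEmb n)) (vecCons a A) (vecCons ζ z)
      = component V lam S A z := by
  rw [component_map]; rfl

/-- Exchanging S with its complement is a symmetry, so the first insertion may be assumed to lie in
the first group; this doubles N/2 to N. -/
lemma axionBlock_cons (n : ℕ) (a : Gen g) (A : Fin n → Gen g) (ζ : ℂ) (z : Fin n → ℂ) :
    axionBlock V lam N (n + 1) (vecCons a A) (vecCons ζ z)
      = N * ∑ S : Finset (Fin n),
          component V lam (insert 0 (S.map (Fin.succEmb n))) (vecCons a A) (vecCons ζ z)
            * component V lam Sᶜ A z := by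
  rw [axionBlock, sum_finset_fin_succ, Finset.sum_add_distrib]
  simp only [compl_map_succEmb, compl_insert_map_succEmb, component_map_succEmb]
  have : ∑ S : Finset (Fin n), component V lam S A z
        * component V lam (insert 0 (Sᶜ.map (Fin.succEmb n))) (vecCons a A) (vecCons ζ z)
      = ∑ S : Finset (Fin n),
          component V lam (insert 0 (S.map (Fin.succEmb n))) (vecCons a A) (vecCons ζ z)
            * component V lam Sᶜ A z := by
    rw [← Equiv.sum_comp (Equiv.mk compl compl compl_compl compl_compl)]
    simp only [Equiv.coe_fn_mk, compl_compl]
    exact Finset.sum_congr rfl fun _ _ => mul_comm _ _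
  rw [this]
  ring

lemma axionBlock_eq_zero_of_exists {n : ℕ} {A : Fin n → Gen g}
    (h : ∃ i, ¬(A i).IsJ ∧ A i ≠ F 0 0) (z : Fin n → ℂ) : axionBlock V lam N n A z = 0 := by
  obtain ⟨i, h1, h2⟩ := h
  rw [axionBlock, Finset.sum_eq_zero, mul_zero]
  intro S _
  by_cases hi : i ∈ S
  · rw [component_eq_zero_of_mem hi h1 h2, zero_mul]
  · rw [component_eq_zero_of_mem (Finset.mem_compl.2 hi) h1 h2, mul_zero]

lemma axionBlock_symmetric (n : ℕ) (τ : Equiv.Perm (Fin n)) (A : Fin n → Gen g) (z : Fin n → ℂ) :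
    axionBlock V lam N n (A ∘ τ) (z ∘ τ) = axionBlock V lam N n A z := by
  rw [axionBlock, axionBlock]
  congr 1
  rw [← Equiv.sum_comp τ.finsetCongr fun S => component V lam S A z * component V lam Sᶜ A z]
  refine Finset.sum_congr rfl fun S _ => ?_
  rw [Equiv.finsetCongr_apply, component_map]
  have : (S.map τ.toEmbedding)ᶜ = Sᶜ.map τ.toEmbedding := by
    ext i
    obtain ⟨j, rfl⟩ := τ.surjective i
    simp
  rw [this, component_map]
  rfl

lemma isRationalOn_axionBlock (n : ℕ) (A : Fin n → Gen g) :
    IsRationalOn Finset.univ fun z => axionBlock V lam N n A z :=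
  (IsRationalOn.const _).mul (IsRationalOn.sum fun S _ =>
    ((isRationalOn_component S A).mono (Finset.subset_univ S)).mul
      ((isRationalOn_component Sᶜ A).mono (Finset.subset_univ _)))

lemma vecCons_eq_update {α : Type*} {n : ℕ} (a b : α) (A : Fin n → α) :
    vecCons a A = Function.update (vecCons b A) 0 a := by
  funext i
  refine Fin.cases ?_ (fun j => ?_) i
  · simp
  · simp [Fin.succ_ne_zero]

lemma zero_notMem_map_succEmb {n : ℕ} (S : Finset (Fin n)) : 0 ∉ S.map (Fin.succEmb n) := by
  simp [Fin.succ_ne_zero]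

/-- A generator outside the J tower gives zero unless it is alone in its group, and then its
position does not enter. -/
lemma component_insert_zero_of_not_isJ {n : ℕ} (S : Finset (Fin n)) {a : Gen g} (ha : ¬a.IsJ)
    (A : Fin n → Gen g) (ζ ζ' : ℂ) (z : Fin n → ℂ) :
    component V lam (insert 0 (S.map (Fin.succEmb n))) (vecCons a A) (vecCons ζ z)
      = component V lam (insert 0 (S.map (Fin.succEmb n))) (vecCons a A) (vecCons ζ' z) := by
  rcases S.eq_empty_or_nonempty with rfl | ⟨i, hi⟩
  · rw [Finset.map_empty, insert_empty_eq]
    by_cases h : a = F 0 0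
    · rw [component_singleton_F (by simpa using h), component_singleton_F (by simpa using h)]
    · rw [component_singleton_of_ne (by simpa using h), component_singleton_of_ne (by simpa using h)]
  · have hi' : i.succ ∈ insert 0 (S.map (Fin.succEmb n)) := by simp [hi]
    have h : ∀ ζ, component V lam (insert 0 (S.map (Fin.succEmb n))) (vecCons a A) (vecCons ζ z)
        = 0 := fun ζ =>
      component_eq_zero_of_two_mem (Finset.mem_insert_self _ _) hi' (Fin.succ_ne_zero i).symm
        (by simpa using ha)
    rw [h, h]

lemma axionBlock_cons_of_not_isJ (n : ℕ) {a : Gen g} (ha : ¬a.IsJ) (A : Fin n → Gen g) (ζ ζ' : ℂ)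
    (z : Fin n → ℂ) :
    axionBlock V lam N (n + 1) (vecCons a A) (vecCons ζ z)
      = axionBlock V lam N (n + 1) (vecCons a A) (vecCons ζ' z) := by
  rw [axionBlock_cons, axionBlock_cons]
  simp only [component_insert_zero_of_not_isJ _ ha A ζ ζ' z]

lemma axionBlock_linear (n : ℕ) (A : Fin n → Gen g) (z : Fin (n + 1) → ℂ) (c : ℂ) (x y : g)
    (r s : ℕ) :
    axionBlock V lam N (n + 1) (vecCons (.J (c • x + y) r s) A) z
      = c * axionBlock V lam N (n + 1) (vecCons (.J x r s) A) z
        + axionBlock V lam N (n + 1) (vecCons (.J y r s) A) z := by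
  have hz : z = vecCons (z 0) (fun i => z i.succ) := (Matrix.cons_head_tail z).symm
  rw [hz, axionBlock_cons, axionBlock_cons, axionBlock_cons, mul_left_comm, ← mul_add]
  congr 1
  rw [Finset.mul_sum, ← Finset.sum_add_distrib]
  refine Finset.sum_congr rfl fun S _ => ?_
  have hmem : ∀ (a b : Gen g), ∀ i ∈ S.map (Fin.succEmb n), vecCons a A i = vecCons b A i := by
    intro a b i hi
    obtain ⟨j, _, rfl⟩ := Finset.mem_map.1 hi
    rfl
  rw [component_linear (A₁ := vecCons (.J x r s) A) (A₂ := vecCons (.J y r s) A) (x := x) (y := y)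
    (r := r) (s := s) (c := c) (zero_notMem_map_succEmb S) (hmem _ _) (hmem _ _) rfl rfl rfl]
  ring

/-- Only the group of the first insertion depends on ζ. For F[0,0], of spin 0, the correlator is
constant in ζ. -/
lemma axionBlock_isBigO (n : ℕ) (a : Gen g) (A : Fin n → Gen g) (z : Fin n → ℂ) :
    (fun ζ : ℂ => axionBlock V lam N (n + 1) (vecCons a A) (vecCons ζ z))
      =O[cocompact ℂ] fun ζ : ℂ => ζ ^ (-a.twiceSpin) := by
  by_cases ha : a.IsJ
  · simp only [axionBlock_cons]
    refine (IsBigO.fun_sum fun S _ => ?_).const_mul_left _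
    have h := component_isBigO (V := V) (lam := lam) (zero_notMem_map_succEmb S)
      (A := vecCons a A) (x := a.colour) (r := a.mode₁) (s := a.mode₂) (by simpa using ha.eq)
      (vecCons 0 z)
    simp only [← vecCons_eq_update, Matrix.cons_val_zero] at h
    simpa only [mul_comm] using h.const_mul_left (component V lam Sᶜ A z)
  · by_cases h : a = F 0 0
    · simp only [axionBlock_cons_of_not_isJ n ha A _ 0 z]
      subst h
      have e : ∀ ζ : ℂ, ζ ^ (-(F 0 0 : Gen g).twiceSpin) = 1 := fun ζ => by simp [twiceSpin]
      simp only [e]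
      exact isBigO_const_const _ one_ne_zero _
    · have : ∀ ζ, axionBlock V lam N (n + 1) (vecCons a A) (vecCons ζ z) = 0 := fun ζ =>
        axionBlock_eq_zero_of_exists ⟨0, by simpa using ha, by simpa using h⟩ _
      simp only [this]
      exact isBigO_zero _ _

end Block

open Gen

/-! ### Operator products of the block and existence -/

section Existence

variable {g : Type*} [LieRing g] [LieAlgebra ℂ g]

open Matrix (vecCons)

variable {V : Type*} [AddCommGroup V] [Module ℂ V] [LieRingModule g V] [LieModule ℂ g V]
  {lam N : ℂ}

lemma update_vecCons_vecCons_one {α : Type*} {n : ℕ} (a b c : α) (A : Fin n → α) :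
    Function.update (vecCons a (vecCons b A)) 1 c ∘ Fin.succEmb (n + 1) = vecCons c A := by
  funext i
  refine Fin.cases ?_ (fun j => ?_) i
  · show Function.update (vecCons a (vecCons b A)) 1 c (Fin.succ 0) = _
    rw [Fin.succ_zero_eq_one, Function.update_self]
    rfl
  · show Function.update (vecCons a (vecCons b A)) 1 c (Fin.succ j.succ) = _
    rw [← Fin.succ_zero_eq_one, Function.update_of_ne
      (fun h => Fin.succ_ne_zero j (Fin.succ_injective _ h))]
    rfl

lemma component_vecCons_sub_isBigO_one {n : ℕ} (T : Finset (Fin n)) (x y : g) (r s t u : ℕ)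
    (A : Fin n → Gen g) {w : ℂ} {z : Fin n → ℂ} (hz : Function.Injective (vecCons w z)) :
    (fun ζ : ℂ => component V lam
        (insert 0 ((insert 0 (T.map (Fin.succEmb n))).map (Fin.succEmb (n + 1))))
        (vecCons (J x r s) (vecCons (J y t u) A)) (vecCons ζ (vecCons w z))
      - (component V lam (insert 0 (T.map (Fin.succEmb n)))
          (vecCons (J ⁅x, y⁆ (r + t) (s + u)) A) (vecCons w z)
        + axionCoupling lam * trPair V x y * ((r : ℂ) * u - (s : ℂ) * t)
          * component V lam (insert 0 (T.map (Fin.succEmb n)))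
              (vecCons (F (r + t - 1) (s + u - 1)) A) (vecCons w z)) / (ζ - w))
      =O[𝓝[≠] w] fun _ => (1 : ℂ) := by
  set S := (T.map (Fin.succEmb n)).map (Fin.succEmb (n + 1)) with hS
  have e : (insert 0 (T.map (Fin.succEmb n))).map (Fin.succEmb (n + 1)) = insert 1 S := by
    rw [Finset.map_insert]
    rfl
  have h0 : (0 : Fin (n + 2)) ∉ S := zero_notMem_map_succEmb _
  have h1 : (1 : Fin (n + 2)) ∉ S := by
    rw [hS, ← Fin.succ_zero_eq_one]
    intro h
    obtain ⟨j, hj, h⟩ := Finset.mem_map.1 h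
    exact zero_notMem_map_succEmb T (Fin.succ_injective _ h ▸ hj)
  have hinj : Set.InjOn (vecCons w (vecCons w z)) (insert 1 S : Finset (Fin (n + 2))) := by
    rw [← e]
    intro i hi j hj hij
    obtain ⟨i', _, rfl⟩ := Finset.mem_map.1 (Finset.mem_coe.1 hi)
    obtain ⟨j', _, rfl⟩ := Finset.mem_map.1 (Finset.mem_coe.1 hj)
    exact congrArg Fin.succ (hz hij)
  have key := component_sub_isBigO_one (V := V) (lam := lam) (S := S) (m := 0) (k := 1)
    (A := vecCons (J x r s) (vecCons (J y t u) A)) zero_ne_one h0 h1 hinj (x := x) (y := y)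
    (r := r) (s := s) (t := t) (u := u) rfl rfl
  have e2 : ∀ c, component V lam (insert 1 S)
      (Function.update (vecCons (J x r s) (vecCons (J y t u) A)) 1 c) (vecCons w (vecCons w z))
      = component V lam (insert 0 (T.map (Fin.succEmb n))) (vecCons c A) (vecCons w z) := by
    intro c
    rw [← e, component_map, update_vecCons_vecCons_one]
    rfl
  simp only [e2, ← vecCons_eq_update] at key
  rw [e]
  exact key

lemma component_vecCons_isBigO_one {n : ℕ} (T : Finset (Fin n)) (a b : Gen g)
    (A : Fin n → Gen g) {w : ℂ} {z : Fin n → ℂ} (hz : Function.Injective (vecCons w z)) :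
    (fun ζ : ℂ => component V lam
        (insert 0 ((T.map (Fin.succEmb n)).map (Fin.succEmb (n + 1))))
        (vecCons a (vecCons b A)) (vecCons ζ (vecCons w z)))
      =O[𝓝[≠] w] fun _ => (1 : ℂ) := by
  have key := component_isBigO_one (V := V) (lam := lam)
    (zero_notMem_map_succEmb (T.map (Fin.succEmb n))) (vecCons a (vecCons b A))
    (z := vecCons w (vecCons w z)) (w := w) (by
      intro i hi j hj hij
      obtain ⟨i', _, rfl⟩ := Finset.mem_map.1 (Finset.mem_coe.1 hi)
      obtain ⟨j', _, rfl⟩ := Finset.mem_map.1 (Finset.mem_coe.1 hj)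
      exact congrArg Fin.succ (hz hij)) (by
      intro i hi h
      obtain ⟨i', hi', rfl⟩ := Finset.mem_map.1 hi
      exact zero_notMem_map_succEmb T ((hz (show vecCons w z i' = vecCons w z 0 from h)) ▸ hi'))
  simpa only [← vecCons_eq_update] using key

/-- If the two gluons belong to different groups there is no singularity at w. If they share a
group, the pole is that of the single-axion correlator, and the other group is a spectator. -/
lemma axionBlock_ope_J_J (n : ℕ) (x y : g) (r s t u : ℕ) (A : Fin n → Gen g) (w : ℂ)
    (z : Fin n → ℂ) (hz : Function.Injective (vecCons w z)) :
    (fun ζ : ℂ => axionBlock V lam N (n + 2) (vecCons (J x r s) (vecCons (J y t u) A))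
          (vecCons ζ (vecCons w z))
        - (axionBlock V lam N (n + 1) (vecCons (J ⁅x, y⁆ (r + t) (s + u)) A) (vecCons w z)
          + axionCoupling lam * trPair V x y * ((r : ℂ) * u - (s : ℂ) * t)
            * axionBlock V lam N (n + 1) (vecCons (F (r + t - 1) (s + u - 1)) A) (vecCons w z))
          / (ζ - w)) =O[𝓝[≠] w] fun _ => (1 : ℂ) := by
  have key : (fun ζ : ℂ => N * ∑ T : Finset (Fin n),
      (component V lam (T.map (Fin.succEmb n))ᶜ (vecCons (J y t u) A) (vecCons w z)
        * component V lam (insert 0 ((T.map (Fin.succEmb n)).map (Fin.succEmb (n + 1))))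
          (vecCons (J x r s) (vecCons (J y t u) A)) (vecCons ζ (vecCons w z))
      + component V lam Tᶜ A z * (component V lam
        (insert 0 ((insert 0 (T.map (Fin.succEmb n))).map (Fin.succEmb (n + 1))))
        (vecCons (J x r s) (vecCons (J y t u) A)) (vecCons ζ (vecCons w z))
      - (component V lam (insert 0 (T.map (Fin.succEmb n)))
          (vecCons (J ⁅x, y⁆ (r + t) (s + u)) A) (vecCons w z)
        + axionCoupling lam * trPair V x y * ((r : ℂ) * u - (s : ℂ) * t)
          * component V lam (insert 0 (T.map (Fin.succEmb n)))
              (vecCons (F (r + t - 1) (s + u - 1)) A) (vecCons w z)) / (ζ - w))))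
      =O[𝓝[≠] w] fun _ => (1 : ℂ) :=
    (IsBigO.fun_sum fun T _ => ((component_vecCons_isBigO_one T _ _ A hz).const_mul_left _).add
      ((component_vecCons_sub_isBigO_one T x y r s t u A hz).const_mul_left _)).const_mul_left N
  refine key.congr_left fun ζ => ?_
  rw [axionBlock_cons, sum_finset_fin_succ, axionBlock_cons, axionBlock_cons]
  simp only [compl_insert_map_succEmb, component_map_succEmb]
  rw [mul_left_comm, ← mul_add, mul_div_assoc, ← mul_sub, Finset.mul_sum _ _ (_ * _),
    ← Finset.sum_add_distrib, Finset.sum_div, ← Finset.sum_sub_distrib]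
  congr 1
  refine Finset.sum_congr rfl fun T _ => ?_
  ring

lemma axionBlock_cons_eq_zero {n : ℕ} {a : Gen g} (h : ¬a.IsJ) (h' : a ≠ F 0 0)
    (A : Fin n → Gen g) (z : Fin (n + 1) → ℂ) : axionBlock V lam N (n + 1) (vecCons a A) z = 0 :=
  axionBlock_eq_zero_of_exists ⟨0, h, h'⟩ z

/-- Here b cannot share a group with a, so nothing is singular at w. This agrees with the operator
products of J with `Jt`, `E` and `F`, which produce only `Jt`, whose correlators are zero. -/
lemma axionBlock_ope_J_of_not_isJ (n : ℕ) (a b : Gen g) (hb : ¬b.IsJ) (A : Fin n → Gen g) (w : ℂ)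
    (z : Fin n → ℂ) (hz : Function.Injective (vecCons w z)) :
    (fun ζ : ℂ => axionBlock V lam N (n + 2) (vecCons a (vecCons b A))
      (vecCons ζ (vecCons w z))) =O[𝓝[≠] w] fun _ => (1 : ℂ) := by
  simp only [axionBlock_cons, sum_finset_fin_succ]
  refine (IsBigO.fun_sum fun T _ => ?_).const_mul_left N
  have : ∀ ζ, component V lam
      (insert 0 ((insert 0 (T.map (Fin.succEmb n))).map (Fin.succEmb (n + 1))))
      (vecCons a (vecCons b A)) (vecCons ζ (vecCons w z)) = 0 := fun ζ =>
    component_eq_zero_of_two_mem (i := 1) (j := 0)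
      (Finset.mem_insert_of_mem (Finset.mem_map.2 ⟨0, Finset.mem_insert_self _ _, rfl⟩))
      (Finset.mem_insert_self _ _) one_ne_zero hb
  simp only [this, zero_mul, add_zero]
  simpa only [mul_comm] using (component_vecCons_isBigO_one T a b A hz).const_mul_left
    (component V lam (T.map (Fin.succEmb n))ᶜ (vecCons b A) (vecCons w z))

lemma axionBlock_two (a b : Gen g) (z : Fin 2 → ℂ) :
    axionBlock V lam N 2 ![a, b] z = N * (component V lam {0} ![a, b] z
      * component V lam {1} ![a, b] z) := by
  obtain ⟨ζ, w, rfl⟩ : ∃ ζ w, z = ![ζ, w] := ⟨z 0, z 1, by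
    funext i; fin_cases i <;> rfl⟩
  rw [axionBlock_cons, sum_finset_fin_succ, Fintype.sum_unique]
  have e1 : (default : Finset (Fin 0)) = ∅ := rfl
  have e2 : (insert 0 ∅ : Finset (Fin 1)) = Finset.univ := rfl
  have e3 : component V lam {1} ![a, b] ![ζ, w] = component V lam Finset.univ ![b] ![w] := by
    rw [show ({1} : Finset (Fin 2)) = (Finset.univ : Finset (Fin 1)).map (Fin.succEmb 1) from rfl,
      component_map_succEmb]
  rw [e1, Finset.map_empty, Finset.map_empty, e2, Finset.compl_univ, component_empty, mul_zero,
    add_zero, Finset.compl_empty, e3]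
  rfl

theorem isTrRhoSqBlock_axionBlock : IsTrRhoSqBlock V lam N (axionBlock V lam N : Correlators g) where
  symmetric n τ A z _ := axionBlock_symmetric n τ A z
  linear_J n A z c x y r s _ := axionBlock_linear n A z c x y r s
  linear_Jt n A z c x y r s _ := by
    have h : ∀ x : g, axionBlock V lam N (n + 1) (vecCons (Jt x r s) A) z = 0 := fun x =>
      axionBlock_cons_eq_zero id (by simp) A z
    rw [h, h, h, mul_zero, add_zero]
  rational n A := (isRationalOn_axionBlock n A).exists_eq_div
  ope_J n x r s b A w z hz := by
    have hJt : ∀ (y : g) (t u : ℕ), axionBlock V lam N (n + 1) (vecCons (Jt y t u) A)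
        = fun _ => 0 := fun y t u => funext fun z => axionBlock_cons_eq_zero id (by simp) A z
    have hE : ∀ (t u : ℕ) (h : 0 < t + u), axionBlock V lam N (n + 1)
        (vecCons (E t u h : Gen g) A) = fun _ => 0 := fun t u h => funext fun z =>
      axionBlock_cons_eq_zero id (by simp) A z
    cases b with
    | J y t u =>
      simpa [polarPart, hE] using axionBlock_ope_J_J n x y r s t u A w z hz
    | Jt y t u =>
      simpa [polarPart, hJt] using axionBlock_ope_J_of_not_isJ n _ (Jt y t u) id A w z hz
    | E t u h =>
      simpa [polarPart, hJt] using axionBlock_ope_J_of_not_isJ n _ (E t u h) id A w z hz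
    | F t u =>
      simpa [polarPart, hJt] using axionBlock_ope_J_of_not_isJ n _ (F t u) id A w z hz
  ope_regular n a b A w z _ hb hz := axionBlock_ope_J_of_not_isJ n a b hb A w z hz
  at_infinity n a A z _ := axionBlock_isBigO n a A z
  dimension n A z _ h := by
    rw [axionBlock, Finset.sum_eq_zero, mul_zero]
    intro S _
    by_contra h0
    apply h
    rw [← Finset.sum_add_sum_compl S, sum_dim_of_component_ne_zero (left_ne_zero_of_mul h0),
      sum_dim_of_component_ne_zero (right_ne_zero_of_mul h0)]
    rfl
  vanishing n A z _ h := axionBlock_eq_zero_of_exists h z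
  two_point z _ := by
    rw [axionBlock_two, component_singleton_F (A := ![F 0 0, F 0 0]) (i := 0) rfl,
      component_singleton_F (A := ![F 0 0, F 0 0]) (i := 1) rfl,
      mul_one, mul_one]
  two_point_other a b z _ h := by
    rw [axionBlock_two]
    by_cases ha : a = F 0 0
    · rw [component_singleton_of_ne (i := 1) fun hb => h ⟨ha, hb⟩, mul_zero, mul_zero]
    · rw [component_singleton_of_ne (i := 0) ha, zero_mul, mul_zero]

end Existence

open Gen

/-! ### Liouville's theorem with removable singularities -/

section Liouville

/-- A function on the plane without its finite set of singularities that is locally bounded and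
tends to zero at infinity vanishes. -/
lemma eq_zero_of_isBigO_one_of_tendsto (s : Finset ℂ) {f : ℂ → ℂ}
    (hf : DifferentiableOn ℂ f (s : Set ℂ)ᶜ)
    (hs : ∀ w ∈ s, f =O[𝓝[≠] w] fun _ => (1 : ℂ))
    (hlim : Tendsto f (cocompact ℂ) (𝓝 0)) : ∀ ζ ∉ s, f ζ = 0 := by
  induction s using Finset.induction_on generalizing f with
  | empty =>
    intro ζ _
    refine Differentiable.apply_eq_of_tendsto_cocompact ?_ ζ hlim
    rwa [Finset.coe_empty, Set.compl_empty, differentiableOn_univ] at hf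
  | insert w s hw ih =>
    intro ζ hζ
    have hopen : (s : Set ℂ)ᶜ ∈ 𝓝 w := s.finite_toSet.isClosed.isOpen_compl.mem_nhds (by simpa)
    have hd : DifferentiableOn ℂ f ((s : Set ℂ)ᶜ \ {w}) :=
      hf.mono fun ζ h => by
        simp only [Finset.coe_insert, Set.mem_compl_iff, Set.mem_insert_iff, not_or]
        exact ⟨h.2, h.1⟩
    -- Boundedness near w makes the singularity removable; filling in the limit gives a function
    -- with one singular point fewer.
    have ho : (fun ζ => f ζ - f w) =o[𝓝[≠] w] fun ζ => (ζ - w)⁻¹ :=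
      IsBoundedUnder.isLittleO_sub_self_inv ((isBigO_one_iff ℂ).1 ((hs w (by simp)).sub
        (isBigO_const_const (f w) one_ne_zero _)))
    have hζw : ζ ≠ w := fun h => hζ (by simp [h])
    have hne : ∀ v, v ≠ w → Function.update f w (limUnder (𝓝[≠] w) f) =ᶠ[𝓝 v] f := fun v hv => by
      filter_upwards [eventually_ne_nhds hv] with u hu using Function.update_of_ne hu _ _
    have := ih (Complex.differentiableOn_update_limUnder_of_isLittleO hopen hd ho) (fun v hv => ?_)
      ?_ ζ fun h => hζ (Finset.mem_insert_of_mem h)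
    · rwa [Function.update_of_ne hζw] at this
    · have hvw : v ≠ w := fun h => hw (h ▸ hv)
      exact (hs v (Finset.mem_insert_of_mem hv)).congr'
        ((hne v hvw).symm.filter_mono nhdsWithin_le_nhds) EventuallyEq.rfl
    · refine hlim.congr' ?_
      have : ∀ᶠ u in cocompact ℂ, u ≠ w := (isCompact_singleton (x := w)).compl_mem_cocompact
      filter_upwards [this] with u hu using (Function.update_of_ne hu _ _).symm

lemma eq_zero_of_div_isBigO_one {c w : ℂ}
    (h : (fun ζ : ℂ => c / (ζ - w)) =O[𝓝[≠] w] fun _ => (1 : ℂ)) : c = 0 := by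
  have h1 : Tendsto (fun ζ : ℂ => ζ - w) (𝓝[≠] w) (𝓝 0) := by
    have : Tendsto (fun ζ : ℂ => ζ - w) (𝓝 w) (𝓝 (w - w)) := (continuous_sub_right w).tendsto w
    rw [sub_self] at this
    exact this.mono_left nhdsWithin_le_nhds
  have h2 : Tendsto (fun ζ : ℂ => c / (ζ - w) * (ζ - w)) (𝓝[≠] w) (𝓝 0) := by
    refine IsBigO.trans_tendsto (g'' := fun ζ : ℂ => ζ - w) ?_ h1
    simpa using h.mul (isBigO_refl (fun ζ : ℂ => ζ - w) _)
  have h3 : Tendsto (fun _ : ℂ => c) (𝓝[≠] w) (𝓝 0) := by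
    refine h2.congr' ?_
    filter_upwards [self_mem_nhdsWithin] with ζ hζ
    exact div_mul_cancel₀ c (sub_ne_zero.2 hζ)
  exact tendsto_nhds_unique tendsto_const_nhds h3

end Liouville

/-! ### Uniqueness of the block -/

section Uniqueness

variable {g : Type*} [LieRing g] [LieAlgebra ℂ g]

open Matrix (vecCons)

/-- The derived ideal is nonzero because a simple algebra is not abelian. This is what makes the
one-point functions vanish. -/
lemma span_lie_eq_top [LieAlgebra.IsSimple ℂ g] :
    Submodule.span ℂ {y : g | ∃ a b : g, ⁅a, b⁆ = y} = ⊤ := by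
  have h : LieSubmodule.toSubmodule ⁅(⊤ : LieIdeal ℂ g), (⊤ : LieIdeal ℂ g)⁆
      = Submodule.span ℂ {y : g | ∃ a b : g, ⁅a, b⁆ = y} := by
    rw [LieSubmodule.lieIdeal_oper_eq_linear_span']
    simp
  rw [← h]
  rcases LieAlgebra.IsSimple.eq_bot_or_eq_top (R := ℂ) ⁅(⊤ : LieIdeal ℂ g), (⊤ : LieIdeal ℂ g)⁆
    with h0 | h0
  · refine absurd ⟨fun x y => ?_⟩ (LieAlgebra.IsSimple.non_abelian (R := ℂ) (L := g))
    have : ⁅x, y⁆ ∈ ⁅(⊤ : LieIdeal ℂ g), (⊤ : LieIdeal ℂ g)⁆ :=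
      LieSubmodule.lie_mem_lie (LieSubmodule.mem_top x) (LieSubmodule.mem_top y)
    rwa [h0, LieSubmodule.mem_bot] at this
  · rw [h0, LieSubmodule.top_toSubmodule]

variable {V : Type*} [AddCommGroup V] [Module ℂ V] [LieRingModule g V] [LieModule ℂ g V]
  {lam N : ℂ} {ψ ψ' : Correlators g}

/-- Agreement in a neighbourhood of w is required, since some operators enter through their
derivative. -/
lemma polarPart_congr {x : g} {r s : ℕ} {b : Gen g} {C C' : Gen g → ℂ → ℂ} {w : ℂ}
    (h : ∀ c, C c =ᶠ[𝓝 w] C' c) (ζ : ℂ) :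
    polarPart V lam x r s b C ζ w = polarPart V lam x r s b C' ζ w := by
  have h1 : ∀ c, C c w = C' c w := fun c => (h c).eq_of_nhds
  have h2 : ∀ c, deriv (C c) w = deriv (C' c) w := fun c => (h c).deriv_eq
  cases b <;> simp only [polarPart, h1, h2]

lemma injective_vecCons_iff {n : ℕ} {ζ : ℂ} {z : Fin n → ℂ} :
    Function.Injective (vecCons ζ z) ↔ (∀ i, z i ≠ ζ) ∧ Function.Injective z := by
  rw [show vecCons ζ z = (Fin.cons ζ z : Fin (n + 1) → ℂ) from rfl, Fin.cons_injective_iff]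
  simp [eq_comm]

namespace IsConformalBlock

lemma differentiableOn (h : IsConformalBlock V lam ψ) {n : ℕ} (a : Gen g) (A : Fin n → Gen g)
    {z : Fin n → ℂ} (hz : Function.Injective z) :
    DifferentiableOn ℂ (fun ζ => ψ (n + 1) (vecCons a A) (vecCons ζ z)) (Set.range z)ᶜ := by
  obtain ⟨P, m, hP⟩ := h.rational (n + 1) (vecCons a A)
  have hinj : ∀ ζ ∈ (Set.range z)ᶜ, Function.Injective (vecCons ζ z) := fun ζ hζ =>
    injective_vecCons_iff.2 ⟨fun i hi => hζ ⟨i, hi⟩, hz⟩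
  have hcoord : ∀ i, Differentiable ℂ fun ζ => (vecCons ζ z : Fin (n + 1) → ℂ) i := fun i => by
    refine Fin.cases ?_ (fun j => ?_) i
    · exact differentiable_id
    · exact differentiable_const _
  refine DifferentiableOn.congr (f := fun ζ => MvPolynomial.eval (vecCons ζ z) P
    / (∏ i, ∏ j ∈ Finset.Ioi i, ((vecCons ζ z : Fin (n + 1) → ℂ) i - vecCons ζ z j)) ^ m) ?_
    fun ζ hζ => hP _ (hinj ζ hζ)
  refine DifferentiableOn.fun_div ?_ ?_ ?_
  · refine Differentiable.differentiableOn ?_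
    clear hP
    induction P using MvPolynomial.induction_on with
    | C c => simp
    | add p q hp hq => simpa using Differentiable.fun_add hp hq
    | mul_X p i hp => simpa using Differentiable.fun_mul hp (hcoord i)
  · exact (Differentiable.fun_pow (Differentiable.fun_finsetProd fun i _ =>
      Differentiable.fun_finsetProd fun j _ => (hcoord i).fun_sub (hcoord j)) m).differentiableOn
  · intro ζ hζ
    refine pow_ne_zero _ (Finset.prod_ne_zero_iff.2 fun i _ => Finset.prod_ne_zero_iff.2
      fun j hj => sub_ne_zero.2 fun hij => ?_)
    exact (Finset.mem_Ioi.1 hj).ne (hinj ζ hζ hij)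

lemma apply_comp_vecCons (h : IsConformalBlock V lam ψ) {n : ℕ} (σ : Equiv.Perm (Fin n))
    (a : Gen g) (A : Fin n → Gen g) {ζ : ℂ} {z : Fin n → ℂ}
    (hz : Function.Injective (vecCons ζ z)) :
    ψ (n + 1) (vecCons a (A ∘ σ)) (vecCons ζ (z ∘ σ)) = ψ (n + 1) (vecCons a A) (vecCons ζ z) := by
  -- This permutation fixes the first insertion and acts by σ on the others.
  rw [← h.symmetric _ (Equiv.Perm.decomposeFin.symm (0, σ)) _ _ hz]
  congr 1 <;> funext i <;> refine Fin.cases ?_ (fun j => ?_) i <;> simp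

/-- The singular behaviour at coincident points is determined by the correlators with fewer
points. -/
lemma sub_isBigO_one (h : IsConformalBlock V lam ψ) (h' : IsConformalBlock V lam ψ') {n : ℕ}
    (heq : ∀ (A : Fin n → Gen g) (z : Fin n → ℂ), Function.Injective z → ψ n A z = ψ' n A z)
    (x : g) (r s : ℕ) (A : Fin n → Gen g) {z : Fin n → ℂ} (hz : Function.Injective z) (i : Fin n) :
    (fun ζ => ψ (n + 1) (vecCons (J x r s) A) (vecCons ζ z)
      - ψ' (n + 1) (vecCons (J x r s) A) (vecCons ζ z)) =O[𝓝[≠] (z i)] fun _ => (1 : ℂ) := by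
  obtain ⟨k, rfl⟩ : ∃ k, n = k + 1 := ⟨n - 1, by have := i.pos; omega⟩
  -- The swap brings insertion i next to the gluon, where the operator product is available.
  set σ : Equiv.Perm (Fin (k + 1)) := Equiv.swap 0 i
  set B : Fin k → Gen g := fun j => (A ∘ σ) j.succ
  set v : Fin k → ℂ := fun j => (z ∘ σ) j.succ
  have hA : A ∘ σ = vecCons (A i) B := by
    funext j
    refine Fin.cases ?_ (fun j => rfl) j
    simp [σ]
  have hv : z ∘ σ = vecCons (z i) v := by
    funext j
    refine Fin.cases ?_ (fun j => rfl) j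
    simp [σ]
  have hinj : Function.Injective (vecCons (z i) v) := hv ▸ hz.comp σ.injective
  have hC : ∀ c, (fun u => ψ (k + 1) (vecCons c B) (vecCons u v))
      =ᶠ[𝓝 (z i)] fun u => ψ' (k + 1) (vecCons c B) (vecCons u v) := by
    intro c
    obtain ⟨h1, h2⟩ := injective_vecCons_iff.1 hinj
    have : ∀ᶠ u in 𝓝 (z i), ∀ j, v j ≠ u := by
      rw [Filter.eventually_all]
      exact fun j => (eventually_ne_nhds (h1 j).symm).mono fun _ h => h.symm
    filter_upwards [this] with u hu
    exact heq _ _ (injective_vecCons_iff.2 ⟨hu, h2⟩)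
  have key := (h.ope_J k x r s (A i) B (z i) v hinj).sub (h'.ope_J k x r s (A i) B (z i) v hinj)
  refine key.congr' ?_ EventuallyEq.rfl
  filter_upwards [eventually_ne_of_finset Finset.univ z (z i)] with ζ hζ
  have hζ' : Function.Injective (vecCons ζ z) :=
    injective_vecCons_iff.2 ⟨fun j => hζ j (Finset.mem_univ j), hz⟩
  rw [← h.apply_comp_vecCons σ _ _ hζ', ← h'.apply_comp_vecCons σ _ _ hζ', hA, hv,
    polarPart_congr hC]
  ring

/-- A correlator with an insertion of a gluon of positive spin is determined by the correlators with
fewer points. -/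
lemma eq_of_forall_eq (h : IsConformalBlock V lam ψ) (h' : IsConformalBlock V lam ψ') {n : ℕ}
    (heq : ∀ (A : Fin n → Gen g) (z : Fin n → ℂ), Function.Injective z → ψ n A z = ψ' n A z)
    (x : g) {r s : ℕ} (hrs : r + s ≤ 1) (A : Fin n → Gen g) {ζ : ℂ} {z : Fin n → ℂ}
    (hz : Function.Injective (vecCons ζ z)) :
    ψ (n + 1) (vecCons (J x r s) A) (vecCons ζ z)
      = ψ' (n + 1) (vecCons (J x r s) A) (vecCons ζ z) := by
  obtain ⟨hζ, hz⟩ := injective_vecCons_iff.1 hz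
  have hrange : ((Finset.univ.image z : Finset ℂ) : Set ℂ) = Set.range z := by simp
  rw [← sub_eq_zero]
  refine eq_zero_of_isBigO_one_of_tendsto (Finset.univ.image z)
    (f := fun ζ => ψ (n + 1) (vecCons (J x r s) A) (vecCons ζ z)
      - ψ' (n + 1) (vecCons (J x r s) A) (vecCons ζ z)) ?_ ?_ ?_ ζ (by simpa using hζ)
  · rw [hrange]
    exact (h.differentiableOn _ A hz).fun_sub (h'.differentiableOn _ A hz)
  · intro w hw
    obtain ⟨i, _, rfl⟩ := Finset.mem_image.1 hw
    exact h.sub_isBigO_one h' heq x r s A hz i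
  · refine ((h.at_infinity n (J x r s) A z hz).sub (h'.at_infinity n (J x r s) A z hz)).trans_tendsto
      ?_
    -- As r + s ≤ 1, twice the spin is at least 1, so the difference is bounded by a strictly
    -- negative power of ζ.
    obtain ⟨d, hd⟩ : ∃ d : ℕ, -(J x r s).twiceSpin = -((d : ℤ) + 1) :=
      ⟨1 - (r + s), by simp only [twiceSpin]; omega⟩
    simp only [hd, zpow_neg]
    have h1 : Tendsto (fun ζ : ℂ => ζ⁻¹) (cocompact ℂ) (𝓝 0) :=
      Metric.cobounded_eq_cocompact (α := ℂ) ▸ tendsto_inv₀_cobounded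
    have h2 := h1.pow (d + 1)
    rw [zero_pow (Nat.succ_ne_zero d)] at h2
    refine h2.congr fun ζ => ?_
    rw [inv_pow]
    norm_cast

end IsConformalBlock

namespace IsTrRhoSqBlock

/-- For reasons of dimension only J[r,s] with r + s = 4 is at stake. By linearity its colour may be
a bracket of a and b, and then the one-point function is the residue of the two-point function of
J[0,0] and J[r,s] with colours a and b, which is zero. -/
lemma one_point [LieAlgebra.IsSimple ℂ g] (h : IsTrRhoSqBlock V lam N ψ) (a : Gen g)
    (z : Fin 1 → ℂ) : ψ 1 ![a] z = 0 := by
  have hz : Function.Injective z := Function.injective_of_subsingleton z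
  obtain ⟨w, rfl⟩ : ∃ w, z = ![w] := ⟨z 0, by funext i; fin_cases i; rfl⟩
  by_cases hd : a.dim = -4
  swap
  · exact h.dimension 1 _ _ hz (by simpa using hd)
  by_cases ha : a.IsJ
  swap
  · refine h.vanishing 1 _ _ hz ⟨0, ha, ?_⟩
    rintro rfl
    simp [dim] at hd
  obtain ⟨x, r, s, rfl⟩ : ∃ x r s, a = J x r s := ⟨_, _, _, ha.eq⟩
  have hrs : 0 < r + s := by simp only [dim] at hd; omega
  have hlin := fun c x y => h.linear_J 0 ![] ![w] c x y r s hz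
  have h0 : ψ 1 ![J 0 r s] ![w] = 0 := by
    have := hlin 1 0 0
    rw [one_smul, add_zero, one_mul, left_eq_add] at this
    exact this
  let W : Submodule ℂ g :=
    { carrier := {x | ψ 1 ![J x r s] ![w] = 0}
      add_mem' := fun {x y} hx hy => by
        have := hlin 1 x y
        rw [Set.mem_ofPred_eq] at hx hy ⊢
        rwa [one_smul, hx, hy, mul_zero, add_zero] at this
      zero_mem' := h0
      smul_mem' := fun c x hx => by
        have := hlin c x 0
        rw [Set.mem_ofPred_eq] at hx ⊢
        rwa [add_zero, hx, h0, mul_zero, add_zero] at this }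
  suffices W = ⊤ from (this ▸ Submodule.mem_top : x ∈ W)
  rw [eq_top_iff, ← span_lie_eq_top, Submodule.span_le]
  rintro _ ⟨a, b, rfl⟩
  show ψ 1 ![J ⁅a, b⁆ r s] ![w] = 0
  have hE : ∀ (t u : ℕ) (hp : 0 < t + u), ψ 1 ![E t u hp] ![w] = 0 := fun t u hp =>
    h.vanishing 1 _ _ hz ⟨0, id, by simp⟩
  refine eq_zero_of_div_isBigO_one (w := w) ?_
  have key := (h.ope_J 0 a 0 0 (J b r s) ![] w ![] hz).neg_left
  refine key.congr' ?_ EventuallyEq.rfl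
  filter_upwards [self_mem_nhdsWithin] with ζ hζ
  rw [h.two_point_other _ _ _ (injective_vecCons_iff.2 ⟨by simpa [eq_comm] using hζ, hz⟩) (by simp)]
  simp [polarPart, hE]

/-- The conformal block of `(tr ρ)²` is determined by its normalisation. -/
theorem eq [LieAlgebra.IsSimple ℂ g] (h : IsTrRhoSqBlock V lam N ψ)
    (h' : IsTrRhoSqBlock V lam N ψ') (n : ℕ) (A : Fin n → Gen g) (z : Fin n → ℂ)
    (hz : Function.Injective z) : ψ n A z = ψ' n A z := by
  induction n with
  | zero => rw [h.dimension 0 A z hz (by simp), h'.dimension 0 A z hz (by simp)]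
  | succ n ih =>
    by_cases hbad : ∃ i, ¬(A i).IsJ ∧ A i ≠ F 0 0
    · rw [h.vanishing _ A z hz hbad, h'.vanishing _ A z hz hbad]
    by_cases hdim : ∑ i, (A i).dim = -4
    swap
    · rw [h.dimension _ A z hz hdim, h'.dimension _ A z hz hdim]
    match n, A, z, hz, ih, hbad, hdim with
    | 0, A, z, hz, _, _, _ =>
      obtain ⟨a, rfl⟩ : ∃ a, A = ![a] := ⟨A 0, by funext i; fin_cases i; rfl⟩
      rw [h.one_point, h'.one_point]
    | 1, A, z, hz, _, _, _ =>
      obtain ⟨a, b, rfl⟩ : ∃ a b, A = ![a, b] := ⟨A 0, A 1, by funext i; fin_cases i <;> rfl⟩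
      by_cases hab : a = F 0 0 ∧ b = F 0 0
      · rw [hab.1, hab.2, h.two_point z hz, h'.two_point z hz]
      · rw [h.two_point_other a b z hz hab, h'.two_point_other a b z hz hab]
    | n + 2, A, z, hz, ih, hbad, hdim =>
      -- Otherwise all insertions are F[0,0] or gluons with r + s ≥ 2, each of dimension at most −2,
      -- and three or more of them add up to at most −6.
      obtain ⟨i, x, r, s, hi, hrs⟩ : ∃ i x r s, A i = J x r s ∧ r + s ≤ 1 := by
        by_contra! hcon
        have hle : ∀ i ∈ Finset.univ, (A i).dim ≤ -2 := by
          intro i _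
          by_cases hJ : (A i).IsJ
          · have h1 := hcon i _ _ _ hJ.eq
            rw [hJ.eq]
            simp only [dim]
            omega
          · have : A i = F 0 0 := by
              by_contra hF
              exact hbad ⟨i, hJ, hF⟩
            rw [this]
            simp [dim]
        have := Finset.sum_le_card_nsmul _ _ _ hle
        rw [hdim, Finset.card_univ, Fintype.card_fin, nsmul_eq_mul] at this
        push_cast at this
        omega
      rw [← h.symmetric _ (Equiv.swap 0 i) A z hz, ← h'.symmetric _ (Equiv.swap 0 i) A z hz]
      have hA : A ∘ Equiv.swap 0 i = vecCons (J x r s) fun j => (A ∘ Equiv.swap 0 i) j.succ := by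
        funext j
        refine Fin.cases ?_ (fun j => rfl) j
        simp [hi]
      have hz' : z ∘ Equiv.swap 0 i = vecCons (z i) fun j => (z ∘ Equiv.swap 0 i) j.succ := by
        funext j
        refine Fin.cases ?_ (fun j => rfl) j
        simp
      rw [hA, hz']
      exact h.eq_of_forall_eq h'.toIsConformalBlock ih x hrs _
        (hz' ▸ hz.comp (Equiv.injective _))

end IsTrRhoSqBlock

end Uniqueness

/-! ### The amplitude as a sum over orderings -/

section Permutations

variable {ι : Type*}

lemma pairSum_ofFn (F : ι → ι → ℂ) {n : ℕ} (v : Fin n → ι) :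
    pairSum F (List.ofFn v) = ∑ i, ∑ j ∈ Finset.Ioi i, F (v i) (v j) := by
  induction n with
  | zero => simp [pairSum]
  | succ n ih =>
    rw [List.ofFn_succ, pairSum, ih]
    simp only [Fin.sum_univ_succ, Fin.sum_Ioi_zero, Fin.sum_Ioi_succ, List.map_ofFn, List.sum_ofFn]
    rfl

lemma tripleSum_ofFn (F : ι → ι → ι → ℂ) {n : ℕ} (v : Fin n → ι) :
    tripleSum F (List.ofFn v)
      = ∑ i, ∑ j ∈ Finset.Ioi i, ∑ k ∈ Finset.Ioi j, F (v i) (v j) (v k) := by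
  induction n with
  | zero => simp [tripleSum]
  | succ n ih =>
    rw [List.ofFn_succ, tripleSum, ih, pairSum_ofFn]
    simp only [Fin.sum_univ_succ, Fin.sum_Ioi_zero, Fin.sum_Ioi_succ]

lemma quadSum_ofFn (F : ι → ι → ι → ι → ℂ) {n : ℕ} (v : Fin n → ι) :
    quadSum F (List.ofFn v) = ∑ i, ∑ j ∈ Finset.Ioi i, ∑ k ∈ Finset.Ioi j, ∑ l ∈ Finset.Ioi k,
      F (v i) (v j) (v k) (v l) := by
  induction n with
  | zero => simp [quadSum]
  | succ n ih =>
    rw [List.ofFn_succ, quadSum, ih, tripleSum_ofFn]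
    simp only [Fin.sum_univ_succ, Fin.sum_Ioi_zero, Fin.sum_Ioi_succ]

lemma path_ofFn_append_singleton (z : ι → ℂ) {n : ℕ} (v : Fin (n + 1) → ι) (c : ι) :
    path z (List.ofFn v ++ [c])
      = (∏ i : Fin n, (z (v i.castSucc) - z (v i.succ))) * (z (v (Fin.last n)) - z c) := by
  induction n with
  | zero => simp [path]
  | succ n ih =>
    have h := ih fun i => v i.succ
    rw [List.ofFn_succ] at h
    rw [List.ofFn_succ, List.ofFn_succ, List.cons_append, List.cons_append, path,
      ← List.cons_append, h, Fin.prod_univ_succ, mul_assoc]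
    rfl

lemma cyc_ofFn (z : ι → ℂ) {n : ℕ} (v : Fin n → ι) :
    cyc z (List.ofFn v) = ∏ i, (z (v i) - z (v (finRotate n i))) := by
  rcases n with _ | n
  · simp [cyc]
  · have h := path_ofFn_append_singleton z v (v 0)
    rw [List.ofFn_succ] at h
    rw [List.ofFn_succ, cyc, h, Fin.prod_univ_castSucc, finRotate_last]
    congr 1
    refine Finset.prod_congr rfl fun i _ => ?_
    rw [finRotate_apply, Fin.coeSucc_eq_succ]

lemma sum_orderings_univ {n : ℕ} (f : List (Fin n) → ℂ) :
    ∑ l ∈ orderings Finset.univ, f l = ∑ σ : Equiv.Perm (Fin n), f (List.ofFn σ) := by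
  symm
  refine Finset.sum_nbij (fun σ => List.ofFn σ) (fun σ _ => ?_) (fun σ _ τ _ h => ?_)
    (fun l hl => ?_) fun _ _ => rfl
  · rw [mem_orderings]
    exact ⟨List.nodup_ofFn.2 σ.injective, fun a => by simpa using σ.surjective a⟩
  · exact Equiv.coe_fn_injective (List.ofFn_injective h)
  · obtain ⟨h1, h2⟩ := mem_orderings.1 hl
    have hlen : l.length = n := by
      rw [← List.toFinset_card_of_nodup h1,
        show l.toFinset = Finset.univ by ext a; simp [h2], Finset.card_univ, Fintype.card_fin]
    have hinj : Function.Injective fun i : Fin n => l.get (i.cast hlen.symm) :=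
      (List.nodup_iff_injective_get.1 h1).comp (Fin.cast_injective _)
    exact ⟨Equiv.ofBijective _ (Finite.injective_iff_bijective.1 hinj),
      Finset.mem_coe.2 (Finset.mem_univ _), List.ext_getElem (by simp [hlen]) (by simp)⟩

variable {g : Type*} [LieRing g] [LieAlgebra ℂ g]

lemma allPlusAmplitude_eq_singleTrace (R : Type*) [AddCommGroup R] [Module ℂ R] [LieRingModule g R]
    [LieModule ℂ g R] (n : ℕ) (x : Fin n → g) (μ : Fin n → Fin 2 → ℂ) (z : Fin n → ℂ) :
    allPlusAmplitude R n x μ z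
      = singleTrace (gaugeTrace R) Finset.univ x z (square μ) (square μ) := by
  rw [allPlusAmplitude, singleTrace, Finset.card_univ, Fintype.card_fin, sum_orderings_univ]
  congr 1
  refine Finset.sum_congr rfl fun σ _ => ?_
  rw [colourOrderedAmplitude, numerator, quadSum_ofFn, cyc_ofFn, List.map_ofFn, div_mul_eq_mul_div]
  rfl

lemma isConserved_square {n : ℕ} {μ : Fin n → Fin 2 → ℂ} {z : Fin n → ℂ}
    (h : ∀ α : Fin 2, ∑ i, μ i α = 0 ∧ ∑ i, z i * μ i α = 0) :
    IsConserved Finset.univ z (square μ) where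
  antisymm i j := by simp only [square]; ring
  sum_eq_zero i _ := by
    simp only [square]
    rw [Finset.sum_sub_distrib, ← Finset.mul_sum, ← Finset.mul_sum, (h 0).1, (h 1).1]
    ring
  sum_mul_eq_zero i _ := by
    have : ∀ j, z j * square μ i j = μ i 0 * (z j * μ j 1) - μ i 1 * (z j * μ j 0) := fun j => by
      simp only [square]; ring
    simp only [this]
    rw [Finset.sum_sub_distrib, ← Finset.mul_sum, ← Finset.mul_sum, (h 0).2, (h 1).2]
    ring

/-- Only the square of the coupling enters, so the branch of the power 3/2 does not matter. -/
lemma axionCoupling_sq (lam : ℂ) :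
    axionCoupling lam ^ 2 = lam ^ 2 / ((2 * Real.pi * Complex.I) ^ 3 * 12) := by
  have h1 : ((2 * Real.pi * Complex.I : ℂ) ^ (3 / 2 : ℂ)) ^ 2 = (2 * Real.pi * Complex.I) ^ 3 := by
    rw [← Complex.cpow_nat_mul]
    norm_num
  have h2 : ((Real.sqrt 12 : ℝ) : ℂ) ^ 2 = 12 := by
    rw [← Complex.ofReal_pow, Real.sq_sqrt (by norm_num)]
    norm_num
  rw [axionCoupling, div_pow, mul_pow, h1, h2]

end Permutations

open Gen

/-! ### Summation over modes -/

section GeneratingFunction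

variable {ι : Type*} [DecidableEq ι]

/-- The mode numbers with a single excitation of each kind. -/
def unitMode (a b k : ι) : ℕ × ℕ := (if a = k then 1 else 0, if b = k then 1 else 0)

lemma exists_of_sum_eq_one {S : Finset ι} {f : ι → ℕ} (h : ∑ i ∈ S, f i = 1) :
    ∃ a ∈ S, ∀ k ∈ S, f k = if a = k then 1 else 0 := by
  obtain ⟨a, ha, h0⟩ := Finset.exists_ne_zero_of_sum_ne_zero (h ▸ one_ne_zero)
  have hs := Finset.add_sum_erase S f ha
  have h1 : f a = 1 := by omega
  have h2 : ∑ i ∈ S.erase a, f i = 0 := by omega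
  refine ⟨a, ha, fun k hk => ?_⟩
  split_ifs with hak
  · rw [← hak, h1]
  · exact Finset.sum_eq_zero_iff.1 h2 k (Finset.mem_erase.2 ⟨Ne.symm hak, hk⟩)

lemma unitMode_eq_iff {S : Finset ι} {a b a' b' : ι} (ha : a ∈ S) (hb : b ∈ S) :
    (∀ k ∈ S, unitMode a b k = unitMode a' b' k) ↔ a' = a ∧ b' = b := by
  constructor
  · intro h
    have h1 := congrArg Prod.fst (h a ha)
    have h2 := congrArg Prod.snd (h b hb)
    simp only [unitMode, if_true] at h1 h2
    exact ⟨by by_contra hc; rw [if_neg hc] at h1; omega,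
      by by_contra hc; rw [if_neg hc] at h2; omega⟩
  · rintro ⟨rfl, rfl⟩ k _
    rfl

variable {g : Type*} [LieRing g] [LieAlgebra ℂ g]
variable {V : Type*} [AddCommGroup V] [Module ℂ V] [LieRingModule g V] [LieModule ℂ g V] {lam : ℂ}

/-- The gluons with the given colours and mode numbers. -/
def gluons (x : ι → g) (m : ι → ℕ × ℕ) (i : ι) : Gen g := J (x i) (m i).1 (m i).2

/-- Unit mode sums mean that one label a carries the first excitation and one label b the second;
the pairing then collapses to z a − z b. Writing this as a sum of indicators, with at most one
nonzero term, prepares the summation over m. -/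
lemma component_gluons (S : Finset ι) (x : ι → g) (m : ι → ℕ × ℕ) (z : ι → ℂ) :
    component V lam S (gluons x m) z = -axionCoupling lam * parkeTaylor (repTrace V) S x z *
      ∑ a ∈ S, ∑ b ∈ S, if ∀ k ∈ S, m k = unitMode a b k then z a - z b else 0 := by
  have hJ : ∀ i ∈ S, (gluons x m i).IsJ := fun _ _ => trivial
  by_cases hu : HasUnitModes S (gluons x m)
  · rw [component_of_isJ hJ hu]
    obtain ⟨a, ha, h1⟩ := exists_of_sum_eq_one hu.1
    obtain ⟨b, hb, h2⟩ := exists_of_sum_eq_one hu.2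
    have hm : ∀ k ∈ S, m k = unitMode a b k := fun k hk => Prod.ext (h1 k hk) (h2 k hk)
    have e : ∀ a' b', (∀ k ∈ S, m k = unitMode a' b' k) ↔ a' = a ∧ b' = b := fun a' b' => by
      rw [← unitMode_eq_iff ha hb]
      exact forall₂_congr fun k hk => by rw [hm k hk]
    have hp : pairing S z (modePairing (gluons x m)) = z a - z b := by
      have : ∀ i ∈ S, ∀ j ∈ S, modePairing (gluons x m) i j * (z i - z j)
          = (if a = i then if b = j then z i - z j else 0 else 0)
            - if b = i then if a = j then z i - z j else 0 else 0 := by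
        intro i hi j hj
        rw [modePairing, h1 i hi, h1 j hj, h2 i hi, h2 j hj]
        split_ifs <;> simp
      rw [pairing, Finset.sum_congr rfl fun i hi => Finset.sum_congr rfl (this i hi)]
      simp only [Finset.sum_sub_distrib, Finset.sum_ite_irrel, Finset.sum_const_zero,
        Finset.sum_ite_eq, ha, hb, if_true]
      ring
    rw [hp]
    have hs : ∑ a' ∈ S, ∑ b' ∈ S, (if ∀ k ∈ S, m k = unitMode a' b' k then z a' - z b' else 0)
        = z a - z b := by
      simp only [e, ite_and, Finset.sum_ite_irrel, Finset.sum_const_zero, Finset.sum_ite_eq', ha,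
        hb, if_true]
    rw [hs]
    simp only [gluons, colour]
    ring
  · rw [component_of_not_hasUnitModes hJ hu, Finset.sum_eq_zero, mul_zero]
    refine fun a ha => Finset.sum_eq_zero fun b hb => if_neg fun h => hu ⟨?_, ?_⟩
    · rw [Finset.sum_congr rfl fun k hk => show (gluons x m k).mode₁ = if a = k then 1 else 0 by
        rw [gluons, h k hk]; rfl, Finset.sum_ite_eq, if_pos ha]
    · rw [Finset.sum_congr rfl fun k hk => show (gluons x m k).mode₂ = if b = k then 1 else 0 by
        rw [gluons, h k hk]; rfl, Finset.sum_ite_eq, if_pos hb]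

/-- By antisymmetry of z a − z b the two halves of the square bracket contribute equally, which
absorbs the factor 1/2. -/
lemma pairing_square {n : ℕ} (S : Finset (Fin n)) (μ : Fin n → Fin 2 → ℂ) (z : Fin n → ℂ) :
    pairing S z (square μ) = ∑ a ∈ S, ∑ b ∈ S, (z a - z b) * (μ a 0 * μ b 1) := by
  have h : ∑ a ∈ S, ∑ b ∈ S, (z a - z b) * (μ a 1 * μ b 0)
      = -∑ a ∈ S, ∑ b ∈ S, (z a - z b) * (μ a 0 * μ b 1) := by
    rw [Finset.sum_comm, ← Finset.sum_neg_distrib]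
    refine Finset.sum_congr rfl fun a _ => ?_
    rw [← Finset.sum_neg_distrib]
    exact Finset.sum_congr rfl fun b _ => by ring
  have h' : ∑ a ∈ S, ∑ b ∈ S, square μ a b * (z a - z b)
      = ∑ a ∈ S, ∑ b ∈ S, (z a - z b) * (μ a 0 * μ b 1)
        - ∑ a ∈ S, ∑ b ∈ S, (z a - z b) * (μ a 1 * μ b 0) := by
    simp only [← Finset.sum_sub_distrib]
    exact Finset.sum_congr rfl fun a _ => Finset.sum_congr rfl fun b _ => by
      rw [square]; ring
  rw [pairing, h', h]
  ring

/-- The coefficient of the modes `m` in the generating function. -/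
noncomputable def modeWeight {n : ℕ} (μ : Fin n → Fin 2 → ℂ) (m : Fin n → ℕ × ℕ) : ℂ :=
  ∏ i, μ i 0 ^ (m i).1 * μ i 1 ^ (m i).2 / (((m i).1)! * ((m i).2)!)

/-- The labels a, c carrying the first kind of mode differ, as do b, d, so no mode number exceeds 1
and all factorials are 1. -/
lemma modeWeight_unitMode_add {n : ℕ} (μ : Fin n → Fin 2 → ℂ) {a b c d : Fin n} (hac : a ≠ c)
    (hbd : b ≠ d) : modeWeight μ (fun k => unitMode a b k + unitMode c d k)
      = (μ a 0 * μ b 1) * (μ c 0 * μ d 1) := by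
  have h1 : ∀ {a c : Fin n}, a ≠ c → ∀ k,
      ((if a = k then 1 else 0) + if c = k then 1 else 0 : ℕ)! = 1 := by
    intro a c hac k
    split_ifs with h h'
    · exact absurd (h.trans h'.symm) hac
    all_goals rfl
  simp only [modeWeight, unitMode, Prod.fst_add, Prod.snd_add, h1 hac, h1 hbd, Nat.cast_one,
    mul_one, div_one, pow_add, Finset.prod_mul_distrib, Finset.prod_pow_boole, Finset.mem_univ,
    if_true]
  ring

/-- The modes that contribute to the generating function. -/
def unitModes (n : ℕ) : Finset (Fin n → ℕ × ℕ) :=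
  Fintype.piFinset fun _ => Finset.range 2 ×ˢ Finset.range 2

lemma modes_eq_iff {n : ℕ} {S : Finset (Fin n)} {a b c d : Fin n} (ha : a ∈ S) (hb : b ∈ S)
    (hc : c ∈ Sᶜ) (hd : d ∈ Sᶜ) (m : Fin n → ℕ × ℕ) :
    ((∀ k ∈ S, m k = unitMode a b k) ∧ ∀ k ∈ Sᶜ, m k = unitMode c d k)
      ↔ m = fun k => unitMode a b k + unitMode c d k := by
  have h0 : ∀ {T : Finset (Fin n)} {c d : Fin n}, c ∉ T → d ∉ T → ∀ k ∈ T,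
      unitMode c d k = 0 := by
    intro T c d hc hd k hk
    rw [unitMode, if_neg (show c ≠ k from fun h => hc (h ▸ hk)),
      if_neg (show d ≠ k from fun h => hd (h ▸ hk))]
    rfl
  have h1 : ∀ k ∈ S, unitMode c d k = 0 :=
    h0 (Finset.mem_compl.1 hc) (Finset.mem_compl.1 hd)
  have h2 : ∀ k ∈ Sᶜ, unitMode a b k = 0 :=
    h0 (fun h => Finset.mem_compl.1 h ha) fun h => Finset.mem_compl.1 h hb
  constructor
  · rintro ⟨e1, e2⟩
    funext k
    by_cases hk : k ∈ S
    · rw [e1 k hk, h1 k hk, add_zero]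
    · rw [e2 k (Finset.mem_compl.2 hk), h2 k (Finset.mem_compl.2 hk), zero_add]
  · rintro rfl
    exact ⟨fun k hk => by simp only [h1 k hk, add_zero],
      fun k hk => by simp only [h2 k hk, zero_add]⟩

lemma unitMode_add_mem_unitModes {n : ℕ} {a b c d : Fin n} (hac : a ≠ c) (hbd : b ≠ d) :
    (fun k => unitMode a b k + unitMode c d k) ∈ unitModes n := by
  rw [unitModes, Fintype.mem_piFinset]
  intro k
  have h : ∀ {a c : Fin n}, a ≠ c →
      ((if a = k then 1 else 0) + if c = k then 1 else 0 : ℕ) < 2 := by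
    intro a c hac
    split_ifs with h h'
    · exact absurd (h.trans h'.symm) hac
    all_goals norm_num
  exact Finset.mem_product.2 ⟨Finset.mem_range.2 (h hac), Finset.mem_range.2 (h hbd)⟩

lemma component_mul_component_gluons {n : ℕ} (S : Finset (Fin n)) (x : Fin n → g)
    (m : Fin n → ℕ × ℕ) (z : Fin n → ℂ) :
    component V lam S (gluons x m) z * component V lam Sᶜ (gluons x m) z
      = axionCoupling lam ^ 2 * (parkeTaylor (repTrace V) S x z * parkeTaylor (repTrace V) Sᶜ x z) *
        ∑ a ∈ S, ∑ b ∈ S, ∑ c ∈ Sᶜ, ∑ d ∈ Sᶜ,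
          if m = fun k => unitMode a b k + unitMode c d k then (z a - z b) * (z c - z d) else 0 := by
  rw [component_gluons, component_gluons, mul_mul_mul_comm, Finset.sum_mul]
  congr 1
  · ring
  refine Finset.sum_congr rfl fun a ha => ?_
  rw [Finset.sum_mul]
  refine Finset.sum_congr rfl fun b hb => ?_
  rw [Finset.mul_sum]
  refine Finset.sum_congr rfl fun c hc => ?_
  rw [Finset.mul_sum]
  refine Finset.sum_congr rfl fun d hd => ?_
  rw [← if_congr (modes_eq_iff ha hb hc hd m) rfl rfl, ite_and]
  split_ifs <;> simp

/-- Each choice of excited labels a, b in S and c, d in the complement selects one m, weighted by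
the matching momentum components. Summing over the choices rebuilds the two pairings of square
brackets. -/
lemma sum_modeWeight_mul {n : ℕ} (S : Finset (Fin n)) (x : Fin n → g) (μ : Fin n → Fin 2 → ℂ)
    (z : Fin n → ℂ) :
    ∑ m ∈ unitModes n, modeWeight μ m *
        (component V lam S (gluons x m) z * component V lam Sᶜ (gluons x m) z)
      = axionCoupling lam ^ 2 * ((parkeTaylor (repTrace V) S x z * pairing S z (square μ)) *
        (parkeTaylor (repTrace V) Sᶜ x z * pairing Sᶜ z (square μ))) := by
  have h : ∀ a ∈ S, ∀ b ∈ S, ∀ c ∈ Sᶜ, ∀ d ∈ Sᶜ, ∑ m ∈ unitModes n, modeWeight μ m *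
      (if m = fun k => unitMode a b k + unitMode c d k then (z a - z b) * (z c - z d) else 0)
      = ((z a - z b) * (μ a 0 * μ b 1)) * ((z c - z d) * (μ c 0 * μ d 1)) := by
    intro a ha b hb c hc d hd
    have hac : a ≠ c := fun h => Finset.mem_compl.1 hc (h ▸ ha)
    have hbd : b ≠ d := fun h => Finset.mem_compl.1 hd (h ▸ hb)
    simp only [mul_ite, mul_zero]
    rw [Finset.sum_ite_eq', if_pos (unitMode_add_mem_unitModes hac hbd),
      modeWeight_unitMode_add μ hac hbd]
    ring
  have h' : ∑ m ∈ unitModes n, modeWeight μ m * ∑ a ∈ S, ∑ b ∈ S, ∑ c ∈ Sᶜ, ∑ d ∈ Sᶜ,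
      (if m = fun k => unitMode a b k + unitMode c d k then (z a - z b) * (z c - z d) else 0)
      = pairing S z (square μ) * pairing Sᶜ z (square μ) := by
    simp only [Finset.mul_sum]
    rw [pairing_square, pairing_square, Finset.sum_comm, Finset.sum_mul]
    refine Finset.sum_congr rfl fun a ha => ?_
    rw [Finset.sum_comm, Finset.sum_mul]
    refine Finset.sum_congr rfl fun b hb => ?_
    rw [Finset.sum_comm, Finset.mul_sum]
    refine Finset.sum_congr rfl fun c hc => ?_
    rw [Finset.sum_comm, Finset.mul_sum]
    exact Finset.sum_congr rfl fun d hd => h a ha b hb c hc d hd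
  simp only [component_mul_component_gluons, mul_left_comm (modeWeight μ _)]
  rw [← Finset.mul_sum, h']
  ring

lemma mem_unitModes_of_component_ne_zero {n : ℕ} {S : Finset (Fin n)} {x : Fin n → g}
    {m : Fin n → ℕ × ℕ} {z : Fin n → ℂ}
    (h : component V lam S (gluons x m) z * component V lam Sᶜ (gluons x m) z ≠ 0) :
    m ∈ unitModes n := by
  rw [component_mul_component_gluons] at h
  obtain ⟨a, ha, h⟩ := Finset.exists_ne_zero_of_sum_ne_zero (right_ne_zero_of_mul h)
  obtain ⟨b, hb, h⟩ := Finset.exists_ne_zero_of_sum_ne_zero h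
  obtain ⟨c, hc, h⟩ := Finset.exists_ne_zero_of_sum_ne_zero h
  obtain ⟨d, hd, h⟩ := Finset.exists_ne_zero_of_sum_ne_zero h
  rw [(ite_ne_right_iff.1 h).1]
  exact unitMode_add_mem_unitModes (fun h => Finset.mem_compl.1 hc (h ▸ ha))
    fun h => Finset.mem_compl.1 hd (h ▸ hb)

variable {N : ℂ}

lemma mem_unitModes_of_axionBlock_ne_zero {n : ℕ} {x : Fin n → g} {m : Fin n → ℕ × ℕ}
    {z : Fin n → ℂ} (h : axionBlock V lam N n (gluons x m) z ≠ 0) : m ∈ unitModes n := by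
  obtain ⟨S, _, hS⟩ := Finset.exists_ne_zero_of_sum_ne_zero (right_ne_zero_of_mul h)
  exact mem_unitModes_of_component_ne_zero hS

lemma sum_modeWeight_mul_axionBlock {n : ℕ} (x : Fin n → g) (μ : Fin n → Fin 2 → ℂ)
    (z : Fin n → ℂ) :
    ∑ m ∈ unitModes n, modeWeight μ m * axionBlock V lam N n (gluons x m) z
      = N / 2 * axionCoupling lam ^ 2 *
        doubleTrace (repTrace V) Finset.univ x z (square μ) (square μ) := by
  simp only [axionBlock, mul_left_comm (modeWeight μ _)]
  rw [← Finset.mul_sum, mul_assoc]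
  congr 1
  simp only [Finset.mul_sum]
  rw [Finset.sum_comm, doubleTrace, Finset.powerset_univ, Finset.mul_sum]
  refine Finset.sum_congr rfl fun S _ => ?_
  rw [sum_modeWeight_mul, Finset.compl_eq_univ_sdiff]

end GeneratingFunction

end AxionChiralAlgebra

/-! ### Assembly of the theorem -/

theorem mainTheorem6
    {g : Type*} [LieRing g] [LieAlgebra ℂ g] [FiniteDimensional ℂ g] [LieAlgebra.IsSimple ℂ g]
    {V : Type*} [AddCommGroup V] [Module ℂ V] [LieRingModule g V] [LieModule ℂ g V]
    [FiniteDimensional ℂ V]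
    {R : Type*} [AddCommGroup R] [Module ℂ R] [LieRingModule g R] [LieModule ℂ g R]
    [FiniteDimensional ℂ R]
    (lam : ℂ)
    (hlam : ∀ X : g, AxionChiralAlgebra.gaugeTrace R [X, X, X, X]
      = lam ^ 2 * AxionChiralAlgebra.trPair V X X ^ 2)
    (N : ℂ) :
    (∃ ψ : AxionChiralAlgebra.Correlators g, AxionChiralAlgebra.IsTrRhoSqBlock V lam N ψ) ∧
    ∀ ψ : AxionChiralAlgebra.Correlators g, AxionChiralAlgebra.IsTrRhoSqBlock V lam N ψ →
      ∀ (n : ℕ) (x : Fin n → g) (μ : Fin n → Fin 2 → ℂ) (z : Fin n → ℂ),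
        Function.Injective z →
        (∀ α : Fin 2, ∑ i, μ i α = 0 ∧ ∑ i, z i * μ i α = 0) →
        {m : Fin n → ℕ × ℕ |
            ψ n (fun i => AxionChiralAlgebra.Gen.J (x i) (m i).1 (m i).2) z ≠ 0}.Finite ∧
        AxionChiralAlgebra.generatingCorrelator ψ n x μ z
          = N / (24 * (2 * Real.pi * Complex.I) ^ 3)
              * AxionChiralAlgebra.allPlusAmplitude R n x μ z := by
  classical
  refine ⟨⟨_, AxionChiralAlgebra.isTrRhoSqBlock_axionBlock⟩, fun ψ hψ n x μ z hz hμ => ?_⟩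
  have hψ' : ∀ m : Fin n → ℕ × ℕ, ψ n (fun i => AxionChiralAlgebra.Gen.J (x i) (m i).1 (m i).2) z
      = AxionChiralAlgebra.axionBlock V lam N n (AxionChiralAlgebra.gluons x m) z := fun m =>
    hψ.eq AxionChiralAlgebra.isTrRhoSqBlock_axionBlock n _ z hz
  have hsub : ∀ m : Fin n → ℕ × ℕ,
      ψ n (fun i => AxionChiralAlgebra.Gen.J (x i) (m i).1 (m i).2) z ≠ 0 →
        m ∈ AxionChiralAlgebra.unitModes n := fun m hm =>
    AxionChiralAlgebra.mem_unitModes_of_axionBlock_ne_zero (hψ' m ▸ hm)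
  refine ⟨(AxionChiralAlgebra.unitModes n).finite_toSet.subset hsub, ?_⟩
  have hcons := AxionChiralAlgebra.isConserved_square hμ
  rw [AxionChiralAlgebra.allPlusAmplitude_eq_singleTrace,
    AxionChiralAlgebra.singleTrace_eq_doubleTrace (AxionChiralAlgebra.isColourTrace_gaugeTrace R)
      (AxionChiralAlgebra.isColourTrace_repTrace V) (AxionChiralAlgebra.permSum_gaugeTrace hlam)
      Finset.univ hz.injOn x hcons hcons,
    AxionChiralAlgebra.generatingCorrelator,
    finsum_eq_sum_of_support_subset (s := AxionChiralAlgebra.unitModes n) _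
      fun m hm => hsub m (right_ne_zero_of_mul hm)]
  simp only [hψ']
  refine (AxionChiralAlgebra.sum_modeWeight_mul_axionBlock x μ z).trans ?_
  -- The constants are (N/2) · λ² / (12 (2πi)³) = N λ² / (24 (2πi)³), and λ² is absorbed by the
  -- on-shell identity.
  rw [AxionChiralAlgebra.axionCoupling_sq, div_mul_div_comm, mul_left_comm (2 : ℂ),
    show (2 : ℂ) * 12 = 24 by norm_num, mul_comm _ (24 : ℂ)]
  ring
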